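/- Let $\Omega=\mathbb R^2$ or $\Omega=\mathbb R^2/\mathbb Z^2$, let $0<T^*\le\infty$, and let $\theta$ be a classical solution on $\Omega\times[0,T^*)$ of the surface quasi-geostrophic equation $$\partial_t\theta+u\cdot\nabla\theta=0,\qquad u=\nabla^\perp\psi=(-\partial_{x_2}\psi,\partial_{x_1}\psi),\qquad \psi=(-\Delta)^{-1/2}\theta,\qquad \theta(\cdot,0)=\theta_0 .$$ Here $\theta\in C^1(\Omega\times[0,T^*))$, the norm $\|\theta(\cdot,t)\|_{L^1(\Omega)}+\|\theta(\cdot,t)\|_{L^\infty(\Omega)}$ is bounded on $[0,T']$ for every $T'<T^*$, and $\psi(\cdot,t)\in C^1(\Omega)$ for every $t$; the operator $(-\Delta)^{-1/2}$ is convolution with $\frac1{2\pi|x|}$ on $\mathbb R^2$, and the Fourier multiplier $\hat\psi(k)=\hat\theta(k)/(2\pi|k|)$ for $k\ne0$, $\hat\psi(0)=0$, on the torus. (Functions on the torus are regarded as $\mathbb Z^2$-periodic functions on $\mathbb R^2$.) Let $a<b$ and let $\varphi_1,\varphi_2\in C^1([a,b]\times[0,T^*))$ be real-valued functions whose graphs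 $x_2=\varphi_i(x_1,t)$ are nondegenerate level curves of $\theta$: there are constants $g_1,g_2$ with $$\theta(x_1,\varphi_i(x_1,t),t)=g_i,\qquad \partial_{x_2}\theta(x_1,\varphi_i(x_1,t),t)\neq0\qquad(x_1\in[a,b],\ t\in[0,T^*)).$$ Put $\delta(x_1,t)=|\varphi_2(x_1,t)-\varphi_1(x_1,t)|$ and $\delta(t)=\min_{x_1\in[a,b]}\delta(x_1,t)$. Suppose that the two curves form a semi-uniform front, that is, for some constant $c>0$, $$\min_{x_1\in[a,b]}\delta(x_1,t)\ \ge\ c\,\max_{x_1\in[a,b]}\delta(x_1,t)\qquad\text{for all }t\in[0,T^*),$$ and that $\delta(0)>0$. Then $$\delta(t)>e^{-e^{At+B}}\qquad\text{for all }t\in[0,T^*),$$ with real constants $A,B$ that depend only on the length $b-a$ of the front, the semi-uniformity constant $c$, the initial thickness $\delta(0)$, and the norm $\|\theta_0\|_{L^1(\Omega)}+\|\theta_0\|_{L^\infty(\Omega)}$. -/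

import Mathlib

open MeasureTheory Set
open scoped ENNReal NNReal

noncomputable section

namespace QG

/-- The spatial domain: the plane `ℝ²` or the torus `ℝ²/ℤ²`. Functions on the torus are
represented by `ℤ²`-periodic functions on `ℝ × ℝ`. -/
inductive Domain
  | plane
  | torus

/-- The unit square, a fundamental domain of the torus. -/
def unitSquare : Set (ℝ × ℝ) := Ico (0 : ℝ) 1 ×ˢ Ico (0 : ℝ) 1

/-- Lebesgue measure of the domain. -/
def Domain.measure : Domain → Measure (ℝ × ℝ)
  | .plane => volume
  | .torus => volume.restrict unitSquare

/-- `f : ℝ × ℝ → ℝ` is a function on the domain. -/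
def Domain.IsFunction : Domain → (ℝ × ℝ → ℝ) → Prop
  | .plane, _ => True
  | .torus, f => ∀ x : ℝ × ℝ, f (x.1 + 1, x.2) = f x ∧ f (x.1, x.2 + 1) = f x

/-- The norm of `L¹ ∩ L^∞`. -/
def normL1Linf (Ω : Domain) (f : ℝ × ℝ → ℝ) : ℝ≥0∞ :=
  eLpNorm f 1 Ω.measure + eLpNorm f ⊤ Ω.measure

/-- The Euclidean norm (the norm instance of `ℝ × ℝ` is the sup norm). -/
def euclid (x : ℝ × ℝ) : ℝ := Real.sqrt (x.1 ^ 2 + x.2 ^ 2)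

/-- Fourier coefficients of a `ℤ²`-periodic function. -/
def fourierCoeff₂ (f : ℝ × ℝ → ℝ) (k : ℤ × ℤ) : ℂ :=
  ∫ x in unitSquare,
    (f x : ℂ) * Complex.exp (-(2 * Real.pi * Complex.I * (k.1 * x.1 + k.2 * x.2)))

/-- `ψ = (-Δ)^{-1/2} θ`. On the plane this is the Riesz potential of order one, whose kernel is
`1 / (2π|x - y|)`; on the torus it is the Fourier multiplier `1 / (2π|k|)`, `k ≠ 0`, with `ψ`
normalized to have mean zero. -/
def IsInvSqrtLaplacian : Domain → (ℝ × ℝ → ℝ) → (ℝ × ℝ → ℝ) → Prop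
  | .plane, θ, ψ => ∀ x, ψ x = (1 / (2 * Real.pi)) * ∫ y, θ y / euclid (x - y)
  | .torus, θ, ψ => Domain.torus.IsFunction ψ ∧
      ∀ k : ℤ × ℤ, fourierCoeff₂ ψ k =
        if k = 0 then 0
        else fourierCoeff₂ θ k / ((2 * Real.pi * euclid ((k.1 : ℝ), (k.2 : ℝ)) : ℝ) : ℂ)

/-- `∂f/∂x₁`. -/
def d₁ (f : ℝ × ℝ → ℝ) (x : ℝ × ℝ) : ℝ := deriv (fun s => f (s, x.2)) x.1

/-- `∂f/∂x₂`. -/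
def d₂ (f : ℝ × ℝ → ℝ) (x : ℝ × ℝ) : ℝ := deriv (fun s => f (x.1, s)) x.2

/-- The time interval `[0, T)`, `T ≤ ∞`. -/
def timeInterval (T : EReal) : Set ℝ := {t | 0 ≤ t ∧ (t : EReal) < T}

/-- `θ` is a classical solution of the quasi-geostrophic equation on `Ω × [0, T)` with stream
function `ψ`; both are written `θ x t`, `ψ x t`. The velocity is `u = (-∂₂ψ, ∂₁ψ)`. -/
structure IsSolution (Ω : Domain) (T : EReal) (θ ψ : ℝ × ℝ → ℝ → ℝ) : Prop where
  isFunction : ∀ t ∈ timeInterval T, Ω.IsFunction (fun x => θ x t)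
  contDiffOn : ContDiffOn ℝ 1 (fun p : (ℝ × ℝ) × ℝ => θ p.1 p.2) (univ ×ˢ timeInterval T)
  locallyBounded : ∀ T' ∈ timeInterval T, ∃ M : ℝ≥0, ∀ t ∈ Icc 0 T',
    normL1Linf Ω (fun x => θ x t) ≤ M
  stream : ∀ t ∈ timeInterval T, IsInvSqrtLaplacian Ω (fun x => θ x t) (fun x => ψ x t)
  stream_contDiff : ∀ t ∈ timeInterval T, ContDiff ℝ 1 (fun x => ψ x t)
  transport : ∀ t ∈ timeInterval T, 0 < t → ∀ x : ℝ × ℝ,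
    deriv (fun s => θ x s) t
      + (-d₂ (fun y => ψ y t) x * d₁ (fun y => θ y t) x
        + d₁ (fun y => ψ y t) x * d₂ (fun y => θ y t) x) = 0

/-- `x₂ = φ(x₁, t)`, `x₁ ∈ [a, b]`, `t ∈ [0, T)`, is a (nondegenerate) `C¹` level curve of `θ`
at the level `g`. -/
structure IsLevelCurve (T : EReal) (θ : ℝ × ℝ → ℝ → ℝ) (a b : ℝ) (φ : ℝ → ℝ → ℝ) (g : ℝ) :
    Prop where
  contDiffOn : ContDiffOn ℝ 1 (fun p : ℝ × ℝ => φ p.1 p.2) (Icc a b ×ˢ timeInterval T)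
  level : ∀ x ∈ Icc a b, ∀ t ∈ timeInterval T, θ (x, φ x t) t = g
  nondegenerate : ∀ x ∈ Icc a b, ∀ t ∈ timeInterval T,
    d₂ (fun y => θ y t) (x, φ x t) ≠ 0

/-- The thickness `δ(x₁, t)`. -/
def thickness (φ₁ φ₂ : ℝ → ℝ → ℝ) (x t : ℝ) : ℝ := |φ₂ x t - φ₁ x t|

/-- The minimum of `δ(·, t)` over `[a, b]`. -/
def minThickness (a b : ℝ) (φ₁ φ₂ : ℝ → ℝ → ℝ) (t : ℝ) : ℝ :=
  sInf ((fun x => thickness φ₁ φ₂ x t) '' Icc a b)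

/-- The maximum of `δ(·, t)` over `[a, b]`. -/
def maxThickness (a b : ℝ) (φ₁ φ₂ : ℝ → ℝ → ℝ) (t : ℝ) : ℝ :=
  sSup ((fun x => thickness φ₁ φ₂ x t) '' Icc a b)

/-- Two level curves of `θ` over `[a, b]` form a semi-uniform front with constant `c`. -/
structure IsSemiUniformFront (T : EReal) (θ : ℝ × ℝ → ℝ → ℝ) (a b c : ℝ)
    (φ₁ φ₂ : ℝ → ℝ → ℝ) : Prop where
  levelCurve₁ : ∃ g₁, IsLevelCurve T θ a b φ₁ g₁
  levelCurve₂ : ∃ g₂, IsLevelCurve T θ a b φ₂ g₂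
  semiUniform : ∀ t ∈ timeInterval T,
    c * maxThickness a b φ₁ φ₂ t ≤ minThickness a b φ₁ φ₂ t

end QG

end

noncomputable section

namespace QG

/-! ### Gaussians on the plane -/

/-- The Gaussian `exp (-s |z|²)`. -/
def gau (s : ℝ) (z : ℝ × ℝ) : ℝ := Real.exp (-s * (z.1 ^ 2 + z.2 ^ 2))

lemma gau_eq_mul (s : ℝ) (z : ℝ × ℝ) :
    gau s z = Real.exp (-s * z.1 ^ 2) * Real.exp (-s * z.2 ^ 2) := by
  rw [gau, ← Real.exp_add]; ring_nf

lemma gau_pos (s : ℝ) (z : ℝ × ℝ) : 0 < gau s z := Real.exp_pos _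

lemma gau_neg (s : ℝ) (z : ℝ × ℝ) : gau s (-z) = gau s z := by simp [gau]

lemma continuous_gau_uncurry : Continuous fun p : ℝ × (ℝ × ℝ) => gau p.1 p.2 := by
  unfold gau; fun_prop

lemma continuous_gau (s : ℝ) : Continuous (gau s) := by
  unfold gau; fun_prop

lemma integrable_gau {s : ℝ} (hs : 0 < s) : Integrable (gau s) := by
  have h := (integrable_exp_neg_mul_sq hs).mul_prod (integrable_exp_neg_mul_sq hs)
  refine h.congr (Filter.Eventually.of_forall fun z => ?_)
  simp [gau_eq_mul]

lemma integral_gau {s : ℝ} (hs : 0 < s) : ∫ z, gau s z = Real.pi / s := by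
  have h := integral_prod_mul (μ := (volume : Measure ℝ)) (ν := (volume : Measure ℝ))
    (fun x : ℝ => Real.exp (-s * x ^ 2)) (fun x : ℝ => Real.exp (-s * x ^ 2))
  rw [integral_gaussian, Real.mul_self_sqrt (by positivity)] at h
  rw [← h]
  exact integral_congr_ae (Filter.Eventually.of_forall fun z => gau_eq_mul s z)

lemma lintegral_gau {s : ℝ} (hs : 0 < s) :
    ∫⁻ z, ENNReal.ofReal (gau s z) = ENNReal.ofReal (Real.pi / s) := by
  rw [← integral_gau hs, ofReal_integral_eq_lintegral_ofReal (integrable_gau hs)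
    (Filter.Eventually.of_forall fun z => (gau_pos s z).le)]

lemma lintegral_gau_sub_left {s : ℝ} (hs : 0 < s) (x : ℝ × ℝ) :
    ∫⁻ y, ENNReal.ofReal (gau s (x - y)) = ENNReal.ofReal (Real.pi / s) := by
  rw [← lintegral_gau hs]
  exact lintegral_sub_left_eq_self (fun y => ENNReal.ofReal (gau s y)) x

lemma abs_mul_exp_neg_sq_le (x : ℝ) : |x| * Real.exp (-x ^ 2 / 2) ≤ 1 := by
  have h1 : |x| ≤ Real.exp (x ^ 2 / 2) := by
    have := Real.add_one_le_exp (x ^ 2 / 2)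
    nlinarith [sq_nonneg (|x| - 1), sq_abs x]
  calc |x| * Real.exp (-x ^ 2 / 2) ≤ Real.exp (x ^ 2 / 2) * Real.exp (-x ^ 2 / 2) := by gcongr
    _ = 1 := by rw [← Real.exp_add]; ring_nf; simp

lemma abs_exp_neg_mul_sq_sub_le {s h : ℝ} (hs : 0 < s) (hh : s * h ^ 2 ≤ 1) (r : ℝ) :
    |Real.exp (-s * (r + h) ^ 2) - Real.exp (-s * r ^ 2)|
      ≤ 4 * |h| * √s * Real.exp (-(s / 4) * r ^ 2) := by
  have hder : ∀ q ∈ uIcc r (r + h), HasDerivWithinAt (fun q => Real.exp (-s * q ^ 2))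
      (Real.exp (-s * q ^ 2) * (-s * (2 * q))) (uIcc r (r + h)) q := by
    intro q _
    have := (((hasDerivAt_pow 2 q).const_mul (-s)).exp).hasDerivWithinAt (s := uIcc r (r + h))
    simpa using this
  have hb : ∀ q ∈ uIcc r (r + h), ‖Real.exp (-s * q ^ 2) * (-s * (2 * q))‖
      ≤ 4 * √s * Real.exp (-(s / 4) * r ^ 2) := by
    intro q hq
    have hqr : |q - r| ≤ |h| := by
      have := abs_sub_left_of_mem_uIcc hq
      simpa [abs_sub_comm] using this
    have hq2 : r ^ 2 / 2 - h ^ 2 ≤ q ^ 2 := by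
      have : (q - r) ^ 2 ≤ h ^ 2 := sq_le_sq.mpr hqr
      nlinarith [sq_nonneg (2 * q - r)]
    have h1 := abs_mul_exp_neg_sq_le (√s * q)
    have hss : √s * √s = s := Real.mul_self_sqrt hs.le
    have e1 : -(√s * q) ^ 2 / 2 = -s * q ^ 2 / 2 := by rw [mul_pow, Real.sq_sqrt hs.le]; ring
    rw [e1, abs_mul, abs_of_nonneg (Real.sqrt_nonneg s)] at h1
    have h2 : Real.exp (-s * q ^ 2 / 2) ≤ 2 * Real.exp (-(s / 4) * r ^ 2) := by
      have h3 : Real.exp (1 / 2) ≤ 2 := by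
        have := Real.exp_one_lt_d9
        have h4 : Real.exp (1 / 2) ^ 2 = Real.exp 1 := by rw [← Real.exp_nat_mul]; norm_num
        nlinarith [Real.exp_pos (1 / 2)]
      calc Real.exp (-s * q ^ 2 / 2) ≤ Real.exp (1 / 2 + -(s / 4) * r ^ 2) := by
            apply Real.exp_le_exp.mpr; nlinarith
        _ = Real.exp (1 / 2) * Real.exp (-(s / 4) * r ^ 2) := Real.exp_add _ _
        _ ≤ _ := by gcongr
    have e2 : Real.exp (-s * q ^ 2) = Real.exp (-s * q ^ 2 / 2) * Real.exp (-s * q ^ 2 / 2) := by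
      rw [← Real.exp_add]; ring_nf
    rw [Real.norm_eq_abs, abs_mul, abs_mul, abs_mul, abs_neg, abs_of_pos hs, abs_two,
      abs_of_pos (Real.exp_pos _), e2]
    calc Real.exp (-s * q ^ 2 / 2) * Real.exp (-s * q ^ 2 / 2) * (s * (2 * |q|))
        = 2 * √s * (√s * |q| * Real.exp (-s * q ^ 2 / 2)) * Real.exp (-s * q ^ 2 / 2) := by
          nth_rewrite 3 [← hss]; ring
      _ ≤ 2 * √s * 1 * (2 * Real.exp (-(s / 4) * r ^ 2)) := by gcongr
      _ = _ := by ring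
  have := (convex_uIcc r (r + h)).norm_image_sub_le_of_norm_hasDerivWithin_le hder hb
    left_mem_uIcc right_mem_uIcc
  simp only [Real.norm_eq_abs, add_sub_cancel_left] at this
  linarith

lemma abs_gau_sub_le {s h : ℝ} (hs : 0 < s) (hh : s * h ^ 2 ≤ 1) (z : ℝ × ℝ) :
    |gau s (z + (0, h)) - gau s z| ≤ 4 * |h| * √s * gau (s / 4) z := by
  rw [gau_eq_mul, gau_eq_mul s z, gau_eq_mul (s / 4) z]
  simp only [Prod.fst_add, Prod.snd_add, add_zero]
  rw [← mul_sub, abs_mul, abs_of_pos (Real.exp_pos _)]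
  calc Real.exp (-s * z.1 ^ 2) * |Real.exp (-s * (z.2 + h) ^ 2) - Real.exp (-s * z.2 ^ 2)|
      ≤ Real.exp (-(s / 4) * z.1 ^ 2) * (4 * |h| * √s * Real.exp (-(s / 4) * z.2 ^ 2)) := by
        gcongr ?_ * ?_
        · apply Real.exp_le_exp.mpr; nlinarith [sq_nonneg z.1]
        · exact abs_exp_neg_mul_sq_sub_le hs hh _
    _ = _ := by ring

/-! ### Characters and the Fourier transform of Gaussians -/

/-- The character `x ↦ exp (-2πi ξ·x)`. -/
def ch (ξ x : ℝ × ℝ) : ℂ :=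
  Complex.exp (-(2 * Real.pi * Complex.I * (ξ.1 * x.1 + ξ.2 * x.2)))

lemma ch_eq (ξ x : ℝ × ℝ) :
    ch ξ x = Complex.exp ((-(2 * Real.pi * (ξ.1 * x.1 + ξ.2 * x.2)) : ℝ) * Complex.I) := by
  rw [ch]; push_cast; ring_nf

@[simp] lemma norm_ch (ξ x : ℝ × ℝ) : ‖ch ξ x‖ = 1 := by
  rw [ch_eq, Complex.norm_exp_ofReal_mul_I]

lemma ch_add (ξ x y : ℝ × ℝ) : ch ξ (x + y) = ch ξ x * ch ξ y := by
  rw [ch, ch, ch, ← Complex.exp_add]; congr 1; push_cast [Prod.fst_add, Prod.snd_add]; ring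

lemma ch_neg (ξ x : ℝ × ℝ) : ch ξ (-x) = (starRingEnd ℂ) (ch ξ x) := by
  rw [ch_eq, ch_eq, ← Complex.exp_conj, map_mul, Complex.conj_ofReal, Complex.conj_I]
  congr 1; push_cast [Prod.fst_neg, Prod.snd_neg]; ring

lemma ch_sub (ξ x y : ℝ × ℝ) : ch ξ (x - y) = ch ξ x * (starRingEnd ℂ) (ch ξ y) := by
  rw [sub_eq_add_neg, ch_add, ch_neg]

lemma ch_comm (ξ x : ℝ × ℝ) : ch ξ x = ch x ξ := by
  rw [ch, ch]; congr 1; ring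

lemma continuous_ch_uncurry : Continuous fun p : (ℝ × ℝ) × (ℝ × ℝ) => ch p.1 p.2 := by
  unfold ch; fun_prop

@[fun_prop] lemma continuous_ch (ξ : ℝ × ℝ) : Continuous (ch ξ) := by
  unfold ch; fun_prop

lemma integral_gaussian_ch_one {s : ℝ} (hs : 0 < s) (ξ : ℝ) :
    ∫ x : ℝ, Complex.exp (-(2 * Real.pi * Complex.I * (ξ * x))) * (Real.exp (-s * x ^ 2) : ℂ)
      = (√(Real.pi / s) * Real.exp (-(Real.pi ^ 2 / s) * ξ ^ 2) : ℝ) := by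
  have h := fourierIntegral_gaussian (b := (s : ℂ)) (by simpa using hs) (-(2 * Real.pi * ξ) : ℂ)
  have e : ((Real.pi : ℂ) / s) ^ (1 / 2 : ℂ) = (√(Real.pi / s) : ℝ) := by
    rw [Real.sqrt_eq_rpow, Complex.ofReal_cpow (by positivity)]; push_cast; rfl
  rw [e] at h
  push_cast
  have hs' : (s : ℂ) ≠ 0 := by exact_mod_cast hs.ne'
  have e2 : -((Real.pi : ℂ) ^ 2 / s) * ξ ^ 2 = -(-(2 * Real.pi * ξ) : ℂ) ^ 2 / (4 * s) := by
    field_simp; ring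
  rw [e2, ← h]
  refine integral_congr_ae (Filter.Eventually.of_forall fun x => ?_)
  simp only
  congr 2; ring

lemma integral_gau_ch {s : ℝ} (hs : 0 < s) (ξ : ℝ × ℝ) :
    ∫ z, (gau s z : ℂ) * ch ξ z = (Real.pi / s * gau (Real.pi ^ 2 / s) ξ : ℝ) := by
  have h := integral_prod_mul (μ := (volume : Measure ℝ)) (ν := (volume : Measure ℝ))
    (fun x : ℝ => Complex.exp (-(2 * Real.pi * Complex.I * (ξ.1 * x))) *
      (Real.exp (-s * x ^ 2) : ℂ))
    (fun x : ℝ => Complex.exp (-(2 * Real.pi * Complex.I * (ξ.2 * x))) *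
      (Real.exp (-s * x ^ 2) : ℂ))
  rw [integral_gaussian_ch_one hs, integral_gaussian_ch_one hs] at h
  rw [gau_eq_mul]
  have e : (Real.pi / s : ℝ) = √(Real.pi / s) * √(Real.pi / s) :=
    (Real.mul_self_sqrt (by positivity)).symm
  rw [e]
  push_cast at h ⊢
  rw [show ∀ a b c : ℂ, a * a * (b * c) = a * b * (a * c) by intros; ring, ← h]
  refine integral_congr_ae (Filter.Eventually.of_forall fun z => ?_)
  have hch : ch ξ z = Complex.exp (-(2 * Real.pi * Complex.I * (ξ.1 * z.1))) *
      Complex.exp (-(2 * Real.pi * Complex.I * (ξ.2 * z.2))) := by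
    rw [ch, ← Complex.exp_add]; congr 1; ring
  simp only [gau_eq_mul, hch]
  push_cast
  ring

lemma gau_eq_integral_ch {s : ℝ} (hs : 0 < s) (z : ℝ × ℝ) :
    (gau s z : ℂ) = ∫ ξ, ((Real.pi / s * gau (Real.pi ^ 2 / s) ξ : ℝ) : ℂ) * ch ξ z := by
  have hp := Real.pi_pos
  have h := integral_gau_ch (s := Real.pi ^ 2 / s) (by positivity) z
  have e1 : Real.pi ^ 2 / (Real.pi ^ 2 / s) = s := by field_simp
  have e2 : Real.pi / (Real.pi ^ 2 / s) = s / Real.pi := by field_simp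
  rw [e1, e2] at h
  have h2 : ∫ ξ, ((Real.pi / s * gau (Real.pi ^ 2 / s) ξ : ℝ) : ℂ) * ch ξ z
      = ((Real.pi / s : ℝ) : ℂ) * ∫ ξ, (gau (Real.pi ^ 2 / s) ξ : ℂ) * ch z ξ := by
    rw [← integral_const_mul]
    refine integral_congr_ae (Filter.Eventually.of_forall fun ξ => ?_)
    simp only [ch_comm ξ z]; push_cast; ring
  rw [h2, h, ← Complex.ofReal_mul]
  congr 1; field_simp

/-! ### The kernels -/

/-- The weight in the subordination formula for `1 / (2π|z|)`. -/
def wt (s : ℝ) : ℝ := 1 / (2 * Real.pi * √Real.pi) * s ^ (-(1 / 2) : ℝ)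

lemma wt_nonneg {s : ℝ} (hs : 0 ≤ s) : 0 ≤ wt s := by unfold wt; positivity

@[fun_prop] lemma measurable_wt : Measurable wt := by unfold wt; fun_prop

lemma wt_const_le : 1 / (2 * Real.pi * √Real.pi) ≤ 1 := by
  have hp := Real.pi_gt_three
  have : 1 ≤ √Real.pi := by rw [Real.one_le_sqrt]; linarith
  rw [div_le_one (by positivity)]; nlinarith

lemma wt_le {s : ℝ} (hs : 0 ≤ s) : wt s ≤ s ^ (-(1 / 2) : ℝ) :=
  mul_le_of_le_one_left (by positivity) wt_const_le

/-- The part of the Riesz kernel of order one carried by the scales in `I`. -/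
def ker (I : Set ℝ) (z : ℝ × ℝ) : ℝ := ∫ s in I, wt s * gau s z

lemma normSq_pos_of_ne {z : ℝ × ℝ} (hz : z ≠ 0) : 0 < z.1 ^ 2 + z.2 ^ 2 := by
  by_contra h
  apply hz
  have h1 : z.1 ^ 2 = 0 := by nlinarith [sq_nonneg z.1, sq_nonneg z.2]
  have h2 : z.2 ^ 2 = 0 := by nlinarith [sq_nonneg z.1, sq_nonneg z.2]
  exact Prod.ext (by simpa using h1) (by simpa using h2)

lemma euclid_pos {z : ℝ × ℝ} (hz : z ≠ 0) : 0 < euclid z :=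
  Real.sqrt_pos.mpr (normSq_pos_of_ne hz)

lemma integrableOn_wt_gau {z : ℝ × ℝ} (hz : z ≠ 0) :
    IntegrableOn (fun s => wt s * gau s z) (Ioi 0) := by
  have h := integrableOn_rpow_mul_exp_neg_mul_rpow (s := -(1 / 2)) (p := 1) (by norm_num) one_pos
    (normSq_pos_of_ne hz)
  refine IntegrableOn.congr_fun (h.const_mul (1 / (2 * Real.pi * √Real.pi))) ?_ measurableSet_Ioi
  intro s hs
  simp only [wt, gau, Real.rpow_one]
  ring_nf

lemma ker_Ioi_zero {z : ℝ × ℝ} (hz : z ≠ 0) : ker (Ioi 0) z = 1 / (2 * Real.pi * euclid z) := by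
  have h := Real.integral_rpow_mul_exp_neg_mul_Ioi (a := 1 / 2) (by norm_num) (normSq_pos_of_ne hz)
  have e : ker (Ioi 0) z = 1 / (2 * Real.pi * √Real.pi) *
      ∫ t : ℝ in Ioi 0, t ^ (1 / 2 - 1 : ℝ) * Real.exp (-((z.1 ^ 2 + z.2 ^ 2) * t)) := by
    rw [ker, ← integral_const_mul]
    refine setIntegral_congr_fun measurableSet_Ioi fun s _ => ?_
    simp only [wt, gau]
    norm_num
    ring_nf
  have hE := euclid_pos hz
  have hp := Real.sqrt_pos.mpr Real.pi_pos
  rw [e, h, Real.Gamma_one_half_eq, ← Real.sqrt_eq_rpow, Real.sqrt_div zero_le_one,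
    Real.sqrt_one, ← euclid]
  field_simp

/-! ### Integrals of the weight -/

lemma lintegral_wt_Ioc_zero_one : ∫⁻ s in Ioc (0 : ℝ) 1, ENNReal.ofReal (wt s) ≤ 2 := by
  have hi : IntegrableOn (fun s : ℝ => s ^ (-(1 / 2) : ℝ)) (Ioc 0 1) := by
    rw [← intervalIntegrable_iff_integrableOn_Ioc_of_le zero_le_one]
    exact intervalIntegral.intervalIntegrable_rpow' (by norm_num)
  calc ∫⁻ s in Ioc (0 : ℝ) 1, ENNReal.ofReal (wt s)
      ≤ ∫⁻ s in Ioc (0 : ℝ) 1, ENNReal.ofReal (s ^ (-(1 / 2) : ℝ)) :=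
        setLIntegral_mono (by fun_prop) fun s hs => ENNReal.ofReal_le_ofReal (wt_le hs.1.le)
    _ = ENNReal.ofReal (∫ s in Ioc (0 : ℝ) 1, s ^ (-(1 / 2) : ℝ)) := by
        rw [ofReal_integral_eq_lintegral_ofReal hi]
        filter_upwards [ae_restrict_mem measurableSet_Ioc] with s hs
        exact Real.rpow_nonneg hs.1.le _
    _ = 2 := by
        rw [← intervalIntegral.integral_of_le zero_le_one, integral_rpow (Or.inl (by norm_num))]
        norm_num

lemma rpow_neg_half_mul_self {s : ℝ} (hs : 0 < s) :
    s ^ (-(1 / 2) : ℝ) * s ^ (-(1 / 2) : ℝ) = s⁻¹ := by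
  rw [← Real.rpow_add hs, ← Real.rpow_neg_one]; norm_num

lemma lintegral_wt_Ioc_one {S : ℝ} (hS : 1 ≤ S) :
    ∫⁻ s in Ioc (1 : ℝ) S, ENNReal.ofReal (wt s) * ENNReal.ofReal (s ^ (-(1 / 2) : ℝ))
      ≤ ENNReal.ofReal (Real.log S) := by
  have hi : IntegrableOn (fun s : ℝ => s⁻¹) (Ioc 1 S) := by
    rw [← intervalIntegrable_iff_integrableOn_Ioc_of_le hS]
    refine intervalIntegral.intervalIntegrable_inv (fun x hx => ?_) continuousOn_id
    rw [uIcc_of_le hS] at hx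
    exact (zero_lt_one.trans_le hx.1).ne'
  calc _ ≤ ∫⁻ s in Ioc (1 : ℝ) S, ENNReal.ofReal (s⁻¹) := by
        refine setLIntegral_mono (by fun_prop) fun s hs => ?_
        have h0 : 0 < s := zero_lt_one.trans hs.1
        rw [← ENNReal.ofReal_mul (wt_nonneg h0.le), ← rpow_neg_half_mul_self h0]
        exact ENNReal.ofReal_le_ofReal
          (mul_le_mul_of_nonneg_right (wt_le h0.le) (Real.rpow_nonneg h0.le _))
    _ = ENNReal.ofReal (∫ s in Ioc (1 : ℝ) S, s⁻¹) := by
        rw [ofReal_integral_eq_lintegral_ofReal hi]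
        filter_upwards [ae_restrict_mem measurableSet_Ioc] with s hs
        exact inv_nonneg.mpr (zero_lt_one.trans hs.1).le
    _ = ENNReal.ofReal (Real.log S) := by
        rw [← intervalIntegral.integral_of_le hS, integral_inv_of_pos one_pos (by linarith)]
        simp

lemma lintegral_wt_Ioi {S : ℝ} (hS : 0 < S) :
    ∫⁻ s in Ioi S, ENNReal.ofReal (wt s) * ENNReal.ofReal (s⁻¹)
      ≤ ENNReal.ofReal (2 * S ^ (-(1 / 2) : ℝ)) := by
  have hi : IntegrableOn (fun s : ℝ => s ^ (-(3 / 2) : ℝ)) (Ioi S) :=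
    integrableOn_Ioi_rpow_of_lt (by norm_num) hS
  calc _ ≤ ∫⁻ s in Ioi S, ENNReal.ofReal (s ^ (-(3 / 2) : ℝ)) := by
        refine setLIntegral_mono (by fun_prop) fun s hs => ?_
        have h0 : 0 < s := hS.trans hs
        rw [← ENNReal.ofReal_mul (wt_nonneg h0.le)]
        have e : s ^ (-(3 / 2) : ℝ) = s ^ (-(1 / 2) : ℝ) * s⁻¹ := by
          rw [← Real.rpow_neg_one, ← Real.rpow_add h0]; norm_num
        rw [e]
        exact ENNReal.ofReal_le_ofReal
          (mul_le_mul_of_nonneg_right (wt_le h0.le) (inv_nonneg.mpr h0.le))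
    _ = ENNReal.ofReal (∫ s in Ioi S, s ^ (-(3 / 2) : ℝ)) := by
        rw [ofReal_integral_eq_lintegral_ofReal hi]
        filter_upwards [ae_restrict_mem measurableSet_Ioi] with s hs
        exact Real.rpow_nonneg (hS.trans hs).le _
    _ = ENNReal.ofReal (2 * S ^ (-(1 / 2) : ℝ)) := by
        rw [integral_Ioi_rpow_of_lt (by norm_num) hS,
          show (-(3 / 2) + 1 : ℝ) = -(1 / 2) by norm_num]
        congr 1; ring

/-! ### Integrability of the kernels -/

lemma ker_nonneg {I : Set ℝ} (hI : MeasurableSet I) (hI0 : I ⊆ Ioi 0) (z : ℝ × ℝ) :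
    0 ≤ ker I z :=
  setIntegral_nonneg hI fun s hs => mul_nonneg (wt_nonneg (hI0 hs).le) (gau_pos s z).le

lemma measurable_wt_gau : Measurable fun p : ℝ × (ℝ × ℝ) => wt p.1 * gau p.1 p.2 :=
  (measurable_wt.comp measurable_fst).mul continuous_gau_uncurry.measurable

lemma measurable_ker (I : Set ℝ) : Measurable (ker I) := by
  have : StronglyMeasurable (fun p : (ℝ × ℝ) × ℝ => wt p.2 * gau p.2 p.1) :=
    (measurable_wt_gau.comp measurable_swap).stronglyMeasurable
  exact (this.integral_prod_right (ν := volume.restrict I)).measurable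

lemma ofReal_ker_eq_lintegral {I : Set ℝ} (hI : MeasurableSet I) (hI0 : I ⊆ Ioi 0) {z : ℝ × ℝ}
    (hz : z ≠ 0) :
    ENNReal.ofReal (ker I z) = ∫⁻ s in I, ENNReal.ofReal (wt s) * ENNReal.ofReal (gau s z) := by
  rw [ker, ofReal_integral_eq_lintegral_ofReal ((integrableOn_wt_gau hz).mono_set hI0)]
  · refine setLIntegral_congr_fun hI fun s hs => ?_
    exact ENNReal.ofReal_mul (wt_nonneg (hI0 hs).le)
  · filter_upwards [ae_restrict_mem hI] with s hs
    exact mul_nonneg (wt_nonneg (hI0 hs).le) (gau_pos s z).le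

lemma ae_ne_zero_prod : ∀ᵐ z : ℝ × ℝ, z ≠ 0 := by
  simp [ae_iff, measure_singleton]

lemma ae_sub_ne_zero (x : ℝ × ℝ) : ∀ᵐ y : ℝ × ℝ, x - y ≠ 0 := by
  have : ∀ᵐ y : ℝ × ℝ, y ≠ x := by simp [ae_iff, measure_singleton]
  filter_upwards [this] with y hy
  rwa [sub_ne_zero, ne_comm]

lemma integrable_ker_Ioi_one : Integrable (ker (Ioi 1)) := by
  have hI0 : Ioi (1 : ℝ) ⊆ Ioi 0 := Ioi_subset_Ioi zero_le_one
  refine ⟨(measurable_ker _).aestronglyMeasurable, ?_⟩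
  rw [hasFiniteIntegral_iff_ofReal
    (Filter.Eventually.of_forall fun z => ker_nonneg measurableSet_Ioi hI0 z)]
  calc ∫⁻ z, ENNReal.ofReal (ker (Ioi 1) z)
      = ∫⁻ z, ∫⁻ s in Ioi (1 : ℝ), ENNReal.ofReal (wt s) * ENNReal.ofReal (gau s z) := by
        refine lintegral_congr_ae ?_
        filter_upwards [ae_ne_zero_prod] with z hz
        exact ofReal_ker_eq_lintegral measurableSet_Ioi hI0 hz
    _ = ∫⁻ s in Ioi (1 : ℝ), ∫⁻ z, ENNReal.ofReal (wt s) * ENNReal.ofReal (gau s z) := by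
        refine lintegral_lintegral_swap (Measurable.aemeasurable ?_)
        have := continuous_gau_uncurry.measurable.comp (measurable_swap (α := ℝ × ℝ) (β := ℝ))
        exact ((measurable_wt.comp measurable_snd).ennreal_ofReal).mul this.ennreal_ofReal
    _ = ∫⁻ s in Ioi (1 : ℝ), ENNReal.ofReal Real.pi *
          (ENNReal.ofReal (wt s) * ENNReal.ofReal (s⁻¹)) := by
        refine setLIntegral_congr_fun measurableSet_Ioi fun s hs => ?_
        rw [lintegral_const_mul _ (continuous_gau s).measurable.ennreal_ofReal,
          lintegral_gau (hI0 hs), div_eq_mul_inv, ENNReal.ofReal_mul Real.pi_pos.le]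
        ring
    _ < ⊤ := by
        rw [lintegral_const_mul' _ _ ENNReal.ofReal_ne_top]
        exact ENNReal.mul_lt_top ENNReal.ofReal_lt_top
          ((lintegral_wt_Ioi one_pos).trans_lt ENNReal.ofReal_lt_top)

lemma gau_le_one {s : ℝ} (hs : 0 ≤ s) (z : ℝ × ℝ) : gau s z ≤ 1 := by
  rw [gau, Real.exp_le_one_iff]; nlinarith [sq_nonneg z.1, sq_nonneg z.2]

lemma ker_Ioc_zero_one_le {z : ℝ × ℝ} (hz : z ≠ 0) : ker (Ioc 0 1) z ≤ 2 := by
  rw [← ENNReal.ofReal_le_ofReal_iff (by norm_num),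
    ofReal_ker_eq_lintegral measurableSet_Ioc Ioc_subset_Ioi_self hz]
  refine le_trans (setLIntegral_mono (by fun_prop) fun s hs => ?_)
    (lintegral_wt_Ioc_zero_one.trans (by simp))
  refine mul_le_of_le_one_right' ?_
  rw [ENNReal.ofReal_le_one]
  exact gau_le_one hs.1.le z

lemma ker_Ioi_zero_eq_add {z : ℝ × ℝ} (hz : z ≠ 0) :
    ker (Ioi 0) z = ker (Ioc 0 1) z + ker (Ioi 1) z := by
  have h := integrableOn_wt_gau hz
  rw [ker, ← Ioc_union_Ioi_eq_Ioi (zero_le_one' ℝ), setIntegral_union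
    (Ioc_disjoint_Ioi le_rfl) measurableSet_Ioi (h.mono_set Ioc_subset_Ioi_self)
    (h.mono_set (Ioi_subset_Ioi zero_le_one))]
  rfl

lemma integrable_mul_ker_Ioi_one {f : ℝ × ℝ → ℝ} (hf : Continuous f) {M : ℝ}
    (hM : ∀ y, |f y| ≤ M) (x : ℝ × ℝ) : Integrable fun y => f y * ker (Ioi 1) (x - y) :=
  (integrable_ker_Ioi_one.comp_sub_left x).bdd_mul hf.aestronglyMeasurable
    (Filter.Eventually.of_forall hM)

lemma integrable_mul_ker_Ioi_zero {f : ℝ × ℝ → ℝ} (hf : Continuous f) (hfi : Integrable f) {M : ℝ}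
    (hM : ∀ y, |f y| ≤ M) (x : ℝ × ℝ) : Integrable fun y => f y * ker (Ioi 0) (x - y) := by
  have h1 : Integrable fun y => f y * ker (Ioc 0 1) (x - y) := by
    refine hfi.mul_bdd (c := 2)
      ((measurable_ker _).comp (measurable_const.sub measurable_id)).aestronglyMeasurable ?_
    filter_upwards [ae_sub_ne_zero x] with y hy
    rw [Real.norm_of_nonneg (ker_nonneg measurableSet_Ioc Ioc_subset_Ioi_self _)]
    exact ker_Ioc_zero_one_le hy
  refine (h1.add (integrable_mul_ker_Ioi_one hf hM x)).congr ?_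
  filter_upwards [ae_sub_ne_zero x] with y hy
  simp only [Pi.add_apply]
  rw [ker_Ioi_zero_eq_add hy, mul_add]

/-! ### Modulus of continuity of potentials -/

/-- The `L¹` modulus of the Gaussian at scale `s` against `f`. -/
def gauMod (f : ℝ × ℝ → ℝ) (x : ℝ × ℝ) (h s : ℝ) : ℝ≥0∞ :=
  ∫⁻ y, ‖f y‖ₑ * ENNReal.ofReal |gau s (x + (0, h) - y) - gau s (x - y)|

lemma gauMod_le {f : ℝ × ℝ → ℝ} {M : ℝ} (hM : ∀ y, |f y| ≤ M) (x : ℝ × ℝ) (h : ℝ) {s : ℝ}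
    (hs : 0 < s) : gauMod f x h s ≤ ENNReal.ofReal (2 * Real.pi * M) * ENNReal.ofReal (s⁻¹) := by
  have hM0 : 0 ≤ M := (abs_nonneg _).trans (hM 0)
  calc gauMod f x h s ≤ ∫⁻ y, ENNReal.ofReal M *
        (ENNReal.ofReal (gau s (x + (0, h) - y)) + ENNReal.ofReal (gau s (x - y))) := by
        refine lintegral_mono fun y => ?_
        refine mul_le_mul' ?_ ?_
        · rw [Real.enorm_eq_ofReal_abs]; exact ENNReal.ofReal_le_ofReal (hM y)
        · rw [← ENNReal.ofReal_add (gau_pos _ _).le (gau_pos _ _).le]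
          refine ENNReal.ofReal_le_ofReal ((abs_sub _ _).trans_eq ?_)
          rw [abs_of_pos (gau_pos _ _), abs_of_pos (gau_pos _ _)]
    _ = _ := by
        rw [lintegral_const_mul' _ _ ENNReal.ofReal_ne_top, lintegral_add_left',
          lintegral_gau_sub_left hs, lintegral_gau_sub_left hs,
          ← ENNReal.ofReal_add (by positivity) (by positivity), ← ENNReal.ofReal_mul hM0,
          ← ENNReal.ofReal_mul (by positivity)]
        · congr 1; ring
        · have := (continuous_gau s).comp (continuous_const.sub continuous_id :
            Continuous fun y : ℝ × ℝ => x + (0, h) - y)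
          exact this.measurable.ennreal_ofReal.aemeasurable

lemma abs_gau_sub_le' {s h : ℝ} (hs : 0 < s) (hh : s * h ^ 2 ≤ 1) (x y : ℝ × ℝ) :
    |gau s (x + (0, h) - y) - gau s (x - y)| ≤ 4 * |h| * √s * gau (s / 4) (x - y) := by
  have := abs_gau_sub_le hs hh (x - y)
  rwa [show x - y + (0, h) = x + (0, h) - y by abel] at this

lemma gauMod_le_of_le_one {f : ℝ × ℝ → ℝ} {M : ℝ} (hM : ∀ y, |f y| ≤ M) (x : ℝ × ℝ) {h s : ℝ}
    (hs : 0 < s) (hh : s * h ^ 2 ≤ 1) : gauMod f x h s ≤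
      ENNReal.ofReal (16 * Real.pi * M * |h|) * ENNReal.ofReal (s ^ (-(1 / 2) : ℝ)) := by
  have hM0 : 0 ≤ M := (abs_nonneg _).trans (hM 0)
  calc gauMod f x h s ≤ ∫⁻ y, ENNReal.ofReal (M * (4 * |h| * √s)) *
        ENNReal.ofReal (gau (s / 4) (x - y)) := by
        refine lintegral_mono fun y => ?_
        rw [Real.enorm_eq_ofReal_abs, ← ENNReal.ofReal_mul (abs_nonneg _),
          ← ENNReal.ofReal_mul (by positivity), mul_assoc]
        exact ENNReal.ofReal_le_ofReal (mul_le_mul (hM y) (abs_gau_sub_le' hs hh x y)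
          (abs_nonneg _) hM0)
    _ = _ := by
        rw [lintegral_const_mul' _ _ ENNReal.ofReal_ne_top, lintegral_gau_sub_left (by positivity),
          ← ENNReal.ofReal_mul (by positivity), ← ENNReal.ofReal_mul (by positivity)]
        congr 1
        rw [Real.rpow_neg hs.le, ← Real.sqrt_eq_rpow]
        have : √s ≠ 0 := (Real.sqrt_pos.mpr hs).ne'
        have h2 : √s ^ 2 = s := Real.sq_sqrt hs.le
        field_simp
        rw [h2]; ring

lemma gauMod_le_of_sq {f : ℝ × ℝ → ℝ} (hf : Continuous f) {E : ℝ} (hE0 : 0 ≤ E)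
    (hE : ∫⁻ y, ENNReal.ofReal (f y ^ 2) ≤ ENNReal.ofReal E) (x : ℝ × ℝ) {h s : ℝ}
    (hs : 0 < s) (hh : s * h ^ 2 ≤ 1) :
    gauMod f x h s ≤ ENNReal.ofReal (2 * |h| * (E + 2 * Real.pi)) := by
  calc gauMod f x h s ≤ ∫⁻ y, ENNReal.ofReal (2 * |h|) * (ENNReal.ofReal (f y ^ 2) +
        ENNReal.ofReal s * ENNReal.ofReal (gau (s / 2) (x - y))) := by
        refine lintegral_mono fun y => ?_
        rw [Real.enorm_eq_ofReal_abs, ← ENNReal.ofReal_mul (abs_nonneg _),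
          ← ENNReal.ofReal_mul hs.le, ← ENNReal.ofReal_add (by positivity)
          (mul_nonneg hs.le (gau_pos _ _).le), ← ENNReal.ofReal_mul (by positivity)]
        refine ENNReal.ofReal_le_ofReal ?_
        have e : gau (s / 2) (x - y) = gau (s / 4) (x - y) ^ 2 := by
          rw [gau, gau, ← Real.exp_nat_mul]; congr 1; push_cast; ring
        rw [e]
        calc |f y| * |gau s (x + (0, h) - y) - gau s (x - y)|
            ≤ |f y| * (4 * |h| * √s * gau (s / 4) (x - y)) := by
              gcongr; exact abs_gau_sub_le' hs hh x y
          _ = 2 * |h| * (2 * |f y| * (√s * gau (s / 4) (x - y))) := by ring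
          _ ≤ 2 * |h| * (|f y| ^ 2 + (√s * gau (s / 4) (x - y)) ^ 2) := by
              gcongr; exact two_mul_le_add_sq _ _
          _ = _ := by rw [mul_pow, Real.sq_sqrt hs.le, sq_abs]
    _ ≤ ENNReal.ofReal (2 * |h|) * (ENNReal.ofReal E + ENNReal.ofReal s *
          ENNReal.ofReal (Real.pi / (s / 2))) := by
        rw [lintegral_const_mul' _ _ ENNReal.ofReal_ne_top, lintegral_add_left (by fun_prop),
          lintegral_const_mul' _ _ ENNReal.ofReal_ne_top, lintegral_gau_sub_left (by positivity)]
        gcongr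
    _ = _ := by
        rw [← ENNReal.ofReal_mul hs.le, ← ENNReal.ofReal_add hE0 (by positivity),
          ← ENNReal.ofReal_mul (by positivity)]
        congr 1; field_simp

lemma enorm_potential_sub_le {f : ℝ × ℝ → ℝ} (hf : Continuous f) {I : Set ℝ}
    (hI : MeasurableSet I) (hI0 : I ⊆ Ioi 0)
    (hint : ∀ x, Integrable fun y => f y * ker I (x - y)) (x : ℝ × ℝ) (h : ℝ) :
    ‖(∫ y, f y * ker I (x + (0, h) - y)) - ∫ y, f y * ker I (x - y)‖ₑ
      ≤ ∫⁻ s in I, ENNReal.ofReal (wt s) * gauMod f x h s := by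
  have hc : Continuous fun p : (ℝ × ℝ) × ℝ => |gau p.2 (x + (0, h) - p.1) - gau p.2 (x - p.1)| := by
    unfold gau; fun_prop
  rw [← integral_sub (hint _) (hint _)]
  refine (enorm_integral_le_lintegral_enorm _).trans ?_
  calc ∫⁻ y, ‖f y * ker I (x + (0, h) - y) - f y * ker I (x - y)‖ₑ
      ≤ ∫⁻ y, ∫⁻ s in I, ENNReal.ofReal (wt s) *
          (‖f y‖ₑ * ENNReal.ofReal |gau s (x + (0, h) - y) - gau s (x - y)|) := by
        refine lintegral_mono_ae ?_
        filter_upwards [ae_sub_ne_zero x, ae_sub_ne_zero (x + (0, h))] with y h1 h2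
        rw [← mul_sub, enorm_mul, ker, ker, ← integral_sub
          ((integrableOn_wt_gau h2).mono_set hI0) ((integrableOn_wt_gau h1).mono_set hI0)]
        calc _ ≤ ‖f y‖ₑ * ∫⁻ s in I, ENNReal.ofReal (wt s) *
              ENNReal.ofReal |gau s (x + (0, h) - y) - gau s (x - y)| := by
              gcongr
              refine (enorm_integral_le_lintegral_enorm _).trans
                (setLIntegral_mono' hI fun s hs => le_of_eq ?_)
              rw [← mul_sub, enorm_mul, Real.enorm_of_nonneg (wt_nonneg (hI0 hs).le),
                Real.enorm_eq_ofReal_abs]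
          _ = _ := by
              rw [← lintegral_const_mul' _ _ enorm_ne_top]
              refine lintegral_congr fun s => ?_
              ring
    _ = ∫⁻ s in I, ∫⁻ y, ENNReal.ofReal (wt s) *
          (‖f y‖ₑ * ENNReal.ofReal |gau s (x + (0, h) - y) - gau s (x - y)|) := by
        refine lintegral_lintegral_swap (Measurable.aemeasurable ?_)
        have hfm : Measurable fun p : (ℝ × ℝ) × ℝ => ‖f p.1‖ₑ :=
          (hf.measurable.comp measurable_fst).enorm
        exact (measurable_wt.comp measurable_snd).ennreal_ofReal.mul
          (hfm.mul hc.measurable.ennreal_ofReal)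
    _ = _ := by
        refine lintegral_congr fun s => ?_
        rw [lintegral_const_mul' _ _ ENNReal.ofReal_ne_top]
        rfl

lemma lintegral_wt_gauMod_Ioi_one_le {f : ℝ × ℝ → ℝ} {M : ℝ} (hM : ∀ y, |f y| ≤ M)
    (x : ℝ × ℝ) {h H : ℝ} (hH : 0 < H) (hH1 : H ≤ 1) (hh : |h| ≤ H) :
    ∫⁻ s in Ioi 1, ENNReal.ofReal (wt s) * gauMod f x h s
      ≤ ENNReal.ofReal (36 * Real.pi * M * (H * (1 + Real.log (1 / H)))) := by
  have hM0 : 0 ≤ M := (abs_nonneg _).trans (hM 0)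
  have hS : 1 ≤ (1 / H) ^ 2 := by
    have : 1 ≤ 1 / H := by rw [le_div_iff₀ hH]; linarith
    nlinarith
  have hS0 : 0 < (1 / H) ^ 2 := by positivity
  have hlog : 0 ≤ Real.log (1 / H) := Real.log_nonneg (by rw [le_div_iff₀ hH]; linarith)
  rw [← Ioc_union_Ioi_eq_Ioi hS, lintegral_union measurableSet_Ioi (Ioc_disjoint_Ioi le_rfl)]
  calc _ ≤ ENNReal.ofReal (16 * Real.pi * M * |h|) * ENNReal.ofReal (Real.log ((1 / H) ^ 2)) +
        ENNReal.ofReal (2 * Real.pi * M) *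
          ENNReal.ofReal (2 * ((1 / H) ^ 2) ^ (-(1 / 2) : ℝ)) := by
        gcongr
        · refine le_trans ?_ (mul_le_mul_right (lintegral_wt_Ioc_one hS) _)
          rw [← lintegral_const_mul' _ _ ENNReal.ofReal_ne_top]
          refine setLIntegral_mono' measurableSet_Ioc fun s hs => ?_
          have h0 : 0 < s := zero_lt_one.trans hs.1
          refine (mul_le_mul_right (gauMod_le_of_le_one hM x h0 ?_) _).trans_eq (by ring)
          have h1 : h ^ 2 ≤ H ^ 2 := by
            rw [← sq_abs]; exact pow_le_pow_left₀ (abs_nonneg _) hh 2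
          calc s * h ^ 2 ≤ (1 / H) ^ 2 * H ^ 2 := by
                apply mul_le_mul hs.2 h1 (sq_nonneg _) (by positivity)
            _ = 1 := by field_simp
        · refine le_trans ?_ (mul_le_mul_right (lintegral_wt_Ioi hS0) _)
          rw [← lintegral_const_mul' _ _ ENNReal.ofReal_ne_top]
          refine setLIntegral_mono' measurableSet_Ioi fun s hs => ?_
          exact (mul_le_mul_right (gauMod_le hM x h (hS0.trans hs)) _).trans_eq (by ring)
    _ ≤ _ := by
        have e : ((1 / H) ^ 2) ^ (-(1 / 2) : ℝ) = H := by
          rw [Real.rpow_neg (by positivity), ← Real.sqrt_eq_rpow, Real.sqrt_sq (by positivity)]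
          simp
        rw [e, Real.log_pow, ← ENNReal.ofReal_mul (by positivity),
          ← ENNReal.ofReal_mul (by positivity), ← ENNReal.ofReal_add (by positivity)
          (by positivity)]
        refine ENNReal.ofReal_le_ofReal ?_
        have h3 : Real.pi * M * Real.log (1 / H) * |h| ≤ Real.pi * M * Real.log (1 / H) * H := by
          gcongr
        have h4 : 0 ≤ Real.pi * M * H := by positivity
        have h5 : 0 ≤ Real.pi * M * Real.log (1 / H) * H := by positivity
        push_cast
        nlinarith

/-- Potentials with the local part of the kernel are log-Lipschitz. -/
theorem abs_localPotential_sub_le {f : ℝ × ℝ → ℝ} (hf : Continuous f) {M : ℝ}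
    (hM : ∀ y, |f y| ≤ M) (x : ℝ × ℝ) {h H : ℝ} (hH : 0 < H) (hH1 : H ≤ 1) (hh : |h| ≤ H) :
    |(∫ y, f y * ker (Ioi 1) (x + (0, h) - y)) - ∫ y, f y * ker (Ioi 1) (x - y)|
      ≤ 36 * Real.pi * M * (H * (1 + Real.log (1 / H))) := by
  have hM0 : 0 ≤ M := (abs_nonneg _).trans (hM 0)
  have hlog : 0 ≤ Real.log (1 / H) := Real.log_nonneg (by rw [le_div_iff₀ hH]; linarith)
  have h1 := (enorm_potential_sub_le hf measurableSet_Ioi (Ioi_subset_Ioi zero_le_one)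
    (integrable_mul_ker_Ioi_one hf hM) x h).trans
    (lintegral_wt_gauMod_Ioi_one_le hM x hH hH1 hh)
  rwa [Real.enorm_eq_ofReal_abs, ENNReal.ofReal_le_ofReal_iff (by positivity)] at h1

/-- Riesz potentials of order one of bounded square integrable functions are log-Lipschitz. -/
theorem abs_potential_sub_le {f : ℝ × ℝ → ℝ} (hf : Continuous f) (hfi : Integrable f) {M E : ℝ}
    (hM : ∀ y, |f y| ≤ M) (hE0 : 0 ≤ E) (hE : ∫⁻ y, ENNReal.ofReal (f y ^ 2) ≤ ENNReal.ofReal E)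
    (x : ℝ × ℝ) {h H : ℝ} (hH : 0 < H) (hH1 : H ≤ 1) (hh : |h| ≤ H) :
    |(∫ y, f y * ker (Ioi 0) (x + (0, h) - y)) - ∫ y, f y * ker (Ioi 0) (x - y)|
      ≤ (36 * Real.pi * M + 4 * (E + 2 * Real.pi)) * (H * (1 + Real.log (1 / H))) := by
  have hM0 : 0 ≤ M := (abs_nonneg _).trans (hM 0)
  have hlog : 0 ≤ Real.log (1 / H) := Real.log_nonneg (by rw [le_div_iff₀ hH]; linarith)
  have h1 := enorm_potential_sub_le hf measurableSet_Ioi subset_rfl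
    (integrable_mul_ker_Ioi_zero hf hfi hM) x h
  rw [← Ioc_union_Ioi_eq_Ioi (zero_le_one' ℝ),
    lintegral_union measurableSet_Ioi (Ioc_disjoint_Ioi le_rfl)] at h1
  have h2 : ∫⁻ s in Ioc (0 : ℝ) 1, ENNReal.ofReal (wt s) * gauMod f x h s
      ≤ ENNReal.ofReal (4 * (E + 2 * Real.pi) * (H * (1 + Real.log (1 / H)))) := by
    calc _ ≤ ∫⁻ s in Ioc (0 : ℝ) 1, ENNReal.ofReal (wt s) *
          ENNReal.ofReal (2 * |h| * (E + 2 * Real.pi)) := by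
          refine setLIntegral_mono (by fun_prop) fun s hs => ?_
          refine mul_le_mul_right (gauMod_le_of_sq hf hE0 hE x hs.1 ?_) _
          have : h ^ 2 ≤ 1 := by
            rw [← sq_abs]; exact pow_le_one₀ (abs_nonneg _) (hh.trans hH1)
          nlinarith [hs.1, hs.2, sq_nonneg h]
      _ ≤ 2 * ENNReal.ofReal (2 * |h| * (E + 2 * Real.pi)) := by
          rw [lintegral_mul_const' _ _ ENNReal.ofReal_ne_top]
          exact mul_le_mul_left lintegral_wt_Ioc_zero_one _
      _ ≤ _ := by
          rw [show (2 : ℝ≥0∞) = ENNReal.ofReal 2 by simp, ← ENNReal.ofReal_mul (by norm_num)]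
          refine ENNReal.ofReal_le_ofReal ?_
          have h3 : |h| ≤ H * (1 + Real.log (1 / H)) := by nlinarith
          have h4 : 0 ≤ E + 2 * Real.pi := by positivity
          nlinarith
  have h3 := h1.trans (add_le_add h2 (lintegral_wt_gauMod_Ioi_one_le hM x hH hH1 hh))
  rw [← ENNReal.ofReal_add (by positivity) (by positivity), Real.enorm_eq_ofReal_abs,
    Ioc_union_Ioi_eq_Ioi (zero_le_one' ℝ), ENNReal.ofReal_le_ofReal_iff (by positivity)] at h3
  linarith

/-! ### Subordination on the Fourier side -/

lemma wt_mul_gau_dual {s : ℝ} (hs : 0 < s) (ξ : ℝ × ℝ) :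
    wt s * (Real.pi / s * gau (Real.pi ^ 2 / s) ξ)
      = (|(-1 : ℝ)| * s ^ (-1 - 1 : ℝ)) • (Real.pi * (wt (s ^ (-1 : ℝ)) *
        gau (s ^ (-1 : ℝ)) (Real.pi • ξ))) := by
  have e1 : gau (s ^ (-1 : ℝ)) (Real.pi • ξ) = gau (Real.pi ^ 2 / s) ξ := by
    simp only [gau, Real.rpow_neg_one, Prod.smul_fst, Prod.smul_snd, smul_eq_mul]
    congr 1; field_simp
  have e2 : (s ^ (-1 : ℝ)) ^ (-(1 / 2) : ℝ) = s ^ (1 / 2 : ℝ) := by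
    rw [← Real.rpow_mul hs.le]; norm_num
  have e3 : s ^ (-1 - 1 : ℝ) * s ^ (1 / 2 : ℝ) = s ^ (-(1 / 2) : ℝ) * s ^ (-1 : ℝ) := by
    rw [← Real.rpow_add hs, ← Real.rpow_add hs]; norm_num
  rw [e1, wt, wt, e2, div_eq_mul_inv Real.pi s, ← Real.rpow_neg_one s, abs_neg, abs_one, one_mul,
    smul_eq_mul]
  linear_combination -(1 / (2 * Real.pi * √Real.pi)) * Real.pi * gau (Real.pi ^ 2 / s) ξ * e3

lemma pi_smul_ne_zero {ξ : ℝ × ℝ} (hξ : ξ ≠ 0) : Real.pi • ξ ≠ 0 :=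
  smul_ne_zero Real.pi_ne_zero hξ

lemma integrableOn_wt_gau_dual {ξ : ℝ × ℝ} (hξ : ξ ≠ 0) :
    IntegrableOn (fun s => wt s * (Real.pi / s * gau (Real.pi ^ 2 / s) ξ)) (Ioi 0) := by
  have h := (integrableOn_wt_gau (pi_smul_ne_zero hξ)).const_mul Real.pi
  have h2 := (integrableOn_Ioi_comp_rpow_iff _ (p := -1) (by norm_num)).mpr h
  exact h2.congr_fun (fun s hs => (wt_mul_gau_dual hs ξ).symm) measurableSet_Ioi

lemma integral_wt_gau_dual {ξ : ℝ × ℝ} (hξ : ξ ≠ 0) :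
    ∫ s in Ioi 0, wt s * (Real.pi / s * gau (Real.pi ^ 2 / s) ξ)
      = 1 / (2 * Real.pi * euclid ξ) := by
  rw [setIntegral_congr_fun measurableSet_Ioi (fun s hs => wt_mul_gau_dual hs ξ),
    integral_comp_rpow_Ioi (fun y => Real.pi * (wt y * gau y (Real.pi • ξ))) (by norm_num),
    integral_const_mul, ← ker, ker_Ioi_zero (pi_smul_ne_zero hξ)]
  have e : euclid (Real.pi • ξ) = Real.pi * euclid ξ := by
    simp only [euclid, Prod.smul_fst, Prod.smul_snd, smul_eq_mul]
    rw [show (Real.pi * ξ.1) ^ 2 + (Real.pi * ξ.2) ^ 2 = Real.pi ^ 2 * (ξ.1 ^ 2 + ξ.2 ^ 2) by ring,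
      Real.sqrt_mul (sq_nonneg _), Real.sqrt_sq Real.pi_pos.le]
  have := (euclid_pos hξ).ne'
  rw [e]; field_simp

lemma lintegral_wt_gau_dual {ξ : ℝ × ℝ} (hξ : ξ ≠ 0) :
    ∫⁻ s in Ioi 0, ENNReal.ofReal (wt s) * ENNReal.ofReal (Real.pi / s * gau (Real.pi ^ 2 / s) ξ)
      = ENNReal.ofReal (1 / (2 * Real.pi * euclid ξ)) := by
  rw [← integral_wt_gau_dual hξ, ofReal_integral_eq_lintegral_ofReal (integrableOn_wt_gau_dual hξ)]
  · refine setLIntegral_congr_fun measurableSet_Ioi fun s hs => ?_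
    exact (ENNReal.ofReal_mul (wt_nonneg (le_of_lt hs))).symm
  · filter_upwards [ae_restrict_mem measurableSet_Ioi] with s hs
    have h0 : 0 < s := hs
    exact mul_nonneg (wt_nonneg h0.le) (mul_nonneg (by positivity) (gau_pos _ _).le)

/-! ### The Fourier transform on the plane -/

lemma enorm_complex_ofReal (r : ℝ) : ‖(r : ℂ)‖ₑ = ENNReal.ofReal |r| := by
  rw [← ofReal_norm, Complex.norm_real, Real.norm_eq_abs]

/-- The Fourier transform of a real function on the plane. -/
def ft (f : ℝ × ℝ → ℝ) (ξ : ℝ × ℝ) : ℂ := ∫ x, (f x : ℂ) * ch ξ x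

lemma measurable_ft {f : ℝ × ℝ → ℝ} (hf : Continuous f) : Measurable (ft f) := by
  have : Continuous fun p : (ℝ × ℝ) × (ℝ × ℝ) => (f p.2 : ℂ) * ch p.1 p.2 :=
    (Complex.continuous_ofReal.comp (hf.comp continuous_snd)).mul continuous_ch_uncurry
  exact (this.measurable.stronglyMeasurable.integral_prod_right (ν := volume)).measurable

lemma integral_mul_mul_gau {f g : ℝ × ℝ → ℝ} (hf : Integrable f) (hg : Integrable g) {s : ℝ}
    (hs : 0 < s) :
    ∫ p : (ℝ × ℝ) × (ℝ × ℝ), ((g p.1 * f p.2 * gau s (p.1 - p.2) : ℝ) : ℂ)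
      = ∫ ξ, ((Real.pi / s * gau (Real.pi ^ 2 / s) ξ : ℝ) : ℂ) *
          (ft g ξ * (starRingEnd ℂ) (ft f ξ)) := by
  have hG : Integrable fun ξ => Real.pi / s * gau (Real.pi ^ 2 / s) ξ :=
    (integrable_gau (by positivity)).const_mul _
  have hF : Integrable (fun q : ((ℝ × ℝ) × (ℝ × ℝ)) × (ℝ × ℝ) =>
      ((g q.1.1 * f q.1.2 * (Real.pi / s * gau (Real.pi ^ 2 / s) q.2) : ℝ) : ℂ) *
        ch q.2 (q.1.1 - q.1.2)) ((volume.prod volume).prod volume) := by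
    refine (((hg.mul_prod hf).mul_prod hG).ofReal).mul_bdd (c := 1) ?_ ?_
    · exact (continuous_ch_uncurry.comp (by fun_prop : Continuous
        fun q : ((ℝ × ℝ) × (ℝ × ℝ)) × (ℝ × ℝ) => (q.2, q.1.1 - q.1.2))).aestronglyMeasurable
    · exact Filter.Eventually.of_forall fun q => by simp
  calc ∫ p : (ℝ × ℝ) × (ℝ × ℝ), ((g p.1 * f p.2 * gau s (p.1 - p.2) : ℝ) : ℂ)
      = ∫ p : (ℝ × ℝ) × (ℝ × ℝ), ∫ ξ,
        ((g p.1 * f p.2 * (Real.pi / s * gau (Real.pi ^ 2 / s) ξ) : ℝ) : ℂ) *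
        ch ξ (p.1 - p.2) := by
        refine integral_congr_ae (Filter.Eventually.of_forall fun p => ?_)
        simp only
        rw [Complex.ofReal_mul, gau_eq_integral_ch hs, ← integral_const_mul]
        refine integral_congr_ae (Filter.Eventually.of_forall fun ξ => ?_)
        simp only; push_cast; ring
    _ = ∫ ξ, ∫ p : (ℝ × ℝ) × (ℝ × ℝ),
        ((g p.1 * f p.2 * (Real.pi / s * gau (Real.pi ^ 2 / s) ξ) : ℝ) : ℂ) *
        ch ξ (p.1 - p.2) := integral_integral_swap hF
    _ = _ := by
        refine integral_congr_ae (Filter.Eventually.of_forall fun ξ => ?_)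
        simp only
        have hc : (starRingEnd ℂ) (ft f ξ) = ∫ y, (f y : ℂ) * (starRingEnd ℂ) (ch ξ y) := by
          rw [ft, ← integral_conj]; simp
        rw [hc, ft, ← integral_prod_mul, ← integral_const_mul]
        refine integral_congr_ae (Filter.Eventually.of_forall fun p => ?_)
        simp only [ch_sub]; push_cast; ring

lemma lintegral_gau_mul_ft_le {f : ℝ × ℝ → ℝ} (hfc : Continuous f) (hf : Integrable f) {s : ℝ}
    (hs : 0 < s) :
    ∫⁻ ξ, ENNReal.ofReal (gau (Real.pi ^ 2 / s) ξ) * ‖ft f ξ‖ₑ ^ 2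
      ≤ ∫⁻ x, ENNReal.ofReal (f x ^ 2) := by
  have hpi := Real.pi_pos
  have hps : 0 < Real.pi / s := by positivity
  have hgm : Measurable fun p : (ℝ × ℝ) × (ℝ × ℝ) => ENNReal.ofReal (gau s (p.1 - p.2)) := by
    have : Continuous fun p : (ℝ × ℝ) × (ℝ × ℝ) => gau s (p.1 - p.2) := by unfold gau; fun_prop
    exact this.measurable.ennreal_ofReal
  have hf2 : Measurable fun x => ENNReal.ofReal (f x ^ 2) := by fun_prop
  have hA : Measurable fun p : (ℝ × ℝ) × (ℝ × ℝ) =>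
      ENNReal.ofReal (f p.1 ^ 2) * ENNReal.ofReal (gau s (p.1 - p.2)) :=
    (hf2.comp measurable_fst).mul hgm
  have hB : Measurable fun p : (ℝ × ℝ) × (ℝ × ℝ) =>
      ENNReal.ofReal (f p.2 ^ 2) * ENNReal.ofReal (gau s (p.1 - p.2)) :=
    (hf2.comp measurable_snd).mul hgm
  have key : ENNReal.ofReal (Real.pi / s) *
      ∫⁻ ξ, ENNReal.ofReal (gau (Real.pi ^ 2 / s) ξ) * ‖ft f ξ‖ₑ ^ 2
      ≤ ENNReal.ofReal (Real.pi / s) * ∫⁻ x, ENNReal.ofReal (f x ^ 2) := by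
    have hbd : ∀ ξ, ‖ft f ξ‖ ≤ ∫ x, |f x| := fun ξ =>
      (norm_integral_le_integral_norm _).trans (by simp)
    have hint : Integrable fun ξ => Real.pi / s * gau (Real.pi ^ 2 / s) ξ * ‖ft f ξ‖ ^ 2 := by
      refine ((integrable_gau (by positivity)).const_mul _).mul_bdd (c := (∫ x, |f x|) ^ 2)
        ((measurable_ft hfc).norm.pow_const 2).aestronglyMeasurable ?_
      refine Filter.Eventually.of_forall fun ξ => ?_
      rw [norm_pow, norm_norm]
      exact pow_le_pow_left₀ (norm_nonneg _) (hbd ξ) 2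
    have e1 : ENNReal.ofReal (Real.pi / s) *
        ∫⁻ ξ, ENNReal.ofReal (gau (Real.pi ^ 2 / s) ξ) * ‖ft f ξ‖ₑ ^ 2
        = ‖∫ ξ, ((Real.pi / s * gau (Real.pi ^ 2 / s) ξ : ℝ) : ℂ) *
          (ft f ξ * (starRingEnd ℂ) (ft f ξ))‖ₑ := by
      have e2 : ∀ ξ, ((Real.pi / s * gau (Real.pi ^ 2 / s) ξ : ℝ) : ℂ) *
          (ft f ξ * (starRingEnd ℂ) (ft f ξ))
          = ((Real.pi / s * gau (Real.pi ^ 2 / s) ξ * ‖ft f ξ‖ ^ 2 : ℝ) : ℂ) := by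
        intro ξ; rw [Complex.mul_conj']; push_cast; ring
      simp_rw [e2]
      have h0 : ∀ ξ, 0 ≤ Real.pi / s * gau (Real.pi ^ 2 / s) ξ * ‖ft f ξ‖ ^ 2 := fun ξ =>
        mul_nonneg (mul_nonneg hps.le (gau_pos _ _).le) (by positivity)
      rw [integral_complex_ofReal, enorm_complex_ofReal, abs_of_nonneg (integral_nonneg h0),
        ofReal_integral_eq_lintegral_ofReal hint (Filter.Eventually.of_forall h0),
        ← lintegral_const_mul' _ _ ENNReal.ofReal_ne_top]
      refine lintegral_congr fun ξ => ?_
      rw [ENNReal.ofReal_mul (mul_nonneg hps.le (gau_pos _ _).le), ENNReal.ofReal_mul hps.le,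
        ENNReal.ofReal_pow (norm_nonneg _), ofReal_norm, mul_assoc]
    rw [e1, ← integral_mul_mul_gau hf hf hs]
    refine (enorm_integral_le_lintegral_enorm _).trans ?_
    have h2 : ∫⁻ p : (ℝ × ℝ) × (ℝ × ℝ), 2 * ‖((f p.1 * f p.2 * gau s (p.1 - p.2) : ℝ) : ℂ)‖ₑ
        ≤ 2 * (ENNReal.ofReal (Real.pi / s) * ∫⁻ x, ENNReal.ofReal (f x ^ 2)) := by
      calc _ ≤ ∫⁻ p : (ℝ × ℝ) × (ℝ × ℝ),
            (ENNReal.ofReal (f p.1 ^ 2) * ENNReal.ofReal (gau s (p.1 - p.2)) +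
            ENNReal.ofReal (f p.2 ^ 2) * ENNReal.ofReal (gau s (p.1 - p.2))) := by
            refine lintegral_mono fun p => ?_
            rw [enorm_complex_ofReal, abs_mul, abs_of_pos (gau_pos _ _),
              ← add_mul, ← ENNReal.ofReal_add (sq_nonneg _) (sq_nonneg _),
              ← ENNReal.ofReal_mul (by positivity),
              show (2 : ℝ≥0∞) = ENNReal.ofReal 2 by simp, ← ENNReal.ofReal_mul (by norm_num),
              abs_mul, ← mul_assoc]
            refine ENNReal.ofReal_le_ofReal ?_
            refine mul_le_mul_of_nonneg_right ?_ (gau_pos _ _).le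
            rw [← mul_assoc, ← sq_abs (f p.1), ← sq_abs (f p.2)]
            exact two_mul_le_add_sq _ _
        _ = _ := by
            rw [lintegral_add_left hA, two_mul]
            congr 1
            · rw [Measure.volume_eq_prod, lintegral_prod _ hA.aemeasurable,
                ← lintegral_const_mul' _ _ ENNReal.ofReal_ne_top]
              refine lintegral_congr fun x => ?_
              simp only
              rw [lintegral_const_mul' _ _ ENNReal.ofReal_ne_top, lintegral_gau_sub_left hs,
                mul_comm]
            · rw [Measure.volume_eq_prod, lintegral_prod_symm _ hB.aemeasurable,
                ← lintegral_const_mul' _ _ ENNReal.ofReal_ne_top]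
              refine lintegral_congr fun y => ?_
              simp only
              rw [lintegral_const_mul' _ _ ENNReal.ofReal_ne_top]
              have : ∀ x, gau s (x - y) = gau s (y - x) := fun x => by
                rw [← gau_neg, neg_sub]
              simp only [this]
              rw [lintegral_gau_sub_left hs, mul_comm]
    rw [lintegral_const_mul' _ _ (by simp)] at h2
    exact (ENNReal.mul_le_mul_iff_right (by simp) (by simp)).mp h2
  exact (ENNReal.mul_le_mul_iff_right (by simpa using hps) ENNReal.ofReal_ne_top).mp key

/-- Half of Plancherel's identity. -/
theorem lintegral_ft_sq_le {f : ℝ × ℝ → ℝ} (hfc : Continuous f) (hf : Integrable f) :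
    ∫⁻ ξ, ‖ft f ξ‖ₑ ^ 2 ≤ ∫⁻ x, ENNReal.ofReal (f x ^ 2) := by
  have hlim : ∀ ξ, Filter.Tendsto (fun n : ℕ =>
      ENNReal.ofReal (gau (Real.pi ^ 2 / ((n : ℝ) + 1)) ξ) * ‖ft f ξ‖ₑ ^ 2) Filter.atTop
      (nhds (‖ft f ξ‖ₑ ^ 2)) := by
    intro ξ
    have h1 : Filter.Tendsto (fun n : ℕ => Real.pi ^ 2 / ((n : ℝ) + 1)) Filter.atTop (nhds 0) := by
      have := (tendsto_one_div_add_atTop_nhds_zero_nat (𝕜 := ℝ)).const_mul (Real.pi ^ 2)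
      simpa [div_eq_mul_inv] using this
    have hc : Continuous fun a : ℝ => gau a ξ := by unfold gau; fun_prop
    have h2 := ENNReal.tendsto_ofReal ((hc.tendsto 0).comp h1)
    have h3 := ENNReal.Tendsto.mul_const (b := ‖ft f ξ‖ₑ ^ 2) h2 (Or.inl (by simp [gau]))
    simpa [gau] using h3
  calc ∫⁻ ξ, ‖ft f ξ‖ₑ ^ 2 = ∫⁻ ξ, Filter.liminf (fun n : ℕ =>
      ENNReal.ofReal (gau (Real.pi ^ 2 / ((n : ℝ) + 1)) ξ) * ‖ft f ξ‖ₑ ^ 2) Filter.atTop :=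
        lintegral_congr fun ξ => ((hlim ξ).liminf_eq).symm
    _ ≤ Filter.liminf (fun n : ℕ => ∫⁻ ξ,
      ENNReal.ofReal (gau (Real.pi ^ 2 / ((n : ℝ) + 1)) ξ) * ‖ft f ξ‖ₑ ^ 2) Filter.atTop := by
        refine lintegral_liminf_le fun n => ?_
        exact (continuous_gau _).measurable.ennreal_ofReal.mul
          ((measurable_ft hfc).enorm.pow_const 2)
    _ ≤ _ := by
        refine Filter.liminf_le_of_le (by isBoundedDefault) fun b hb => ?_
        obtain ⟨n, hn⟩ := hb.exists
        exact hn.trans (lintegral_gau_mul_ft_le hfc hf (by positivity))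

/-! ### The gradient of a Riesz potential of order one -/

lemma integrable_mul_mul_ker {f g : ℝ × ℝ → ℝ} (hfc : Continuous f) (hf : Integrable f) {M : ℝ}
    (hM : ∀ y, |f y| ≤ M) (hgc : Continuous g) (hg : Integrable g) :
    Integrable fun p : (ℝ × ℝ) × (ℝ × ℝ) => g p.1 * (f p.2 * ker (Ioi 0) (p.1 - p.2)) := by
  have hM0 : 0 ≤ M := (abs_nonneg _).trans (hM 0)
  have hmeas : Measurable fun p : (ℝ × ℝ) × (ℝ × ℝ) =>
      g p.1 * (f p.2 * ker (Ioi 0) (p.1 - p.2)) :=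
    (hgc.measurable.comp measurable_fst).mul ((hfc.measurable.comp measurable_snd).mul
      ((measurable_ker _).comp (measurable_fst.sub measurable_snd)))
  rw [Measure.volume_eq_prod, integrable_prod_iff hmeas.aestronglyMeasurable]
  refine ⟨Filter.Eventually.of_forall fun x =>
    (integrable_mul_ker_Ioi_zero hfc hf hM x).const_mul (g x), ?_⟩
  refine (hg.norm.mul_const ((∫ y, |f y| * 2) + ∫ z, M * ker (Ioi 1) z)).mono'
    hmeas.aestronglyMeasurable.norm.integral_prod_right' (Filter.Eventually.of_forall fun x => ?_)
  rw [Real.norm_of_nonneg (integral_nonneg fun y => norm_nonneg _)]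
  simp only [norm_mul]
  rw [integral_const_mul]
  refine mul_le_mul_of_nonneg_left ?_ (norm_nonneg _)
  have h1 : ∫ z, M * ker (Ioi 1) z = ∫ y, M * ker (Ioi 1) (x - y) :=
    (integral_sub_left_eq_self (fun z => M * ker (Ioi 1) z) volume x).symm
  have i2 : Integrable fun y => M * ker (Ioi 1) (x - y) :=
    (integrable_ker_Ioi_one.comp_sub_left x).const_mul M
  rw [h1, ← integral_add (hf.abs.mul_const 2) i2]
  refine integral_mono_ae ?_ ((hf.abs.mul_const 2).add i2) ?_
  · simpa only [norm_mul] using (integrable_mul_ker_Ioi_zero hfc hf hM x).norm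
  · filter_upwards [ae_sub_ne_zero x] with y hy
    have hk := ker_nonneg measurableSet_Ioi (Ioi_subset_Ioi zero_le_one) (x - y)
    have hk0 := ker_nonneg measurableSet_Ioc Ioc_subset_Ioi_self (x - y) (I := Ioc 0 1)
    rw [Real.norm_eq_abs, Real.norm_of_nonneg (ker_nonneg measurableSet_Ioi subset_rfl _),
      ker_Ioi_zero_eq_add hy, mul_add]
    gcongr
    · exact ker_Ioc_zero_one_le hy
    · exact hM y

lemma integral_mul_mul_ker_eq {f g : ℝ × ℝ → ℝ} (hfc : Continuous f) (hf : Integrable f) {M : ℝ}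
    (hM : ∀ y, |f y| ≤ M) (hgc : Continuous g) (hg : Integrable g) :
    ∫ p : (ℝ × ℝ) × (ℝ × ℝ), g p.1 * (f p.2 * ker (Ioi 0) (p.1 - p.2))
      = ∫ s in Ioi 0, wt s * ∫ p : (ℝ × ℝ) × (ℝ × ℝ), g p.1 * f p.2 * gau s (p.1 - p.2) := by
  have hae : ∀ᵐ p : (ℝ × ℝ) × (ℝ × ℝ), p.1 - p.2 ≠ 0 := by
    have hms : MeasurableSet {p : (ℝ × ℝ) × (ℝ × ℝ) | p.1 - p.2 ≠ 0} :=
      (measurable_fst.sub measurable_snd) (measurableSet_singleton 0).compl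
    rw [Measure.volume_eq_prod, Measure.ae_prod_iff_ae_ae hms]
    exact Filter.Eventually.of_forall fun x => ae_sub_ne_zero x
  have hmeas : Measurable fun q : ((ℝ × ℝ) × (ℝ × ℝ)) × ℝ =>
      wt q.2 * (g q.1.1 * f q.1.2 * gau q.2 (q.1.1 - q.1.2)) := by
    have h1 : Continuous fun q : ((ℝ × ℝ) × (ℝ × ℝ)) × ℝ => gau q.2 (q.1.1 - q.1.2) := by
      unfold gau; fun_prop
    have h2 : Continuous fun q : ((ℝ × ℝ) × (ℝ × ℝ)) × ℝ =>
        g q.1.1 * f q.1.2 * gau q.2 (q.1.1 - q.1.2) := by fun_prop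
    exact (measurable_wt.comp measurable_snd).mul h2.measurable
  have hF : Integrable (fun q : ((ℝ × ℝ) × (ℝ × ℝ)) × ℝ =>
      wt q.2 * (g q.1.1 * f q.1.2 * gau q.2 (q.1.1 - q.1.2)))
      (volume.prod (volume.restrict (Ioi 0))) := by
    rw [integrable_prod_iff hmeas.aestronglyMeasurable]
    constructor
    · filter_upwards [hae] with p hp
      refine ((integrableOn_wt_gau hp).const_mul (g p.1 * f p.2)).congr
        (Filter.Eventually.of_forall fun s => ?_)
      ring
    · refine (integrable_mul_mul_ker hfc hf hM hgc hg).norm.congr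
        (Filter.Eventually.of_forall fun p => ?_)
      simp only
      rw [norm_mul, norm_mul, Real.norm_of_nonneg (ker_nonneg measurableSet_Ioi subset_rfl _), ker,
        ← mul_assoc, ← integral_const_mul]
      refine setIntegral_congr_fun measurableSet_Ioi fun s hs => ?_
      simp only [norm_mul, Real.norm_of_nonneg (wt_nonneg (le_of_lt hs)),
        Real.norm_of_nonneg (gau_pos s _).le]
      ring
  calc _ = ∫ p : (ℝ × ℝ) × (ℝ × ℝ), ∫ s in Ioi 0,
        wt s * (g p.1 * f p.2 * gau s (p.1 - p.2)) := by
        refine integral_congr_ae (Filter.Eventually.of_forall fun p => ?_)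
        simp only
        rw [ker, ← mul_assoc, ← integral_const_mul]
        refine integral_congr_ae (Filter.Eventually.of_forall fun s => ?_)
        simp only; ring
    _ = ∫ s in Ioi 0, ∫ p : (ℝ × ℝ) × (ℝ × ℝ),
        wt s * (g p.1 * f p.2 * gau s (p.1 - p.2)) := integral_integral_swap hF
    _ = _ := by simp_rw [integral_const_mul]

lemma abs_integral_mul_mul_ker_le {f g G : ℝ × ℝ → ℝ} (hfc : Continuous f) (hf : Integrable f)
    {M : ℝ} (hM : ∀ y, |f y| ≤ M) (hgc : Continuous g) (hg : Integrable g) (hGc : Continuous G)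
    (hG : Integrable G) (hGg : ∀ ξ, ‖ft G ξ‖ ≤ 2 * Real.pi * euclid ξ * ‖ft g ξ‖) {E F : ℝ}
    (hE0 : 0 ≤ E) (hF0 : 0 ≤ F) (hE : ∫⁻ y, ENNReal.ofReal (f y ^ 2) ≤ ENNReal.ofReal E)
    (hF : ∫⁻ y, ENNReal.ofReal (g y ^ 2) ≤ ENNReal.ofReal F) :
    |∫ p : (ℝ × ℝ) × (ℝ × ℝ), G p.1 * (f p.2 * ker (Ioi 0) (p.1 - p.2))| ≤ E + F := by
  have hp := Real.pi_pos
  have hmf : Measurable fun ξ => ‖ft f ξ‖ₑ := (measurable_ft hfc).enorm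
  have hmG : Measurable fun ξ => ‖ft G ξ‖ₑ := (measurable_ft hGc).enorm
  have hmg : Measurable fun ξ => ‖ft g ξ‖ₑ := (measurable_ft hgc).enorm
  have hm : Measurable fun q : ℝ × (ℝ × ℝ) => ENNReal.ofReal (wt q.1) *
      (ENNReal.ofReal (Real.pi / q.1 * gau (Real.pi ^ 2 / q.1) q.2) *
        (‖ft G q.2‖ₑ * ‖ft f q.2‖ₑ)) := by
    have h1 : Measurable fun q : ℝ × (ℝ × ℝ) => Real.pi / q.1 * gau (Real.pi ^ 2 / q.1) q.2 := by
      unfold gau; fun_prop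
    exact (measurable_wt.comp measurable_fst).ennreal_ofReal.mul
      (h1.ennreal_ofReal.mul ((hmG.comp measurable_snd).mul (hmf.comp measurable_snd)))
  have key : ‖∫ p : (ℝ × ℝ) × (ℝ × ℝ), G p.1 * (f p.2 * ker (Ioi 0) (p.1 - p.2))‖ₑ
      ≤ ENNReal.ofReal (E + F) := by
    rw [integral_mul_mul_ker_eq hfc hf hM hGc hG]
    calc _ ≤ ∫⁻ s in Ioi 0, ENNReal.ofReal (wt s) *
          ∫⁻ ξ, ENNReal.ofReal (Real.pi / s * gau (Real.pi ^ 2 / s) ξ) *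
            (‖ft G ξ‖ₑ * ‖ft f ξ‖ₑ) := by
          refine (enorm_integral_le_lintegral_enorm _).trans
            (setLIntegral_mono' measurableSet_Ioi fun s hs => ?_)
          have hs0 : 0 < s := hs
          rw [enorm_mul, Real.enorm_of_nonneg (wt_nonneg hs0.le)]
          gcongr
          rw [Real.enorm_eq_ofReal_abs, ← enorm_complex_ofReal, ← integral_complex_ofReal,
            integral_mul_mul_gau hf hG hs0]
          refine (enorm_integral_le_lintegral_enorm _).trans (lintegral_mono fun ξ => le_of_eq ?_)
          rw [enorm_mul, enorm_mul, enorm_complex_ofReal, abs_of_nonneg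
            (mul_nonneg (by positivity) (gau_pos _ _).le)]
          congr 2
          rw [← ofReal_norm, ← ofReal_norm, RCLike.norm_conj]
      _ = ∫⁻ s in Ioi 0, ∫⁻ ξ, ENNReal.ofReal (wt s) *
          (ENNReal.ofReal (Real.pi / s * gau (Real.pi ^ 2 / s) ξ) *
            (‖ft G ξ‖ₑ * ‖ft f ξ‖ₑ)) := by
          simp_rw [lintegral_const_mul' _ _ ENNReal.ofReal_ne_top]
      _ = ∫⁻ ξ, ∫⁻ s in Ioi 0, ENNReal.ofReal (wt s) *
          (ENNReal.ofReal (Real.pi / s * gau (Real.pi ^ 2 / s) ξ) *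
            (‖ft G ξ‖ₑ * ‖ft f ξ‖ₑ)) := lintegral_lintegral_swap hm.aemeasurable
      _ ≤ ∫⁻ ξ, (‖ft g ξ‖ₑ ^ 2 + ‖ft f ξ‖ₑ ^ 2) := by
          refine lintegral_mono_ae ?_
          filter_upwards [ae_ne_zero_prod] with ξ hξ
          have hxi := euclid_pos hξ
          simp_rw [← mul_assoc _ _ (‖ft G ξ‖ₑ * ‖ft f ξ‖ₑ)]
          rw [lintegral_mul_const' _ _ (ENNReal.mul_ne_top enorm_ne_top enorm_ne_top),
            lintegral_wt_gau_dual hξ]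
          simp only [← ofReal_norm]
          rw [← ENNReal.ofReal_mul (norm_nonneg _), ← ENNReal.ofReal_mul (by positivity),
            ← ENNReal.ofReal_pow (norm_nonneg _), ← ENNReal.ofReal_pow (norm_nonneg _),
            ← ENNReal.ofReal_add (by positivity) (by positivity)]
          refine ENNReal.ofReal_le_ofReal ?_
          calc 1 / (2 * Real.pi * euclid ξ) * (‖ft G ξ‖ * ‖ft f ξ‖)
              ≤ 1 / (2 * Real.pi * euclid ξ) *
                (2 * Real.pi * euclid ξ * ‖ft g ξ‖ * ‖ft f ξ‖) := by
                gcongr; exact hGg ξ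
            _ = ‖ft g ξ‖ * ‖ft f ξ‖ := by field_simp
            _ ≤ _ := by nlinarith [sq_nonneg (‖ft g ξ‖ - ‖ft f ξ‖), norm_nonneg (ft g ξ),
                norm_nonneg (ft f ξ)]
      _ ≤ ENNReal.ofReal (E + F) := by
          rw [lintegral_add_left (hmg.pow_const 2), ENNReal.ofReal_add hE0 hF0, add_comm]
          exact add_le_add ((lintegral_ft_sq_le hfc hf).trans hE)
            ((lintegral_ft_sq_le hgc hg).trans hF)
  rwa [Real.enorm_eq_ofReal_abs, ENNReal.ofReal_le_ofReal_iff (by positivity)] at key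

lemma hasFDerivAt_ch (ξ x : ℝ × ℝ) :
    HasFDerivAt (ch ξ) ((ch ξ x * -(2 * Real.pi * Complex.I)) •
      (Complex.ofRealCLM.comp (ξ.1 • ContinuousLinearMap.fst ℝ ℝ ℝ +
        ξ.2 • ContinuousLinearMap.snd ℝ ℝ ℝ))) x := by
  have h1 : HasFDerivAt (fun y : ℝ × ℝ => Complex.ofRealCLM
      ((ξ.1 • ContinuousLinearMap.fst ℝ ℝ ℝ + ξ.2 • ContinuousLinearMap.snd ℝ ℝ ℝ) y))
      (Complex.ofRealCLM.comp (ξ.1 • ContinuousLinearMap.fst ℝ ℝ ℝ +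
        ξ.2 • ContinuousLinearMap.snd ℝ ℝ ℝ)) x :=
    (Complex.ofRealCLM.comp (ξ.1 • ContinuousLinearMap.fst ℝ ℝ ℝ +
        ξ.2 • ContinuousLinearMap.snd ℝ ℝ ℝ)).hasFDerivAt
  have h2 := (h1.const_mul (-(2 * Real.pi * Complex.I))).cexp
  have e : ch ξ = fun y => Complex.exp (-(2 * Real.pi * Complex.I) * Complex.ofRealCLM
      ((ξ.1 • ContinuousLinearMap.fst ℝ ℝ ℝ + ξ.2 • ContinuousLinearMap.snd ℝ ℝ ℝ) y)) := by
    funext y; simp [ch]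
  have h3 : ch ξ x = Complex.exp (-(2 * Real.pi * Complex.I) * Complex.ofRealCLM
      ((ξ.1 • ContinuousLinearMap.fst ℝ ℝ ℝ + ξ.2 • ContinuousLinearMap.snd ℝ ℝ ℝ) x)) :=
    congrFun e x
  rw [h3, e, mul_smul]
  exact h2

lemma norm_ft_fderiv_le {g : ℝ × ℝ → ℝ} (hg : ContDiff ℝ 1 g) (hgs : HasCompactSupport g)
    {v : ℝ × ℝ} (hv : v.1 ^ 2 + v.2 ^ 2 ≤ 1) (ξ : ℝ × ℝ) :
    ‖ft (fun x => fderiv ℝ g x v) ξ‖ ≤ 2 * Real.pi * euclid ξ * ‖ft g ξ‖ := by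
  have hdc : Continuous fun x => fderiv ℝ g x v :=
    (hg.continuous_fderiv one_ne_zero).clm_apply continuous_const
  have hds : HasCompactSupport fun x => fderiv ℝ g x v := hgs.fderiv_apply (𝕜 := ℝ) v
  have hgC : ∀ x, HasFDerivAt (fun y => (g y : ℂ)) (Complex.ofRealCLM.comp (fderiv ℝ g x)) x :=
    fun x => Complex.ofRealCLM.hasFDerivAt.comp x (hg.differentiable one_ne_zero x).hasFDerivAt
  have hi : ∀ (u : ℝ × ℝ → ℝ) (w : ℝ × ℝ → ℂ), Continuous u → HasCompactSupport u →
      Continuous w → Integrable fun x => w x * (u x : ℂ) := by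
    intro u w hu hus hw
    refine (hw.mul (Complex.continuous_ofReal.comp hu)).integrable_of_hasCompactSupport ?_
    exact (hus.comp_left (g := fun r : ℝ => (r : ℂ)) Complex.ofReal_zero).mul_left
  have key := integral_bilinear_hasFDerivAt_right_eq_neg_left_of_integrable (μ := volume)
    (f := ch ξ) (g := fun y => (g y : ℂ)) (v := v) (B := ContinuousLinearMap.mul ℝ ℂ)
    (f' := fun x => ((ch ξ x * -(2 * Real.pi * Complex.I)) •
      (Complex.ofRealCLM.comp (ξ.1 • ContinuousLinearMap.fst ℝ ℝ ℝ +
        ξ.2 • ContinuousLinearMap.snd ℝ ℝ ℝ))))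
    (g' := fun x => Complex.ofRealCLM.comp (fderiv ℝ g x)) ?_ ?_ ?_
    (fun x _ => hasFDerivAt_ch ξ x) (fun x _ => hgC x)
  · simp only [ContinuousLinearMap.mul_apply', ContinuousLinearMap.comp_apply,
      Complex.ofRealCLM_apply, smul_apply, smul_eq_mul] at key
    have e1 : ft (fun x => fderiv ℝ g x v) ξ
        = (2 * Real.pi * Complex.I * ((ξ.1 * v.1 + ξ.2 * v.2 : ℝ) : ℂ)) * ft g ξ := by
      rw [ft, ft, ← integral_const_mul]
      calc _ = ∫ x, ch ξ x * (fderiv ℝ g x v : ℂ) :=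
            integral_congr_ae (Filter.Eventually.of_forall fun x => mul_comm _ _)
        _ = _ := by
            rw [key, ← integral_neg]
            refine integral_congr_ae (Filter.Eventually.of_forall fun x => ?_)
            simp
            ring
    rw [e1, norm_mul]
    gcongr
    rw [norm_mul, norm_mul, norm_mul, Complex.norm_I, Complex.norm_real, Complex.norm_real,
      Complex.norm_ofNat, Real.norm_of_nonneg Real.pi_pos.le, mul_one]
    gcongr
    rw [Real.norm_eq_abs, euclid]
    refine Real.abs_le_sqrt ?_
    nlinarith [sq_nonneg (ξ.1 * v.2 - ξ.2 * v.1), sq_nonneg ξ.1, sq_nonneg ξ.2]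
  · exact hi g (fun x => ((ch ξ x * -(2 * Real.pi * Complex.I)) •
      (Complex.ofRealCLM.comp (ξ.1 • ContinuousLinearMap.fst ℝ ℝ ℝ +
        ξ.2 • ContinuousLinearMap.snd ℝ ℝ ℝ))) v) hg.continuous hgs (by fun_prop)
  · exact hi _ (ch ξ) hdc hds (continuous_ch ξ)
  · exact hi _ (ch ξ) hg.continuous hgs (continuous_ch ξ)

lemma riesz_eq_ker {f ψ : ℝ × ℝ → ℝ} (h : IsInvSqrtLaplacian .plane f ψ) (x : ℝ × ℝ) :
    ψ x = ∫ y, f y * ker (Ioi 0) (x - y) := by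
  rw [show ψ x = _ from h x, ← integral_const_mul]
  refine integral_congr_ae ?_
  filter_upwards [ae_sub_ne_zero x] with y hy
  have := euclid_pos hy
  rw [ker_Ioi_zero hy]; field_simp

/-- The gradient of the Riesz potential of order one is bounded in `L²`, in dual form. -/
theorem abs_integral_mul_fderiv_riesz_le {f g ψ : ℝ × ℝ → ℝ} (hfc : Continuous f)
    (hf : Integrable f) {M : ℝ} (hM : ∀ y, |f y| ≤ M) (hψ : IsInvSqrtLaplacian .plane f ψ)
    (hψc : ContDiff ℝ 1 ψ) (hg : ContDiff ℝ 1 g) (hgs : HasCompactSupport g)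
    {v : ℝ × ℝ} (hv : v.1 ^ 2 + v.2 ^ 2 ≤ 1) {E F : ℝ}
    (hE0 : 0 ≤ E) (hF0 : 0 ≤ F) (hE : ∫⁻ y, ENNReal.ofReal (f y ^ 2) ≤ ENNReal.ofReal E)
    (hF : ∫⁻ y, ENNReal.ofReal (g y ^ 2) ≤ ENNReal.ofReal F) :
    |∫ x, g x * fderiv ℝ ψ x v| ≤ E + F := by
  have hdc : Continuous fun x => fderiv ℝ g x v :=
    (hg.continuous_fderiv one_ne_zero).clm_apply continuous_const
  have hds : HasCompactSupport fun x => fderiv ℝ g x v := hgs.fderiv_apply (𝕜 := ℝ) v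
  have hdi : Integrable fun x => fderiv ℝ g x v := hdc.integrable_of_hasCompactSupport hds
  have hψd : Continuous fun x => fderiv ℝ ψ x v :=
    (hψc.continuous_fderiv one_ne_zero).clm_apply continuous_const
  rw [integral_mul_fderiv_eq_neg_fderiv_mul_of_integrable
    ((hdc.mul hψc.continuous).integrable_of_hasCompactSupport hds.mul_right)
    ((hg.continuous.mul hψd).integrable_of_hasCompactSupport hgs.mul_right)
    ((hg.continuous.mul hψc.continuous).integrable_of_hasCompactSupport hgs.mul_right)
    (fun x _ => hg.differentiable one_ne_zero x) (fun x _ => hψc.differentiable one_ne_zero x),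
    abs_neg]
  have e : ∫ x, fderiv ℝ g x v * ψ x
      = ∫ p : (ℝ × ℝ) × (ℝ × ℝ), fderiv ℝ g p.1 v * (f p.2 * ker (Ioi 0) (p.1 - p.2)) := by
    refine Eq.trans ?_ (integral_prod _ (integrable_mul_mul_ker hfc hf hM hdc hdi)).symm
    refine integral_congr_ae (Filter.Eventually.of_forall fun x => ?_)
    simp only
    rw [riesz_eq_ker hψ x, integral_const_mul]
  rw [e]
  exact abs_integral_mul_mul_ker_le hfc hf hM hg.continuous
    (hg.continuous.integrable_of_hasCompactSupport hgs) hdc hdi (norm_ft_fderiv_le hg hgs hv)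
    hE0 hF0 hE hF

/-! ### Partial derivatives -/

lemma d₁_eq_fderiv {f : ℝ × ℝ → ℝ} {x : ℝ × ℝ} (hf : DifferentiableAt ℝ f x) :
    d₁ f x = fderiv ℝ f x (1, 0) := by
  have h : HasDerivAt (fun s : ℝ => (s, x.2)) ((1 : ℝ), (0 : ℝ)) x.1 :=
    (hasDerivAt_id x.1).prodMk (hasDerivAt_const x.1 x.2)
  exact (hf.hasFDerivAt.comp_hasDerivAt (x := x.1) (f := fun s : ℝ => (s, x.2)) h).deriv

lemma d₂_eq_fderiv {f : ℝ × ℝ → ℝ} {x : ℝ × ℝ} (hf : DifferentiableAt ℝ f x) :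
    d₂ f x = fderiv ℝ f x (0, 1) := by
  have h : HasDerivAt (fun s : ℝ => (x.1, s)) ((0 : ℝ), (1 : ℝ)) x.2 :=
    (hasDerivAt_const x.2 x.1).prodMk (hasDerivAt_id x.2)
  exact (hf.hasFDerivAt.comp_hasDerivAt (x := x.2) (f := fun s : ℝ => (x.1, s)) h).deriv

/-! ### Periodic functions -/

lemma setIntegral_unitSquare {E : Type*} [NormedAddCommGroup E] [NormedSpace ℝ E]
    {F : ℝ × ℝ → E} (hF : Continuous F) :
    ∫ x in unitSquare, F x = ∫ a in (0 : ℝ)..1, ∫ b in (0 : ℝ)..1, F (a, b) := by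
  have hi : IntegrableOn F unitSquare (volume.prod volume) :=
    (hF.continuousOn.integrableOn_compact (isCompact_Icc.prod isCompact_Icc)).mono_set
      (prod_mono Ico_subset_Icc_self Ico_subset_Icc_self)
  rw [unitSquare, Measure.volume_eq_prod, setIntegral_prod _ hi, integral_Ico_eq_integral_Ioc,
    intervalIntegral.integral_of_le zero_le_one]
  refine integral_congr_ae (Filter.Eventually.of_forall fun a => ?_)
  simp only
  rw [integral_Ico_eq_integral_Ioc, intervalIntegral.integral_of_le zero_le_one]

lemma setIntegral_unitSquare_translate {E : Type*} [NormedAddCommGroup E] [NormedSpace ℝ E]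
    {F : ℝ × ℝ → E} (hF : Continuous F) (h₁ : ∀ x : ℝ × ℝ, F (x.1 + 1, x.2) = F x)
    (h₂ : ∀ x : ℝ × ℝ, F (x.1, x.2 + 1) = F x) (v : ℝ × ℝ) :
    ∫ x in unitSquare, F (x + v) = ∫ x in unitSquare, F x := by
  rw [setIntegral_unitSquare (by fun_prop), setIntegral_unitSquare hF]
  have hper : ∀ (k : ℝ → E) (_ : Function.Periodic k 1) (r : ℝ),
      ∫ a in (0 : ℝ)..1, k (a + r) = ∫ a in (0 : ℝ)..1, k a := by
    intro k hk r
    rw [intervalIntegral.integral_comp_add_right, zero_add, add_comm 1 r,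
      hk.intervalIntegral_add_eq r 0, zero_add]
  rw [← hper (fun a => ∫ b in (0 : ℝ)..1, F (a, b)) (fun a => by simp [fun b => h₁ (a, b)]) v.1]
  refine intervalIntegral.integral_congr fun a _ => ?_
  exact hper (fun b => F (a + v.1, b)) (fun b => h₂ (a + v.1, b)) v.2

lemma integrable_unitSquare {E : Type*} [NormedAddCommGroup E] {F : ℝ × ℝ → E}
    (hF : Continuous F) : IntegrableOn F unitSquare :=
  (hF.continuousOn.integrableOn_compact (isCompact_Icc.prod isCompact_Icc)).mono_set
    (prod_mono Ico_subset_Icc_self Ico_subset_Icc_self)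

lemma measurableSet_unitSquare : MeasurableSet unitSquare := measurableSet_Ico.prod measurableSet_Ico

lemma norm_le_one_of_mem_unitSquare {x : ℝ × ℝ} (hx : x ∈ unitSquare) : ‖x‖ ≤ 1 := by
  obtain ⟨h1, h2⟩ := hx
  rw [Prod.norm_def, Real.norm_of_nonneg h1.1, Real.norm_of_nonneg h2.1]
  exact max_le h1.2.le h2.2.le

/-! ### Integrals of Jacobians -/

lemma norm_diffQuot_le {f : ℝ × ℝ → ℝ} (hf : ContDiff ℝ 1 f) {R C : ℝ}
    (hC : ∀ x ∈ Metric.closedBall (0 : ℝ × ℝ) R, ‖fderiv ℝ f x‖ ≤ C) {x y : ℝ × ℝ}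
    (hx : ‖x‖ ≤ R) (hy : ‖y‖ ≤ R) {h : ℝ} (hh : 0 < h) (hxy : ‖y - x‖ ≤ h) :
    ‖(f y - f x) / h‖ ≤ C := by
  have h1 := (convex_closedBall (0 : ℝ × ℝ) R).norm_image_sub_le_of_norm_fderiv_le (𝕜 := ℝ)
    (fun z _ => hf.differentiable one_ne_zero z) hC (mem_closedBall_zero_iff.mpr hx)
    (mem_closedBall_zero_iff.mpr hy)
  have hC0 : 0 ≤ C := (norm_nonneg _).trans (hC x (mem_closedBall_zero_iff.mpr hx))
  rw [norm_div, Real.norm_of_nonneg hh.le, div_le_iff₀ hh]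
  exact h1.trans (by gcongr)

lemma tendsto_diffQuot {f : ℝ × ℝ → ℝ} (hf : ContDiff ℝ 1 f) (x v : ℝ × ℝ) {u : ℕ → ℝ}
    (hu : Filter.Tendsto u Filter.atTop (nhds 0)) (hu0 : ∀ n, u n ≠ 0) :
    Filter.Tendsto (fun n => (f (x + u n • v) - f x) / u n) Filter.atTop
      (nhds (fderiv ℝ f x v)) := by
  have h := ((hf.differentiable one_ne_zero x).hasFDerivAt.hasLineDerivAt v).tendsto_slope_zero
  have h2 : Filter.Tendsto u Filter.atTop (nhdsWithin 0 {0}ᶜ) :=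
    tendsto_nhdsWithin_iff.mpr ⟨hu, Filter.Eventually.of_forall hu0⟩
  refine (h.comp h2).congr fun n => ?_
  simp [div_eq_inv_mul]

lemma integral_jacobian_aux {μ : Measure (ℝ × ℝ)} [IsFiniteMeasureOnCompacts μ]
    {ψ g : ℝ × ℝ → ℝ} (hψ : ContDiff ℝ 1 ψ) (hg : ContDiff ℝ 1 g) {R : ℝ}
    (hsupp : ∀ᵐ x ∂μ, R < ‖x‖ → ∀ v : ℝ × ℝ, ‖v‖ ≤ 1 → g (x + v) = 0)
    (hint : ∀ a b : ℝ × ℝ, Integrable (fun x => ψ (x + a) * g (x + b)) μ)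
    (htr : ∀ a b : ℝ × ℝ, ∫ x, ψ (x + a) * g (x + b) ∂μ = ∫ x, ψ x * g (x + (b - a)) ∂μ) :
    ∫ x, fderiv ℝ ψ x (1, 0) * fderiv ℝ g x (0, 1) ∂μ
      = ∫ x, fderiv ℝ ψ x (0, 1) * fderiv ℝ g x (1, 0) ∂μ := by
  obtain ⟨C₁, hC₁⟩ := (isCompact_closedBall (0 : ℝ × ℝ) (R + 1)).exists_bound_of_continuousOn
    (hψ.continuous_fderiv one_ne_zero).norm.continuousOn
  obtain ⟨C₂, hC₂⟩ := (isCompact_closedBall (0 : ℝ × ℝ) (R + 1)).exists_bound_of_continuousOn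
    (hg.continuous_fderiv one_ne_zero).norm.continuousOn
  simp only [norm_norm] at hC₁ hC₂
  let u : ℕ → ℝ := fun n => 1 / ((n : ℝ) + 1)
  have hu : Filter.Tendsto u Filter.atTop (nhds 0) := tendsto_one_div_add_atTop_nhds_zero_nat
  have hu0 : ∀ n, 0 < u n := fun n => by positivity
  have hu1 : ∀ n, u n ≤ 1 := fun n => by
    simp only [u]; rw [div_le_one (by positivity)]; linarith [n.cast_nonneg (α := ℝ)]
  have key : ∀ (e e' : ℝ × ℝ) (σ : ℝ), ‖e‖ ≤ 1 → ‖e'‖ ≤ 1 → |σ| = 1 →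
      Filter.Tendsto (fun n => ∫ x, (ψ (x + (σ * u n) • e) - ψ x) / (σ * u n) *
        ((g (x + (σ * u n) • e') - g x) / (σ * u n)) ∂μ) Filter.atTop
      (nhds (∫ x, fderiv ℝ ψ x e * fderiv ℝ g x e' ∂μ)) := by
    intro e e' σ he he' hσ
    have hσ0 : σ ≠ 0 := by rintro rfl; simp at hσ
    refine tendsto_integral_of_dominated_convergence
      ((Metric.closedBall (0 : ℝ × ℝ) R).indicator fun _ => C₁ * C₂) ?_ ?_ ?_ ?_
    · intro n
      have h1 := hψ.continuous
      have h2 := hg.continuous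
      have : Continuous fun x => (ψ (x + (σ * u n) • e) - ψ x) / (σ * u n) *
        ((g (x + (σ * u n) • e') - g x) / (σ * u n)) := by fun_prop
      exact this.aestronglyMeasurable
    · rw [integrable_indicator_iff measurableSet_closedBall]
      exact integrableOn_const (isCompact_closedBall _ _).measure_lt_top.ne
    · intro n
      have hn : ∀ w : ℝ × ℝ, ‖w‖ ≤ 1 → ‖(σ * u n) • w‖ ≤ u n := by
        intro w hw
        rw [norm_smul, Real.norm_eq_abs, abs_mul, hσ, one_mul, abs_of_pos (hu0 n)]
        exact mul_le_of_le_one_right (hu0 n).le hw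
      filter_upwards [hsupp] with x hx
      by_cases hxR : ‖x‖ ≤ R
      · rw [indicator_of_mem (mem_closedBall_zero_iff.mpr hxR), norm_mul]
        have hb : ∀ (f : ℝ × ℝ → ℝ) (C : ℝ) (w : ℝ × ℝ), ContDiff ℝ 1 f → ‖w‖ ≤ 1 →
            (∀ x ∈ Metric.closedBall (0 : ℝ × ℝ) (R + 1), ‖fderiv ℝ f x‖ ≤ C) →
            ‖(f (x + (σ * u n) • w) - f x) / (σ * u n)‖ ≤ C := by
          intro f C w hf hw hC
          have h1 := norm_diffQuot_le hf hC (x := x) (y := x + (σ * u n) • w) (by linarith)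
            ((norm_add_le _ _).trans (add_le_add hxR ((hn w hw).trans (hu1 n)))) (hu0 n)
            (by simpa using hn w hw)
          rwa [norm_div, norm_mul, Real.norm_eq_abs σ, hσ, one_mul, ← norm_div]
        have hC0 : 0 ≤ C₁ := (norm_nonneg _).trans (hb ψ C₁ e hψ he hC₁)
        exact mul_le_mul (hb ψ C₁ e hψ he hC₁) (hb g C₂ e' hg he' hC₂) (norm_nonneg _) hC0
      · have h1 := hx (not_le.mp hxR) ((σ * u n) • e') ((hn e' he').trans (hu1 n))
        have h2 := hx (not_le.mp hxR) 0 (by simp)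
        rw [add_zero] at h2
        rw [h1, h2, indicator_of_notMem (by simpa using hxR)]
        simp
    · refine Filter.Eventually.of_forall fun x => ?_
      have hv : Filter.Tendsto (fun n => σ * u n) Filter.atTop (nhds 0) := by
        simpa using hu.const_mul σ
      exact (tendsto_diffQuot hψ x e hv fun n => mul_ne_zero hσ0 (hu0 n).ne').mul
        (tendsto_diffQuot hg x e' hv fun n => mul_ne_zero hσ0 (hu0 n).ne')
  have hA := key (1, 0) (0, 1) 1 (by simp [Prod.norm_def]) (by simp [Prod.norm_def]) (by simp)
  have hB := key (0, 1) (1, 0) (-1) (by simp [Prod.norm_def]) (by simp [Prod.norm_def]) (by simp)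
  refine tendsto_nhds_unique hA (hB.congr fun n => ?_)
  have expand : ∀ (a b : ℝ × ℝ) (r : ℝ), ∫ x, (ψ (x + a) - ψ x) / r * ((g (x + b) - g x) / r) ∂μ
      = ((∫ x, ψ x * g (x + (b - a)) ∂μ) - (∫ x, ψ x * g (x + -a) ∂μ) -
        (∫ x, ψ x * g (x + b) ∂μ) + ∫ x, ψ x * g x ∂μ) / (r * r) := by
    intro a b r
    have i1 := hint a b
    have i2 := hint a 0
    have i3 := hint 0 b
    have i4 := hint 0 0
    have t1 := htr a b
    have t2 := htr a 0
    simp only [add_zero, zero_sub] at i2 i3 i4 t2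
    have i12 : Integrable (fun x => ψ (x + a) * g (x + b) - ψ (x + a) * g x) μ := i1.sub i2
    have i123 : Integrable (fun x => ψ (x + a) * g (x + b) - ψ (x + a) * g x -
      ψ x * g (x + b)) μ := i12.sub i3
    rw [← t1, ← t2, ← integral_sub i1 i2, ← integral_sub i12 i3, ← integral_add i123 i4,
      ← integral_div]
    refine integral_congr_ae (Filter.Eventually.of_forall fun x => ?_)
    simp only
    rw [div_mul_div_comm]
    congr 1
    ring
  rw [expand, expand]
  simp only [one_mul, neg_smul, neg_neg, mul_neg, neg_mul]
  rw [sub_neg_eq_add, neg_add_eq_sub]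
  ring

/-- The Jacobian of two `C¹` functions has vanishing integral. -/
theorem integral_jacobian (Ω : Domain) {ψ g : ℝ × ℝ → ℝ} (hψ : ContDiff ℝ 1 ψ)
    (hg : ContDiff ℝ 1 g) (hψΩ : Ω.IsFunction ψ) (hgΩ : Ω.IsFunction g)
    (hc : Ω = .plane → HasCompactSupport g) :
    ∫ x, fderiv ℝ ψ x (1, 0) * fderiv ℝ g x (0, 1) ∂Ω.measure
      = ∫ x, fderiv ℝ ψ x (0, 1) * fderiv ℝ g x (1, 0) ∂Ω.measure := by
  have h1 := hψ.continuous
  have h2 := hg.continuous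
  cases Ω with
  | plane =>
    have hgs := hc rfl
    obtain ⟨R, hR⟩ := hgs.isCompact.isBounded.subset_closedBall (0 : ℝ × ℝ)
    have : IsFiniteMeasureOnCompacts Domain.plane.measure :=
      inferInstanceAs (IsFiniteMeasureOnCompacts (volume : Measure (ℝ × ℝ)))
    refine integral_jacobian_aux hψ hg (R := R + 1) ?_ ?_ ?_
    · refine Filter.Eventually.of_forall fun x hx v hv => ?_
      by_contra hne
      have := hR (subset_tsupport g (Function.mem_support.mpr hne))
      rw [mem_closedBall_zero_iff] at this
      have h3 : ‖x‖ ≤ ‖x + v‖ + ‖v‖ := by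
        simpa using norm_sub_le (x + v) v
      linarith
    · intro a b
      refine Continuous.integrable_of_hasCompactSupport (by fun_prop) ?_
      exact (hgs.comp_homeomorph (Homeomorph.addRight b)).mul_left
    · intro a b
      have := integral_add_right_eq_self (μ := (volume : Measure (ℝ × ℝ)))
        (fun x => ψ x * g (x + (b - a))) a
      refine Eq.trans ?_ this
      refine integral_congr_ae (Filter.Eventually.of_forall fun x => ?_)
      simp only
      rw [show x + a + (b - a) = x + b by abel]
  | torus =>
    have : IsFiniteMeasureOnCompacts Domain.torus.measure :=
      inferInstanceAs (IsFiniteMeasureOnCompacts (volume.restrict unitSquare))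
    refine integral_jacobian_aux hψ hg (R := 1) ?_ ?_ ?_
    · change ∀ᵐ x ∂volume.restrict unitSquare, _
      filter_upwards [ae_restrict_mem measurableSet_unitSquare] with x hx h
      exact absurd (norm_le_one_of_mem_unitSquare hx) (not_le.mpr h)
    · intro a b
      exact integrable_unitSquare (by fun_prop)
    · intro a b
      have := setIntegral_unitSquare_translate (F := fun x => ψ x * g (x + (b - a)))
        (by fun_prop) (fun x => ?_) (fun x => ?_) a
      · refine Eq.trans ?_ this
        refine integral_congr_ae (Filter.Eventually.of_forall fun x => ?_)
        simp only
        rw [show x + a + (b - a) = x + b by abel]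
      · rw [(hψΩ x).1, ← (hgΩ (x + (b - a))).1]
        congr 2; exact Prod.ext (by simp; ring) (by simp)
      · rw [(hψΩ x).2, ← (hgΩ (x + (b - a))).2]
        congr 2; exact Prod.ext (by simp) (by simp; ring)

/-! ### Continuous functions on the domain -/

lemma eq_zero_of_ae (Ω : Domain) {f : ℝ × ℝ → ℝ} (hf : Continuous f) (hΩ : Ω.IsFunction f)
    (h : ∀ᵐ x ∂Ω.measure, f x = 0) (x : ℝ × ℝ) : f x = 0 := by
  cases Ω with
  | plane =>
    have h' : f =ᵐ[volume] fun _ => 0 := h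
    exact congrFun ((hf.ae_eq_iff_eq volume continuous_const).mp h') x
  | torus =>
    have hU : IsOpen (Ioo (0 : ℝ) 1 ×ˢ Ioo (0 : ℝ) 1) := isOpen_Ioo.prod isOpen_Ioo
    have h' : f =ᵐ[volume.restrict (Ioo (0 : ℝ) 1 ×ˢ Ioo (0 : ℝ) 1)] fun _ => 0 :=
      ae_restrict_of_ae_restrict_of_subset
        (prod_mono Ioo_subset_Ico_self Ioo_subset_Ico_self) h
    have h1 := Measure.eqOn_open_of_ae_eq h' hU hf.continuousOn continuousOn_const
    have h2 : EqOn f (fun _ => 0) (closure (Ioo (0 : ℝ) 1 ×ˢ Ioo (0 : ℝ) 1)) :=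
      h1.closure hf continuous_const
    rw [closure_prod_eq, closure_Ioo zero_ne_one] at h2
    have p1 : ∀ b, Function.Periodic (fun a => f (a, b)) 1 := fun b a => (hΩ (a, b)).1
    have p2 : ∀ a, Function.Periodic (fun b => f (a, b)) 1 := fun a b => (hΩ (a, b)).2
    have e1 : f x = f (Int.fract x.1, x.2) := by
      have := (p1 x.2).sub_int_mul_eq (x := x.1) ⌊x.1⌋
      simp only [mul_one, Int.self_sub_floor] at this
      exact this.symm
    have e2 : f (Int.fract x.1, x.2) = f (Int.fract x.1, Int.fract x.2) := by
      have := (p2 (Int.fract x.1)).sub_int_mul_eq (x := x.2) ⌊x.2⌋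
      simp only [mul_one, Int.self_sub_floor] at this
      exact this.symm
    rw [e1, e2]
    exact h2 ⟨⟨Int.fract_nonneg _, (Int.fract_lt_one _).le⟩,
      ⟨Int.fract_nonneg _, (Int.fract_lt_one _).le⟩⟩

lemma IsFunction.comp {Ω : Domain} {f : ℝ × ℝ → ℝ} (hΩ : Ω.IsFunction f) (k : ℝ → ℝ) :
    Ω.IsFunction fun x => k (f x) := by
  cases Ω with
  | plane => trivial
  | torus => exact fun x => ⟨congrArg k (hΩ x).1, congrArg k (hΩ x).2⟩

lemma ae_abs_le_of_norm {Ω : Domain} {f : ℝ × ℝ → ℝ} {M : ℝ} (hM : 0 ≤ M)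
    (h : normL1Linf Ω f ≤ ENNReal.ofReal M) : ∀ᵐ x ∂Ω.measure, |f x| ≤ M := by
  have h2 : eLpNorm f ⊤ Ω.measure ≤ ENNReal.ofReal M := le_add_self.trans h
  rw [eLpNorm_exponent_top] at h2
  filter_upwards [ae_le_eLpNormEssSup (f := f) (μ := Ω.measure)] with x hx
  have := hx.trans h2
  rwa [Real.enorm_eq_ofReal_abs, ENNReal.ofReal_le_ofReal_iff hM] at this

lemma abs_le_of_ae {Ω : Domain} {f : ℝ × ℝ → ℝ} (hf : Continuous f) (hΩ : Ω.IsFunction f) {M : ℝ}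
    (h : ∀ᵐ x ∂Ω.measure, |f x| ≤ M) (x : ℝ × ℝ) : |f x| ≤ M := by
  have h1 : max (|f x| - M) 0 = 0 :=
    eq_zero_of_ae Ω (f := fun x => max (|f x| - M) 0) (by fun_prop)
      (IsFunction.comp hΩ fun r => max (|r| - M) 0)
      (by filter_upwards [h] with y hy; rw [max_eq_right]; linarith) x
  have := max_eq_right_iff.mp h1
  linarith

lemma integrable_of_norm {f : ℝ × ℝ → ℝ} (hf : Continuous f) {M : ℝ}
    (h : normL1Linf .plane f ≤ ENNReal.ofReal M) : Integrable f := by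
  have h2 : eLpNorm f 1 volume ≤ ENNReal.ofReal M := le_self_add.trans h
  exact memLp_one_iff_integrable.mp ⟨hf.aestronglyMeasurable, h2.trans_lt ENNReal.ofReal_lt_top⟩

lemma lintegral_sq_le_of_norm {f : ℝ × ℝ → ℝ} {M : ℝ} (hM : 0 ≤ M)
    (h : normL1Linf .plane f ≤ ENNReal.ofReal M) :
    ∫⁻ x, ENNReal.ofReal (f x ^ 2) ≤ ENNReal.ofReal (M ^ 2) := by
  have h2 : eLpNorm f 1 volume ≤ ENNReal.ofReal M := le_self_add.trans h
  rw [eLpNorm_one_eq_lintegral_enorm] at h2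
  have h3 : ∀ᵐ x, |f x| ≤ M := ae_abs_le_of_norm hM h
  calc ∫⁻ x, ENNReal.ofReal (f x ^ 2) ≤ ∫⁻ x, ENNReal.ofReal M * ‖f x‖ₑ := by
        refine lintegral_mono_ae ?_
        filter_upwards [h3] with x hx
        rw [Real.enorm_eq_ofReal_abs, ← ENNReal.ofReal_mul hM, ← sq_abs, sq]
        exact ENNReal.ofReal_le_ofReal (by gcongr)
    _ ≤ ENNReal.ofReal M * ENNReal.ofReal M := by
        rw [lintegral_const_mul' _ _ ENNReal.ofReal_ne_top]; gcongr
    _ = _ := by rw [← ENNReal.ofReal_mul hM, sq]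

/-! ### The time interval -/

lemma Icc_subset_timeInterval {T : EReal} {t : ℝ} (ht : t ∈ timeInterval T) :
    Icc 0 t ⊆ timeInterval T := fun _ hs =>
  ⟨hs.1, (EReal.coe_le_coe_iff.mpr hs.2).trans_lt ht.2⟩

/-- The open time interval `(0, T)`. -/
def openTime (T : EReal) : Set ℝ := {t | 0 < t ∧ (t : EReal) < T}

lemma isOpen_openTime (T : EReal) : IsOpen (openTime T) :=
  (isOpen_lt continuous_const continuous_id).inter
    (isOpen_lt continuous_coe_real_ereal continuous_const)

lemma openTime_subset (T : EReal) : openTime T ⊆ timeInterval T := fun _ h => ⟨h.1.le, h.2⟩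

lemma Ioo_subset_openTime {T : EReal} {t : ℝ} (ht : t ∈ timeInterval T) :
    Ioo 0 t ⊆ openTime T := fun _ hs =>
  ⟨hs.1, (EReal.coe_le_coe_iff.mpr hs.2.le).trans_lt ht.2⟩

section Slices

variable {T : EReal} {θ : ℝ × ℝ → ℝ → ℝ}

lemma contDiff_slice
    (h : ContDiffOn ℝ 1 (fun p : (ℝ × ℝ) × ℝ => θ p.1 p.2) (univ ×ˢ timeInterval T))
    {t : ℝ} (ht : t ∈ timeInterval T) : ContDiff ℝ 1 fun x => θ x t := by
  rw [← contDiffOn_univ]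
  exact h.comp (f := fun x : ℝ × ℝ => (x, t)) (by fun_prop) (fun x _ => ⟨mem_univ _, ht⟩)

lemma hasDerivAt_time
    (h : ContDiffOn ℝ 1 (fun p : (ℝ × ℝ) × ℝ => θ p.1 p.2) (univ ×ˢ timeInterval T))
    {t : ℝ} (ht : t ∈ openTime T) (x : ℝ × ℝ) :
    HasDerivAt (fun s => θ x s)
      (fderiv ℝ (fun p : (ℝ × ℝ) × ℝ => θ p.1 p.2) (x, t) (0, 1)) t := by
  have hU : univ ×ˢ openTime T ∈ nhds (x, t) :=
    (isOpen_univ.prod (isOpen_openTime T)).mem_nhds ⟨mem_univ _, ht⟩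
  have hd : DifferentiableAt ℝ (fun p : (ℝ × ℝ) × ℝ => θ p.1 p.2) (x, t) :=
    ((h.mono (prod_mono_right (openTime_subset T))).contDiffAt hU).differentiableAt one_ne_zero
  have h1 : HasDerivAt (fun s : ℝ => (x, s)) ((0 : ℝ × ℝ), (1 : ℝ)) t :=
    (hasDerivAt_const t x).prodMk (hasDerivAt_id t)
  exact hd.hasFDerivAt.comp_hasDerivAt (x := t) (f := fun s : ℝ => (x, s)) h1

lemma continuousOn_time_deriv
    (h : ContDiffOn ℝ 1 (fun p : (ℝ × ℝ) × ℝ => θ p.1 p.2) (univ ×ˢ timeInterval T)) :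
    ContinuousOn (fun p => fderiv ℝ (fun p : (ℝ × ℝ) × ℝ => θ p.1 p.2) p (0, 1))
      (univ ×ˢ openTime T) :=
  ((h.mono (prod_mono_right (openTime_subset T))).continuousOn_fderiv_of_isOpen
    (isOpen_univ.prod (isOpen_openTime T)) le_rfl).clm_apply continuousOn_const

variable {μ : Measure (ℝ × ℝ)} [IsFiniteMeasureOnCompacts μ] {β : ℝ → ℝ} {χ : ℝ × ℝ → ℝ}
  {K : Set (ℝ × ℝ)}

lemma hasDerivAt_integral_comp
    (h : ContDiffOn ℝ 1 (fun p : (ℝ × ℝ) × ℝ => θ p.1 p.2) (univ ×ˢ timeInterval T))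
    (hβ : ContDiff ℝ 1 β) (hχ : Continuous χ) (hK : IsCompact K)
    (hχK : ∀ᵐ x ∂μ, x ∉ K → χ x = 0) {t : ℝ} (ht : t ∈ openTime T) :
    HasDerivAt (fun s => ∫ x, χ x * β (θ x s) ∂μ)
      (∫ x, χ x * (deriv β (θ x t) * deriv (fun s => θ x s) t) ∂μ) t := by
  obtain ⟨ε, hε, hball⟩ := Metric.isOpen_iff.mp (isOpen_openTime T) t ht
  have hsub : Icc (t - ε / 2) (t + ε / 2) ⊆ openTime T := by
    refine Subset.trans (fun s hs => ?_) hball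
    rw [Metric.mem_ball, Real.dist_eq, abs_lt]
    constructor <;> linarith [hs.1, hs.2]
  have hcont := h.continuousOn
  have hβd : Continuous (deriv β) := hβ.continuous_deriv le_rfl
  have hmaps : K ×ˢ Icc (t - ε / 2) (t + ε / 2) ⊆ univ ×ˢ openTime T :=
    prod_mono (subset_univ _) hsub
  have hbdd : ContinuousOn (fun p : (ℝ × ℝ) × ℝ => χ p.1 * (deriv β (θ p.1 p.2) *
      fderiv ℝ (fun p : (ℝ × ℝ) × ℝ => θ p.1 p.2) p (0, 1)))
      (K ×ˢ Icc (t - ε / 2) (t + ε / 2)) := by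
    refine (hχ.comp continuous_fst).continuousOn.mul (ContinuousOn.mul ?_
      ((continuousOn_time_deriv h).mono hmaps))
    exact hβd.comp_continuousOn (hcont.mono (hmaps.trans (prod_mono_right (openTime_subset T))))
  obtain ⟨C, hC⟩ := (hK.prod isCompact_Icc).exists_bound_of_continuousOn hbdd
  have hslice : ∀ s ∈ openTime T, Continuous fun x => θ x s := fun s hs =>
    (contDiff_slice h (openTime_subset T hs)).continuous
  have hKm := hK.measurableSet
  refine (hasDerivAt_integral_of_dominated_loc_of_deriv_le
    (F := fun s x => χ x * β (θ x s))
    (F' := fun s x => χ x * (deriv β (θ x s) * deriv (fun s => θ x s) s))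
    (s := Icc (t - ε / 2) (t + ε / 2)) (bound := K.indicator fun _ => C)
    (Icc_mem_nhds (by linarith) (by linarith)) ?_ ?_ ?_ ?_ ?_ ?_).2
  · filter_upwards [(isOpen_openTime T).mem_nhds ht] with s hs
    exact (hχ.mul (hβ.continuous.comp (hslice s hs))).aestronglyMeasurable
  · have hc : Continuous fun x => χ x * β (θ x t) := hχ.mul (hβ.continuous.comp (hslice t ht))
    have h1 : IntegrableOn (fun x => χ x * β (θ x t)) K μ :=
      hc.continuousOn.integrableOn_compact hK
    refine ((integrable_indicator_iff hKm).mpr h1).congr ?_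
    filter_upwards [hχK] with x hx
    by_cases hxK : x ∈ K
    · rw [indicator_of_mem hxK]
    · rw [indicator_of_notMem hxK, hx hxK, zero_mul]
  · have e : (fun x => deriv (fun s => θ x s) t) =
        fun x => fderiv ℝ (fun p : (ℝ × ℝ) × ℝ => θ p.1 p.2) (x, t) (0, 1) :=
      funext fun x => (hasDerivAt_time h ht x).deriv
    have hc : Continuous fun x => deriv (fun s => θ x s) t := by
      rw [e]
      exact (continuousOn_time_deriv h).comp_continuous (by fun_prop) fun x => ⟨mem_univ _, ht⟩
    exact (hχ.mul ((hβd.comp (hslice t ht)).mul hc)).aestronglyMeasurable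
  · filter_upwards [hχK] with x hx s hs
    by_cases hxK : x ∈ K
    · rw [indicator_of_mem hxK, (hasDerivAt_time h (hsub hs) x).deriv]
      exact hC (x, s) ⟨hxK, hs⟩
    · rw [indicator_of_notMem hxK, hx hxK, zero_mul, norm_zero]
  · rw [integrable_indicator_iff hKm]
    exact integrableOn_const hK.measure_lt_top.ne
  · refine Filter.Eventually.of_forall fun x s hs => ?_
    have h1 := hasDerivAt_time h (hsub hs) x
    have h2 := (hβ.differentiable one_ne_zero (θ x s)).hasDerivAt.comp s h1
    rw [← h1.deriv] at h2
    exact h2.const_mul (χ x)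

lemma continuousOn_integral_comp
    (h : ContDiffOn ℝ 1 (fun p : (ℝ × ℝ) × ℝ => θ p.1 p.2) (univ ×ˢ timeInterval T))
    (hβ : Continuous β) (hχ : Continuous χ) (hK : IsCompact K)
    (hχK : ∀ᵐ x ∂μ, x ∉ K → χ x = 0) {t : ℝ} (ht : t ∈ timeInterval T) :
    ContinuousOn (fun s => ∫ x, χ x * β (θ x s) ∂μ) (Icc 0 t) := by
  have hcont : ContinuousOn (fun p : (ℝ × ℝ) × ℝ => χ p.1 * β (θ p.1 p.2))
      (univ ×ˢ timeInterval T) :=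
    (hχ.comp continuous_fst).continuousOn.mul (hβ.comp_continuousOn h.continuousOn)
  obtain ⟨C, hC⟩ := (hK.prod isCompact_Icc).exists_bound_of_continuousOn
    (hcont.mono (prod_mono (subset_univ K) (Icc_subset_timeInterval ht)))
  refine continuousOn_of_dominated (bound := K.indicator fun _ => C) ?_ ?_ ?_ ?_
  · intro s hs
    exact (hχ.mul (hβ.comp (contDiff_slice h
      (Icc_subset_timeInterval ht hs)).continuous)).aestronglyMeasurable
  · intro s hs
    filter_upwards [hχK] with x hx
    by_cases hxK : x ∈ K
    · rw [indicator_of_mem hxK]; exact hC (x, s) ⟨hxK, hs⟩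
    · rw [indicator_of_notMem hxK, hx hxK, zero_mul, norm_zero]
  · rw [integrable_indicator_iff hK.measurableSet]
    exact integrableOn_const hK.measure_lt_top.ne
  · refine Filter.Eventually.of_forall fun x => ?_
    exact hcont.comp (f := fun s : ℝ => (x, s)) (by fun_prop)
      fun s hs => ⟨mem_univ _, Icc_subset_timeInterval ht hs⟩

end Slices

/-! ### Conserved quantities -/

instance (Ω : Domain) : IsFiniteMeasureOnCompacts Ω.measure := by
  cases Ω with
  | plane => exact inferInstanceAs (IsFiniteMeasureOnCompacts (volume : Measure (ℝ × ℝ)))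
  | torus => exact inferInstanceAs (IsFiniteMeasureOnCompacts (volume.restrict unitSquare))

lemma IsFunction.mul {Ω : Domain} {f g : ℝ × ℝ → ℝ} (hf : Ω.IsFunction f) (hg : Ω.IsFunction g) :
    Ω.IsFunction fun x => f x * g x := by
  cases Ω with
  | plane => trivial
  | torus => exact fun x => ⟨congrArg₂ _ (hf x).1 (hg x).1, congrArg₂ _ (hf x).2 (hg x).2⟩

lemma IsSolution.isFunction_stream {Ω : Domain} {T : EReal} {θ ψ : ℝ × ℝ → ℝ → ℝ}
    (hS : IsSolution Ω T θ ψ) {t : ℝ} (ht : t ∈ timeInterval T) :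
    Ω.IsFunction fun x => ψ x t := by
  cases Ω with
  | plane => trivial
  | torus => exact (hS.stream t ht).1

lemma integrable_of_ae_compact {μ : Measure (ℝ × ℝ)} [IsFiniteMeasureOnCompacts μ]
    {f : ℝ × ℝ → ℝ} (hf : Continuous f) {K : Set (ℝ × ℝ)} (hK : IsCompact K)
    (h : ∀ᵐ x ∂μ, x ∉ K → f x = 0) : Integrable f μ := by
  have h1 : IntegrableOn f K μ := hf.continuousOn.integrableOn_compact hK
  refine ((integrable_indicator_iff hK.measurableSet).mpr h1).congr ?_
  filter_upwards [h] with x hx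
  by_cases hxK : x ∈ K
  · rw [indicator_of_mem hxK]
  · rw [indicator_of_notMem hxK, hx hxK]

/-- The local balance law for `β(θ)`. -/
lemma IsSolution.hasDerivAt_integral {Ω : Domain} {T : EReal} {θ ψ : ℝ × ℝ → ℝ → ℝ}
    (hS : IsSolution Ω T θ ψ) {β : ℝ → ℝ} (hβ : ContDiff ℝ 1 β) {χ : ℝ × ℝ → ℝ}
    (hχ : ContDiff ℝ 1 χ) (hχΩ : Ω.IsFunction χ) (hχs : Ω = .plane → HasCompactSupport χ)
    {t : ℝ} (ht : t ∈ openTime T) :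
    HasDerivAt (fun s => ∫ x, χ x * β (θ x s) ∂Ω.measure)
      ((∫ x, β (θ x t) * fderiv ℝ χ x (0, 1) * fderiv ℝ (fun y => ψ y t) x (1, 0) ∂Ω.measure) -
        ∫ x, β (θ x t) * fderiv ℝ χ x (1, 0) * fderiv ℝ (fun y => ψ y t) x (0, 1) ∂Ω.measure)
      t := by
  have htT := openTime_subset T ht
  have hθ : ContDiff ℝ 1 fun x => θ x t := contDiff_slice hS.contDiffOn htT
  have hψ : ContDiff ℝ 1 fun x => ψ x t := hS.stream_contDiff t htT
  obtain ⟨K, hK, hχK⟩ : ∃ K : Set (ℝ × ℝ), IsCompact K ∧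
      ∀ᵐ x ∂Ω.measure, x ∉ K → χ x = 0 ∧ fderiv ℝ χ x = 0 := by
    cases Ω with
    | plane =>
      refine ⟨tsupport χ, hχs rfl, Filter.Eventually.of_forall fun x hx => ⟨?_, ?_⟩⟩
      · exact image_eq_zero_of_notMem_tsupport hx
      · exact image_eq_zero_of_notMem_tsupport fun h => hx (tsupport_fderiv_subset ℝ h)
    | torus =>
      refine ⟨Metric.closedBall 0 1, isCompact_closedBall _ _, ?_⟩
      change ∀ᵐ x ∂volume.restrict unitSquare, _
      filter_upwards [ae_restrict_mem measurableSet_unitSquare] with x hx h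
      exact absurd (mem_closedBall_zero_iff.mpr (norm_le_one_of_mem_unitSquare hx)) h
  convert hasDerivAt_integral_comp (μ := Ω.measure) hS.contDiffOn hβ hχ.continuous hK
    (hχK.mono fun x hx h => (hx h).1) ht using 1
  have hg : ContDiff ℝ 1 fun x => χ x * β (θ x t) := hχ.mul (hβ.comp hθ)
  have hjac := integral_jacobian Ω hψ hg (hS.isFunction_stream htT)
    (IsFunction.mul hχΩ (IsFunction.comp (hS.isFunction t htT) β))
    (fun h => (hχs h).mul_right)
  have hdθ := fun x => hθ.differentiable one_ne_zero x
  have hdψ := fun x => hψ.differentiable one_ne_zero x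
  have hdg : ∀ x v, fderiv ℝ (fun x => χ x * β (θ x t)) x v
      = χ x * (deriv β (θ x t) * fderiv ℝ (fun y => θ y t) x v) +
        β (θ x t) * fderiv ℝ χ x v := by
    intro x v
    have h1 := (hβ.differentiable one_ne_zero (θ x t)).hasDerivAt.comp_hasFDerivAt x
      (hdθ x).hasFDerivAt
    have h2 := ((hχ.differentiable one_ne_zero x).hasFDerivAt.mul h1).fderiv
    have h3 : fderiv ℝ (fun x => χ x * β (θ x t)) x = _ := h2
    rw [h3]
    simp [smul_eq_mul]
  simp only [hdg] at hjac
  have c1 := hχ.continuous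
  have c2 := hβ.continuous.comp hθ.continuous
  have c3 : Continuous fun x => deriv β (θ x t) :=
    (hβ.continuous_deriv le_rfl).comp hθ.continuous
  have c4 : ∀ v, Continuous fun x => fderiv ℝ (fun y => θ y t) x v := fun v =>
    (hθ.continuous_fderiv one_ne_zero).clm_apply continuous_const
  have c5 : ∀ v, Continuous fun x => fderiv ℝ (fun y => ψ y t) x v := fun v =>
    (hψ.continuous_fderiv one_ne_zero).clm_apply continuous_const
  have c6 : ∀ v, Continuous fun x => fderiv ℝ χ x v := fun v =>
    (hχ.continuous_fderiv one_ne_zero).clm_apply continuous_const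
  have i1 : ∀ v w, Integrable (fun x => fderiv ℝ (fun y => ψ y t) x v *
      (χ x * (deriv β (θ x t) * fderiv ℝ (fun y => θ y t) x w))) Ω.measure := by
    intro v w
    refine integrable_of_ae_compact ((c5 v).mul (c1.mul (c3.mul (c4 w)))) hK ?_
    filter_upwards [hχK] with x hx h
    rw [(hx h).1]; ring
  have i2 : ∀ v w, Integrable (fun x => β (θ x t) * fderiv ℝ χ x w *
      fderiv ℝ (fun y => ψ y t) x v) Ω.measure := by
    intro v w
    refine integrable_of_ae_compact ((c2.mul (c6 w)).mul (c5 v)) hK ?_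
    filter_upwards [hχK] with x hx h
    rw [(hx h).2]; simp
  have e : ∀ v w, ∫ x, fderiv ℝ (fun y => ψ y t) x v *
      (χ x * (deriv β (θ x t) * fderiv ℝ (fun y => θ y t) x w) + β (θ x t) * fderiv ℝ χ x w)
        ∂Ω.measure = (∫ x, fderiv ℝ (fun y => ψ y t) x v *
      (χ x * (deriv β (θ x t) * fderiv ℝ (fun y => θ y t) x w)) ∂Ω.measure) +
      ∫ x, β (θ x t) * fderiv ℝ χ x w * fderiv ℝ (fun y => ψ y t) x v ∂Ω.measure := by
    intro v w
    rw [← integral_add (i1 v w) (i2 v w)]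
    refine integral_congr_ae (Filter.Eventually.of_forall fun x => ?_)
    simp only; ring
  rw [e, e] at hjac
  have hfin : ∫ x, χ x * (deriv β (θ x t) * deriv (fun s => θ x s) t) ∂Ω.measure
      = (∫ x, fderiv ℝ (fun y => ψ y t) x (0, 1) *
      (χ x * (deriv β (θ x t) * fderiv ℝ (fun y => θ y t) x (1, 0))) ∂Ω.measure) -
      ∫ x, fderiv ℝ (fun y => ψ y t) x (1, 0) *
      (χ x * (deriv β (θ x t) * fderiv ℝ (fun y => θ y t) x (0, 1))) ∂Ω.measure := by
    rw [← integral_sub (i1 _ _) (i1 _ _)]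
    refine integral_congr_ae (Filter.Eventually.of_forall fun x => ?_)
    have htr := hS.transport t htT ht.1 x
    rw [d₁_eq_fderiv (hdψ x), d₂_eq_fderiv (hdψ x), d₁_eq_fderiv (hdθ x),
      d₂_eq_fderiv (hdθ x)] at htr
    simp only
    linear_combination (χ x * deriv β (θ x t)) * htr
  rw [hfin]
  linarith

lemma IsSolution.continuousOn_integral {Ω : Domain} {T : EReal} {θ ψ : ℝ × ℝ → ℝ → ℝ}
    (hS : IsSolution Ω T θ ψ) {β : ℝ → ℝ} (hβ : Continuous β) {χ : ℝ × ℝ → ℝ}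
    (hχ : Continuous χ) (hχs : Ω = .plane → HasCompactSupport χ)
    {t : ℝ} (ht : t ∈ timeInterval T) :
    ContinuousOn (fun s => ∫ x, χ x * β (θ x s) ∂Ω.measure) (Icc 0 t) := by
  cases Ω with
  | plane =>
    exact continuousOn_integral_comp hS.contDiffOn hβ hχ (hχs rfl)
      (Filter.Eventually.of_forall fun x hx => image_eq_zero_of_notMem_tsupport hx) ht
  | torus =>
    refine continuousOn_integral_comp hS.contDiffOn hβ hχ (isCompact_closedBall 0 1) ?_ ht
    change ∀ᵐ x ∂volume.restrict unitSquare, _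
    filter_upwards [ae_restrict_mem measurableSet_unitSquare] with x hx h
    exact absurd (mem_closedBall_zero_iff.mpr (norm_le_one_of_mem_unitSquare hx)) h

lemma abs_sub_le_of_hasDerivAt {f f' : ℝ → ℝ} {t C : ℝ} (ht : 0 ≤ t)
    (hc : ContinuousOn f (Icc 0 t)) (hd : ∀ s ∈ Ioo 0 t, HasDerivAt f (f' s) s)
    (hC : ∀ s ∈ Ioo 0 t, |f' s| ≤ C) : |f t - f 0| ≤ C * t := by
  rcases ht.eq_or_lt with rfl | ht0
  · simp
  · obtain ⟨s, hs, h⟩ := exists_hasDerivAt_eq_slope f f' ht0 hc hd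
    rw [eq_div_iff (by linarith), sub_zero] at h
    rw [← h, abs_mul, abs_of_pos ht0]
    exact mul_le_mul_of_nonneg_right (hC s hs) ht

lemma IsSolution.integral_comp_torus {T : EReal} {θ ψ : ℝ × ℝ → ℝ → ℝ}
    (hS : IsSolution .torus T θ ψ) {β : ℝ → ℝ} (hβ : ContDiff ℝ 1 β) {t : ℝ}
    (ht : t ∈ timeInterval T) :
    ∫ x, β (θ x t) ∂Domain.torus.measure = ∫ x, β (θ x 0) ∂Domain.torus.measure := by
  have h := abs_sub_le_of_hasDerivAt ht.1
    (hS.continuousOn_integral hβ.continuous (χ := fun _ => 1) continuous_const nofun ht)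
    (fun s hs => hS.hasDerivAt_integral hβ (χ := fun _ => 1) contDiff_const
      (fun x => ⟨rfl, rfl⟩) nofun (Ioo_subset_openTime ht hs)) (C := 0)
    (fun s hs => by simp)
  simp only [one_mul, zero_mul, abs_nonpos_iff] at h
  linarith

lemma flux_le {f ψ : ℝ × ℝ → ℝ} (hf : ContDiff ℝ 1 f) (hfi : Integrable f) {M : ℝ}
    (hM : ∀ y, |f y| ≤ M) (hψ : IsInvSqrtLaplacian .plane f ψ) (hψc : ContDiff ℝ 1 ψ)
    (hE : ∫⁻ y, ENNReal.ofReal (f y ^ 2) ≤ ENNReal.ofReal (M ^ 2))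
    {β : ℝ → ℝ} (hβ : ContDiff ℝ 1 β) (hβ0 : ∀ s, 0 ≤ β s) (hβ2 : ∀ s, β s ≤ s ^ 2)
    {χ : ℝ × ℝ → ℝ} (hχ : ContDiff ℝ 2 χ) (hχs : HasCompactSupport χ) {C R : ℝ} (hR : 0 < R)
    (hC : ∀ x, ‖fderiv ℝ χ x‖ ≤ C / R) {v w : ℝ × ℝ} (hv : v.1 ^ 2 + v.2 ^ 2 ≤ 1)
    (hw : ‖w‖ ≤ 1) :
    |∫ x, β (f x) * fderiv ℝ χ x w * fderiv ℝ ψ x v| ≤ (M ^ 2 + (C * M) ^ 2 * M ^ 2) / R := by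
  have hM0 : 0 ≤ M := (abs_nonneg _).trans (hM 0)
  have hχ1 : ContDiff ℝ 1 fun x => fderiv ℝ χ x w :=
    (hχ.fderiv_right (m := 1) (by norm_num)).clm_apply contDiff_const
  have hg : ContDiff ℝ 1 fun x => R * (β (f x) * fderiv ℝ χ x w) :=
    contDiff_const.mul ((hβ.comp hf).mul hχ1)
  have hgs : HasCompactSupport fun x => R * (β (f x) * fderiv ℝ χ x w) :=
    ((hχs.fderiv_apply (𝕜 := ℝ) w).mul_left (f := fun x => β (f x))).mul_left (f := fun _ => R)
  have hF : ∫⁻ x, ENNReal.ofReal ((R * (β (f x) * fderiv ℝ χ x w)) ^ 2)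
      ≤ ENNReal.ofReal ((C * M) ^ 2 * M ^ 2) := by
    calc _ ≤ ∫⁻ x, ENNReal.ofReal ((C * M) ^ 2) * ENNReal.ofReal (f x ^ 2) := by
          refine lintegral_mono fun x => ?_
          rw [← ENNReal.ofReal_mul (sq_nonneg _)]
          refine ENNReal.ofReal_le_ofReal ?_
          rw [← mul_pow]
          have h1 : |fderiv ℝ χ x w| ≤ C / R :=
            ((fderiv ℝ χ x).le_opNorm w).trans
              ((mul_le_of_le_one_right (norm_nonneg _) hw).trans (hC x))
          have h2 : |R * (β (f x) * fderiv ℝ χ x w)| ≤ |C * M * f x| := by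
            rw [abs_mul, abs_mul, abs_of_pos hR, abs_of_nonneg (hβ0 _)]
            have hCR : 0 ≤ C / R := (abs_nonneg _).trans h1
            have hC0 : 0 ≤ C := by
              have := mul_nonneg hCR hR.le
              rwa [div_mul_cancel₀ _ hR.ne'] at this
            have h3 : β (f x) ≤ M * |f x| := (hβ2 _).trans (by
              rw [← sq_abs, sq]; exact mul_le_mul_of_nonneg_right (hM x) (abs_nonneg _))
            calc R * (β (f x) * |fderiv ℝ χ x w|) ≤ R * (M * |f x| * (C / R)) := by
                  gcongr
              _ = C * M * |f x| := by field_simp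
              _ = |C * M * f x| := by
                  rw [abs_mul, abs_of_nonneg (mul_nonneg hC0 hM0)]
          exact sq_le_sq.mpr h2
    _ ≤ _ := by
          rw [lintegral_const_mul' _ _ ENNReal.ofReal_ne_top, ENNReal.ofReal_mul (sq_nonneg _)]
          gcongr
  have key := abs_integral_mul_fderiv_riesz_le hf.continuous hfi hM hψ hψc hg hgs hv
    (sq_nonneg M) (by positivity) hE hF
  rw [le_div_iff₀ hR]
  calc |∫ x, β (f x) * fderiv ℝ χ x w * fderiv ℝ ψ x v| * R
      = |∫ x, R * (β (f x) * fderiv ℝ χ x w) * fderiv ℝ ψ x v| := by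
        rw [← abs_of_pos hR, ← abs_mul, mul_comm, ← integral_const_mul, abs_of_pos hR]
        simp only [mul_assoc]
    _ ≤ _ := key

lemma IsSolution.integral_comp_plane {T : EReal} {θ ψ : ℝ × ℝ → ℝ → ℝ}
    (hS : IsSolution .plane T θ ψ) {β : ℝ → ℝ} (hβ : ContDiff ℝ 1 β) (hβ0 : ∀ s, 0 ≤ β s)
    (hβ2 : ∀ s, β s ≤ s ^ 2) {t : ℝ} (ht : t ∈ timeInterval T) :
    ∫ x, β (θ x t) ∂Domain.plane.measure = ∫ x, β (θ x 0) ∂Domain.plane.measure := by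
  change ∫ x, β (θ x t) = ∫ x, β (θ x 0)
  obtain ⟨M', hM'⟩ := hS.locallyBounded t ht
  obtain ⟨M, hM0, hM⟩ : ∃ M : ℝ, 0 ≤ M ∧ ∀ s ∈ Icc 0 t,
      normL1Linf .plane (fun x => θ x s) ≤ ENNReal.ofReal M :=
    ⟨M', M'.2, fun s hs => by simpa using hM' s hs⟩
  have hsl : ∀ s ∈ Icc 0 t, ContDiff ℝ 1 fun x => θ x s := fun s hs =>
    contDiff_slice hS.contDiffOn (Icc_subset_timeInterval ht hs)
  have hbd : ∀ s ∈ Icc 0 t, ∀ x, |θ x s| ≤ M := fun s hs =>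
    abs_le_of_ae (Ω := .plane) (hsl s hs).continuous trivial (ae_abs_le_of_norm hM0 (hM s hs))
  let χ : ContDiffBump (0 : ℝ × ℝ) := ⟨1, 2, one_pos, one_lt_two⟩
  have hχd : ContDiff ℝ 2 χ := χ.contDiff
  obtain ⟨C, hC⟩ := (χ.hasCompactSupport.fderiv (𝕜 := ℝ)).exists_bound_of_continuous
    (hχd.continuous_fderiv two_ne_zero)
  have hbound : ∀ n : ℕ, |(∫ x, χ (((n : ℝ) + 1)⁻¹ • x) * β (θ x t)) -
      ∫ x, χ (((n : ℝ) + 1)⁻¹ • x) * β (θ x 0)|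
      ≤ 2 * (M ^ 2 + (C * M) ^ 2 * M ^ 2) * t * (1 / ((n : ℝ) + 1)) := by
    intro n
    have hn : (0 : ℝ) < (n : ℝ) + 1 := by positivity
    have hχn : ContDiff ℝ 2 fun x : ℝ × ℝ => χ (((n : ℝ) + 1)⁻¹ • x) :=
      hχd.comp (contDiff_const_smul _)
    have hχns : HasCompactSupport fun x : ℝ × ℝ => χ (((n : ℝ) + 1)⁻¹ • x) :=
      χ.hasCompactSupport.comp_homeomorph
        (Homeomorph.smulOfNeZero (((n : ℝ) + 1)⁻¹) (inv_ne_zero hn.ne'))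
    have hCn : ∀ x, ‖fderiv ℝ (fun x : ℝ × ℝ => χ (((n : ℝ) + 1)⁻¹ • x)) x‖ ≤ C / (n + 1) := by
      intro x
      rw [fderiv_comp_smul, norm_smul, Real.norm_of_nonneg (by positivity), inv_mul_eq_div]
      gcongr
      exact hC _
    have h := abs_sub_le_of_hasDerivAt ht.1
      (hS.continuousOn_integral hβ.continuous hχn.continuous (fun _ => hχns) ht)
      (fun s hs => hS.hasDerivAt_integral hβ (hχn.of_le (by norm_num)) trivial (fun _ => hχns)
        (Ioo_subset_openTime ht hs)) (C := 2 * (M ^ 2 + (C * M) ^ 2 * M ^ 2) / (n + 1)) ?_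
    · refine h.trans_eq ?_
      ring
    · intro s hs
      have hs' : s ∈ Icc 0 t := Ioo_subset_Icc_self hs
      have hsT := Icc_subset_timeInterval ht hs'
      have hfl : ∀ v w : ℝ × ℝ, v.1 ^ 2 + v.2 ^ 2 ≤ 1 → ‖w‖ ≤ 1 →
          |∫ x, β (θ x s) * fderiv ℝ (fun x : ℝ × ℝ => χ (((n : ℝ) + 1)⁻¹ • x)) x w *
            fderiv ℝ (fun y => ψ y s) x v| ≤ (M ^ 2 + (C * M) ^ 2 * M ^ 2) / (n + 1) :=
        fun v w hv hw => flux_le (hsl s hs') (integrable_of_norm (hsl s hs').continuous (hM s hs'))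
          (hbd s hs') (hS.stream s hsT) (hS.stream_contDiff s hsT)
          (lintegral_sq_le_of_norm hM0 (hM s hs')) hβ hβ0 hβ2 hχn hχns hn hCn hv hw
      refine (abs_sub _ _).trans ?_
      have := add_le_add (hfl (1, 0) (0, 1) (by norm_num) (by simp [Prod.norm_def]))
        (hfl (0, 1) (1, 0) (by norm_num) (by simp [Prod.norm_def]))
      refine this.trans_eq ?_
      ring
  have hlim : ∀ s ∈ Icc 0 t, Filter.Tendsto (fun n : ℕ =>
      ∫ x, χ (((n : ℝ) + 1)⁻¹ • x) * β (θ x s)) Filter.atTop (nhds (∫ x, β (θ x s))) := by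
    intro s hs
    have hc : Continuous fun x => β (θ x s) := hβ.continuous.comp (hsl s hs).continuous
    have hi : Integrable fun x => θ x s ^ 2 := by
      refine ⟨((hsl s hs).continuous.pow 2).aestronglyMeasurable, ?_⟩
      rw [hasFiniteIntegral_iff_ofReal (Filter.Eventually.of_forall fun x => sq_nonneg _)]
      exact (lintegral_sq_le_of_norm hM0 (hM s hs)).trans_lt ENNReal.ofReal_lt_top
    refine tendsto_integral_of_dominated_convergence (fun x => θ x s ^ 2) ?_ hi ?_ ?_
    · intro n
      have : Continuous fun x : ℝ × ℝ => χ (((n : ℝ) + 1)⁻¹ • x) :=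
        χ.continuous.comp (continuous_const_smul _)
      exact (this.mul hc).aestronglyMeasurable
    · intro n
      refine Filter.Eventually.of_forall fun x => ?_
      rw [norm_mul, Real.norm_of_nonneg χ.nonneg, Real.norm_of_nonneg (hβ0 _)]
      exact (mul_le_of_le_one_left (hβ0 _) χ.le_one).trans (hβ2 _)
    · refine Filter.Eventually.of_forall fun x => ?_
      refine tendsto_const_nhds.congr' ?_
      obtain ⟨n₀, hn₀⟩ := exists_nat_ge ‖x‖
      filter_upwards [Filter.eventually_ge_atTop n₀] with n hn
      rw [χ.one_of_mem_closedBall, one_mul]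
      rw [mem_closedBall_zero_iff, norm_smul, norm_inv, Real.norm_of_nonneg (by positivity),
        inv_mul_le_iff₀ (by positivity)]
      have : (n₀ : ℝ) ≤ n := by exact_mod_cast hn
      change ‖x‖ ≤ ((n : ℝ) + 1) * 1
      linarith
  have h1 := (hlim t ⟨ht.1, le_rfl⟩).sub (hlim 0 ⟨le_rfl, ht.1⟩)
  have h2 : Filter.Tendsto (fun n : ℕ => 2 * (M ^ 2 + (C * M) ^ 2 * M ^ 2) * t *
      (1 / ((n : ℝ) + 1))) Filter.atTop (nhds 0) := by
    simpa using (tendsto_one_div_add_atTop_nhds_zero_nat (𝕜 := ℝ)).const_mul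
      (2 * (M ^ 2 + (C * M) ^ 2 * M ^ 2) * t)
  have h3 := tendsto_nhds_unique h1 (squeeze_zero_norm hbound h2)
  linarith

/-- Integrals of functions of `θ` are conserved. -/
theorem IsSolution.integral_comp {Ω : Domain} {T : EReal} {θ ψ : ℝ × ℝ → ℝ → ℝ}
    (hS : IsSolution Ω T θ ψ) {β : ℝ → ℝ} (hβ : ContDiff ℝ 1 β) (hβ0 : ∀ s, 0 ≤ β s)
    (hβ2 : ∀ s, β s ≤ s ^ 2) {t : ℝ} (ht : t ∈ timeInterval T) :
    ∫ x, β (θ x t) ∂Ω.measure = ∫ x, β (θ x 0) ∂Ω.measure := by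
  cases Ω with
  | plane => exact hS.integral_comp_plane hβ hβ0 hβ2 ht
  | torus => exact hS.integral_comp_torus hβ ht

lemma expNegInvGlue_le {x : ℝ} (hx : 0 ≤ x) : expNegInvGlue x ≤ x := by
  rcases hx.eq_or_lt with rfl | hx
  · simp
  · rw [expNegInvGlue, if_neg (not_le.mpr hx), Real.exp_neg, inv_le_comm₀ (Real.exp_pos _) hx]
    linarith [Real.add_one_le_exp x⁻¹]

lemma timeInterval_zero_mem {T : EReal} {t : ℝ} (ht : t ∈ timeInterval T) : 0 ∈ timeInterval T :=
  Icc_subset_timeInterval ht ⟨le_rfl, ht.1⟩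

/-- The maximum principle. -/
theorem IsSolution.abs_le {Ω : Domain} {T : EReal} {θ ψ : ℝ × ℝ → ℝ → ℝ}
    (hS : IsSolution Ω T θ ψ) {N : ℝ} (hN : 0 ≤ N)
    (h0 : normL1Linf Ω (fun x => θ x 0) ≤ ENNReal.ofReal N) {t : ℝ} (ht : t ∈ timeInterval T)
    (x : ℝ × ℝ) : |θ x t| ≤ N := by
  let β : ℝ → ℝ := fun s => expNegInvGlue (s ^ 2 - N ^ 2)
  have hβ : ContDiff ℝ 1 β :=
    (expNegInvGlue.contDiff (n := 1)).comp ((contDiff_id.pow 2).sub contDiff_const)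
  have hβ0 : ∀ s, 0 ≤ β s := fun s => expNegInvGlue.nonneg _
  have hβ2 : ∀ s, β s ≤ s ^ 2 := by
    intro s
    rcases le_total (s ^ 2 - N ^ 2) 0 with h | h
    · simp only [β, expNegInvGlue.zero_of_nonpos h]; positivity
    · exact (expNegInvGlue_le h).trans (by nlinarith)
  have hc : ContDiff ℝ 1 fun x => θ x t := contDiff_slice hS.contDiffOn ht
  have hcons := hS.integral_comp hβ hβ0 hβ2 ht
  have hz : ∫ x, β (θ x 0) ∂Ω.measure = 0 := by
    rw [integral_eq_zero_of_ae]
    filter_upwards [ae_abs_le_of_norm hN h0] with y hy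
    refine expNegInvGlue.zero_of_nonpos ?_
    rw [← sq_abs]
    have := pow_le_pow_left₀ (abs_nonneg _) hy 2
    linarith
  have hcβ : Continuous fun x => β (θ x t) := hβ.continuous.comp hc.continuous
  have hint : Integrable (fun x => β (θ x t)) Ω.measure := by
    cases Ω with
    | torus => exact integrable_unitSquare hcβ
    | plane =>
      obtain ⟨M, hM⟩ := hS.locallyBounded t ht
      have hM' : normL1Linf .plane (fun x => θ x t) ≤ ENNReal.ofReal (M : ℝ) := by
        simpa using hM t ⟨ht.1, le_rfl⟩
      refine ⟨hcβ.aestronglyMeasurable, ?_⟩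
      rw [hasFiniteIntegral_iff_ofReal (Filter.Eventually.of_forall fun x => hβ0 _)]
      exact ((lintegral_mono fun x => ENNReal.ofReal_le_ofReal (hβ2 _)).trans
        (lintegral_sq_le_of_norm M.2 hM')).trans_lt ENNReal.ofReal_lt_top
  rw [hz, integral_eq_zero_iff_of_nonneg (fun x => hβ0 _) hint] at hcons
  have h1 := eq_zero_of_ae Ω hcβ (IsFunction.comp (hS.isFunction t ht) β) hcons x
  have h2 : θ x t ^ 2 - N ^ 2 ≤ 0 := expNegInvGlue.zero_iff_nonpos.mp h1
  exact abs_le_of_sq_le_sq (by linarith) hN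

/-- The `L²` norm is controlled on the plane. -/
theorem IsSolution.lintegral_sq_le {T : EReal} {θ ψ : ℝ × ℝ → ℝ → ℝ}
    (hS : IsSolution .plane T θ ψ) {N : ℝ} (hN : 0 ≤ N)
    (h0 : normL1Linf .plane (fun x => θ x 0) ≤ ENNReal.ofReal N) {t : ℝ}
    (ht : t ∈ timeInterval T) : ∫⁻ x, ENNReal.ofReal (θ x t ^ 2) ≤ ENNReal.ofReal (N ^ 2) := by
  have hcons := hS.integral_comp (β := fun s => s ^ 2) (contDiff_id.pow 2) (fun s => sq_nonneg s)
    (fun s => le_rfl) ht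
  have hint : ∀ s ∈ timeInterval T, Integrable fun x => θ x s ^ 2 := by
    intro s hs
    obtain ⟨M, hM⟩ := hS.locallyBounded s hs
    have hM' : normL1Linf .plane (fun x => θ x s) ≤ ENNReal.ofReal (M : ℝ) := by
      simpa using hM s ⟨hs.1, le_rfl⟩
    refine ⟨((contDiff_slice hS.contDiffOn hs).continuous.pow 2).aestronglyMeasurable, ?_⟩
    rw [hasFiniteIntegral_iff_ofReal (Filter.Eventually.of_forall fun x => sq_nonneg _)]
    exact (lintegral_sq_le_of_norm M.2 hM').trans_lt ENNReal.ofReal_lt_top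
  change ∫ x, θ x t ^ 2 = ∫ x, θ x 0 ^ 2 at hcons
  rw [← ofReal_integral_eq_lintegral_ofReal (hint t ht)
    (Filter.Eventually.of_forall fun x => sq_nonneg _), hcons, ofReal_integral_eq_lintegral_ofReal
    (hint 0 (timeInterval_zero_mem ht)) (Filter.Eventually.of_forall fun x => sq_nonneg _)]
  exact lintegral_sq_le_of_norm hN h0

/-! ### Fourier coefficients of periodic functions -/

/-- A pair of integers as a point of the plane. -/
def intPt (k : ℤ × ℤ) : ℝ × ℝ := ((k.1 : ℝ), (k.2 : ℝ))

lemma intPt_ne_zero {k : ℤ × ℤ} (hk : k ≠ 0) : intPt k ≠ 0 := by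
  intro h
  apply hk
  have h1 := congrArg Prod.fst h
  have h2 := congrArg Prod.snd h
  simp only [intPt, Prod.fst_zero, Prod.snd_zero, Int.cast_eq_zero] at h1 h2
  exact Prod.ext h1 h2

lemma fourierCoeff₂_eq (f : ℝ × ℝ → ℝ) (k : ℤ × ℤ) :
    fourierCoeff₂ f k = ∫ x in unitSquare, (f x : ℂ) * ch (intPt k) x := by
  simp [fourierCoeff₂, ch, intPt]

lemma ch_intPt_fst (k : ℤ × ℤ) (x : ℝ × ℝ) : ch (intPt k) (x.1 + 1, x.2) = ch (intPt k) x := by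
  have : ch (intPt k) (x.1 + 1, x.2) = ch (intPt k) x * Complex.exp ((-k.1 : ℤ) *
      (2 * Real.pi * Complex.I)) := by
    rw [ch, ch, ← Complex.exp_add]; congr 1; simp [intPt]; ring
  rw [this, Complex.exp_int_mul_two_pi_mul_I, mul_one]

lemma ch_intPt_snd (k : ℤ × ℤ) (x : ℝ × ℝ) : ch (intPt k) (x.1, x.2 + 1) = ch (intPt k) x := by
  have : ch (intPt k) (x.1, x.2 + 1) = ch (intPt k) x * Complex.exp ((-k.2 : ℤ) *
      (2 * Real.pi * Complex.I)) := by
    rw [ch, ch, ← Complex.exp_add]; congr 1; simp [intPt]; ring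
  rw [this, Complex.exp_int_mul_two_pi_mul_I, mul_one]

lemma fourierCoeff₂_translate {f : ℝ × ℝ → ℝ} (hf : Continuous f)
    (hp : Domain.torus.IsFunction f) (v : ℝ × ℝ) (k : ℤ × ℤ) :
    fourierCoeff₂ (fun x => f (x + v)) k = ch (intPt k) (-v) * fourierCoeff₂ f k := by
  have h := setIntegral_unitSquare_translate (F := fun x => (f x : ℂ) * ch (intPt k) x)
    (by fun_prop) (fun x => by rw [(hp x).1, ch_intPt_fst]) (fun x => by
      rw [(hp x).2, ch_intPt_snd]) v
  rw [fourierCoeff₂_eq, fourierCoeff₂_eq, ← h, ← integral_const_mul]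
  refine integral_congr_ae (Filter.Eventually.of_forall fun x => ?_)
  simp only
  have e : ch (intPt k) x = ch (intPt k) (-v) * ch (intPt k) (x + v) := by
    rw [← ch_add]; congr 1; abel
  rw [e]; ring

lemma fourierCoeff₂_sub {f g : ℝ × ℝ → ℝ} (hf : Continuous f) (hg : Continuous g) (k : ℤ × ℤ) :
    fourierCoeff₂ (fun x => f x - g x) k = fourierCoeff₂ f k - fourierCoeff₂ g k := by
  rw [fourierCoeff₂_eq, fourierCoeff₂_eq, fourierCoeff₂_eq, ← integral_sub
    (integrable_unitSquare (by fun_prop)) (integrable_unitSquare (by fun_prop))]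
  refine integral_congr_ae (Filter.Eventually.of_forall fun x => ?_)
  simp only; push_cast; ring

lemma volume_unitSquare : volume.real unitSquare = 1 := by
  rw [unitSquare, Measure.volume_eq_prod, measureReal_prod_prod]; simp

lemma norm_fourierCoeff₂_le {f : ℝ × ℝ → ℝ} {M : ℝ} (hM : ∀ y, |f y| ≤ M) (k : ℤ × ℤ) :
    ‖fourierCoeff₂ f k‖ ≤ M := by
  have hfin : volume unitSquare < ⊤ := by
    rw [unitSquare, Measure.volume_eq_prod, Measure.prod_prod]; simp
  rw [fourierCoeff₂_eq]
  refine (norm_setIntegral_le_of_norm_le_const hfin (C := M) fun x _ => ?_).trans_eq ?_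
  · rw [norm_mul, norm_ch, mul_one, Complex.norm_real]; exact hM x
  · rw [volume_unitSquare, mul_one]

lemma norm_le_tsum_fourier {h : ℝ → ℂ} (hc : Continuous h) (hp : Function.Periodic h 1)
    {B : ℤ → ℝ} (hB : Summable B) (hle : ∀ n : ℤ,
      ‖∫ x in (0 : ℝ)..1, h x * Complex.exp (-(2 * Real.pi * Complex.I * (n * x)))‖ ≤ B n) (x : ℝ) :
    ‖h x‖ ≤ ∑' n, B n := by
  let H : C(AddCircle (1 : ℝ), ℂ) := ⟨hp.lift, continuous_coinduced_dom.mpr hc⟩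
  have hH : ∀ y : ℝ, H (y : AddCircle (1 : ℝ)) = h y := fun y => hp.lift_coe y
  have hcoef : ∀ n : ℤ, fourierCoeff H n
      = ∫ x in (0 : ℝ)..1, h x * Complex.exp (-(2 * Real.pi * Complex.I * (n * x))) := by
    intro n
    rw [fourierCoeff_eq_intervalIntegral _ n 0]
    simp only [div_one, one_smul, zero_add]
    refine intervalIntegral.integral_congr fun y _ => ?_
    simp only [hH, fourier_coe_apply, smul_eq_mul]
    rw [mul_comm]
    congr 2
    push_cast
    ring
  have hs : Summable (fourierCoeff H) := by
    refine Summable.of_norm_bounded hB fun n => ?_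
    rw [hcoef]; exact hle n
  have h1 := has_pointwise_sum_fourier_series_of_summable hs (x : AddCircle (1 : ℝ))
  rw [hH] at h1
  refine h1.norm_le_of_bounded hB.hasSum fun n => ?_
  rw [norm_smul, hcoef]
  have : ‖fourier n (x : AddCircle (1 : ℝ))‖ ≤ 1 :=
    ((fourier n).norm_coe_le_norm _).trans_eq (fourier_norm n)
  calc _ ≤ B n * 1 := mul_le_mul (hle n) this (norm_nonneg _) ((norm_nonneg _).trans (hle n))
    _ = _ := mul_one _

/-- A continuous periodic function is bounded by the sum of its Fourier coefficients. -/
lemma abs_le_tsum_fourierCoeff₂ {w : ℝ × ℝ → ℝ} (hw : Continuous w)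
    (hp : Domain.torus.IsFunction w) {B : ℤ × ℤ → ℝ} (hB : Summable B)
    (hle : ∀ k, ‖fourierCoeff₂ w k‖ ≤ B k) (x : ℝ × ℝ) : |w x| ≤ ∑' k, B k := by
  have hB' : Summable fun p : ℤ × ℤ => B (p.2, p.1) := hB.prod_symm
  have hsum : ∑' k, B k = ∑' m, ∑' n, B (n, m) := by
    rw [← hB'.tsum_prod]
    exact ((Equiv.prodComm ℤ ℤ).tsum_eq B).symm
  have hG : ∀ (m : ℤ) (a : ℝ), ‖∫ b in (0 : ℝ)..1, (w (a, b) : ℂ) *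
      Complex.exp (-(2 * Real.pi * Complex.I * (m * b)))‖ ≤ ∑' n, B (n, m) := by
    intro m a
    refine norm_le_tsum_fourier (h := fun a => ∫ b in (0 : ℝ)..1, (w (a, b) : ℂ) *
      Complex.exp (-(2 * Real.pi * Complex.I * (m * b)))) ?_ ?_ (hB'.prod_factor m) ?_ a
    · exact intervalIntegral.continuous_parametric_intervalIntegral_of_continuous'
        (by fun_prop) 0 1
    · intro a
      simp only [fun b => (hp (a, b)).1]
    · intro n
      refine le_trans (le_of_eq ?_) (hle (n, m))
      rw [fourierCoeff₂, setIntegral_unitSquare (by fun_prop)]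
      congr 1
      refine intervalIntegral.integral_congr fun a _ => ?_
      rw [← intervalIntegral.integral_mul_const]
      refine intervalIntegral.integral_congr fun b _ => ?_
      simp only
      rw [mul_assoc, ← Complex.exp_add]
      congr 2; ring
  have := norm_le_tsum_fourier (h := fun b => (w (x.1, b) : ℂ)) (by fun_prop)
    (fun b => by simp only [(hp (x.1, b)).2]) hB'.prod (fun m => hG m x.1) x.2
  rw [hsum]
  simpa using this

/-! ### The local part of the potential of a periodic function -/

lemma localPotential_eq (f : ℝ × ℝ → ℝ) (x : ℝ × ℝ) :
    ∫ y, f y * ker (Ioi 1) (x - y) = ∫ z, f (x - z) * ker (Ioi 1) z := by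
  rw [← integral_sub_left_eq_self (fun z => f (x - z) * ker (Ioi 1) z) volume x]
  simp

lemma ker_Ioi_one_nonneg (z : ℝ × ℝ) : 0 ≤ ker (Ioi 1) z :=
  ker_nonneg measurableSet_Ioi (Ioi_subset_Ioi zero_le_one) z

lemma continuous_localPotential {f : ℝ × ℝ → ℝ} (hf : Continuous f) {M : ℝ}
    (hM : ∀ y, |f y| ≤ M) : Continuous fun x => ∫ y, f y * ker (Ioi 1) (x - y) := by
  simp_rw [localPotential_eq]
  refine continuous_of_dominated (bound := fun z => M * ker (Ioi 1) z) (fun x => ?_) (fun x => ?_)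
    (integrable_ker_Ioi_one.const_mul M) ?_
  · exact ((by fun_prop : Continuous fun z => f (x - z)).measurable.mul
      (measurable_ker _)).aestronglyMeasurable
  · refine Filter.Eventually.of_forall fun z => ?_
    rw [norm_mul, Real.norm_of_nonneg (ker_Ioi_one_nonneg z)]
    exact mul_le_mul_of_nonneg_right (hM _) (ker_Ioi_one_nonneg z)
  · exact Filter.Eventually.of_forall fun z => by fun_prop

lemma isFunction_localPotential {f : ℝ × ℝ → ℝ} (hp : Domain.torus.IsFunction f) :
    Domain.torus.IsFunction fun x => ∫ y, f y * ker (Ioi 1) (x - y) := by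
  simp_rw [localPotential_eq]
  intro x
  constructor
  · refine integral_congr_ae (Filter.Eventually.of_forall fun z => ?_)
    simp only
    rw [← (hp (x - z)).1]
    congr 2; exact Prod.ext (by simp; ring) (by simp)
  · refine integral_congr_ae (Filter.Eventually.of_forall fun z => ?_)
    simp only
    rw [← (hp (x - z)).2]
    congr 2; exact Prod.ext (by simp) (by simp; ring)

lemma integral_ker_ch (ξ : ℝ × ℝ) :
    ∫ z, (ker (Ioi 1) z : ℂ) * ch ξ z
      = ((∫ s in Ioi 1, wt s * (Real.pi / s * gau (Real.pi ^ 2 / s) ξ) : ℝ) : ℂ) := by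
  have hI0 : Ioi (1 : ℝ) ⊆ Ioi 0 := Ioi_subset_Ioi zero_le_one
  have hm : Measurable fun p : (ℝ × ℝ) × ℝ => wt p.2 * gau p.2 p.1 :=
    measurable_wt_gau.comp measurable_swap
  have hF0 : Integrable (fun p : (ℝ × ℝ) × ℝ => wt p.2 * gau p.2 p.1)
      (volume.prod (volume.restrict (Ioi 1))) := by
    rw [integrable_prod_iff hm.aestronglyMeasurable]
    constructor
    · filter_upwards [ae_ne_zero_prod] with z hz
      exact (integrableOn_wt_gau hz).mono_set hI0
    · refine integrable_ker_Ioi_one.congr (Filter.Eventually.of_forall fun z => ?_)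
      refine setIntegral_congr_fun measurableSet_Ioi fun s hs => ?_
      simp only
      rw [Real.norm_of_nonneg (mul_nonneg (wt_nonneg (le_of_lt (hI0 hs))) (gau_pos s z).le)]
  have hF : Integrable (fun p : (ℝ × ℝ) × ℝ => ((wt p.2 * gau p.2 p.1 : ℝ) : ℂ) * ch ξ p.1)
      (volume.prod (volume.restrict (Ioi 1))) := by
    refine hF0.ofReal.mul_bdd (c := 1) ?_ (Filter.Eventually.of_forall fun p => by simp)
    exact ((continuous_ch ξ).comp continuous_fst).aestronglyMeasurable
  calc _ = ∫ z, ∫ s in Ioi 1, ((wt s * gau s z : ℝ) : ℂ) * ch ξ z := by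
        refine integral_congr_ae (Filter.Eventually.of_forall fun z => ?_)
        simp only
        rw [ker, ← integral_complex_ofReal, ← integral_mul_const]
    _ = ∫ s in Ioi 1, ∫ z, ((wt s * gau s z : ℝ) : ℂ) * ch ξ z := integral_integral_swap hF
    _ = _ := by
        rw [← integral_complex_ofReal]
        refine setIntegral_congr_fun measurableSet_Ioi fun s hs => ?_
        rw [Complex.ofReal_mul (wt s), ← integral_gau_ch (hI0 hs), ← integral_const_mul]
        refine integral_congr_ae (Filter.Eventually.of_forall fun z => ?_)
        simp only; push_cast; ring

lemma fourierCoeff₂_localPotential {f : ℝ × ℝ → ℝ} (hf : Continuous f)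
    (hp : Domain.torus.IsFunction f) {M : ℝ} (hM : ∀ y, |f y| ≤ M) (k : ℤ × ℤ) :
    fourierCoeff₂ (fun x => ∫ y, f y * ker (Ioi 1) (x - y)) k
      = ((∫ s in Ioi 1, wt s * (Real.pi / s * gau (Real.pi ^ 2 / s) (intPt k)) : ℝ) : ℂ) *
        fourierCoeff₂ f k := by
  have hfin : volume unitSquare < ⊤ := by
    rw [unitSquare, Measure.volume_eq_prod, Measure.prod_prod]; simp
  have : IsFiniteMeasure (volume.restrict unitSquare) := ⟨by simpa using hfin⟩
  have hF : Integrable (fun p : (ℝ × ℝ) × (ℝ × ℝ) =>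
      ((f (p.1 - p.2) * ker (Ioi 1) p.2 : ℝ) : ℂ) * ch (intPt k) p.1)
      ((volume.restrict unitSquare).prod volume) := by
    have h1 : Integrable (fun p : (ℝ × ℝ) × (ℝ × ℝ) => (1 : ℝ) * ker (Ioi 1) p.2)
        ((volume.restrict unitSquare).prod volume) :=
      (integrable_const (1 : ℝ)).mul_prod integrable_ker_Ioi_one
    simp only [one_mul] at h1
    refine Integrable.mul_bdd (c := 1) ?_ ?_ (Filter.Eventually.of_forall fun p => by simp)
    · refine Integrable.ofReal ?_
      refine h1.bdd_mul (c := M) ?_ (Filter.Eventually.of_forall fun p => hM _)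
      exact (by fun_prop : Continuous fun p : (ℝ × ℝ) × (ℝ × ℝ) =>
        f (p.1 - p.2)).aestronglyMeasurable
    · exact ((continuous_ch _).comp continuous_fst).aestronglyMeasurable
  rw [fourierCoeff₂_eq, ← integral_ker_ch, ← integral_mul_const]
  calc _ = ∫ x in unitSquare, ∫ z, ((f (x - z) * ker (Ioi 1) z : ℝ) : ℂ) * ch (intPt k) x := by
        refine integral_congr_ae (Filter.Eventually.of_forall fun x => ?_)
        simp only
        rw [localPotential_eq, ← integral_complex_ofReal, ← integral_mul_const]
    _ = ∫ z, ∫ x in unitSquare, ((f (x - z) * ker (Ioi 1) z : ℝ) : ℂ) * ch (intPt k) x :=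
        integral_integral_swap hF
    _ = _ := by
        refine integral_congr_ae (Filter.Eventually.of_forall fun z => ?_)
        simp only
        have h := fourierCoeff₂_translate hf hp (-z) k
        rw [neg_neg, fourierCoeff₂_eq] at h
        rw [mul_assoc, ← h, ← integral_const_mul]
        refine integral_congr_ae (Filter.Eventually.of_forall fun x => ?_)
        simp only [← sub_eq_add_neg]
        push_cast; ring

/-! ### The smooth part of the potential of a periodic function -/

lemma summable_inv_one_add_sq : Summable fun n : ℤ => (1 + (n : ℝ) ^ 2)⁻¹ := by
  have h1 : Summable fun n : ℤ => 1 / (n : ℝ) ^ 2 :=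
    Real.summable_one_div_int_pow.mpr (by norm_num)
  have h2 : Summable fun n : ℤ => if n = 0 then (1 : ℝ) else 0 :=
    (hasSum_ite_eq 0 (1 : ℝ)).summable
  refine Summable.of_nonneg_of_le (fun n => by positivity) (fun n => ?_) (h1.add h2)
  by_cases hn : n = 0
  · simp [hn]
  · have : (0 : ℝ) < (n : ℝ) ^ 2 := by positivity
    rw [if_neg hn, add_zero, one_div]
    exact inv_anti₀ this (by linarith)

/-- The summable majorant for the Fourier coefficients of the smooth part. -/
def decay (k : ℤ × ℤ) : ℝ := (1 + (k.1 : ℝ) ^ 2)⁻¹ * (1 + (k.2 : ℝ) ^ 2)⁻¹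

lemma summable_decay : Summable decay :=
  summable_inv_one_add_sq.mul_of_nonneg summable_inv_one_add_sq (fun n => by positivity)
    (fun n => by positivity)

lemma exp_neg_le_cube {x : ℝ} (hx : 0 < x) : Real.exp (-x) ≤ 6 / x ^ 3 := by
  have h := Real.pow_div_factorial_le_exp x hx.le 3
  rw [Real.exp_neg, inv_le_comm₀ (Real.exp_pos _) (by positivity), inv_div]
  simpa [Nat.factorial] using h

lemma integral_wt_gau_dual_Ioc_le {k : ℤ × ℤ} (hk : k ≠ 0) :
    |(k.2 : ℝ)| * ∫ s in Ioc (0 : ℝ) 1, wt s * (Real.pi / s * gau (Real.pi ^ 2 / s) (intPt k))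
      ≤ 192 * decay k := by
  set q : ℝ := (k.1 : ℝ) ^ 2 + (k.2 : ℝ) ^ 2 with hq
  have hq1 : 1 ≤ q := by
    have hz : (1 : ℤ) ≤ k.1 ^ 2 + k.2 ^ 2 := by
      by_contra h
      apply hk
      have h1 : k.1 ^ 2 = 0 := by nlinarith [sq_nonneg k.1, sq_nonneg k.2]
      have h2 : k.2 ^ 2 = 0 := by nlinarith [sq_nonneg k.1, sq_nonneg k.2]
      exact Prod.ext (by simpa using h1) (by simpa using h2)
    rw [hq]; exact_mod_cast hz
  have hpi := Real.pi_gt_three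
  have hb : ∀ s ∈ Ioc (0 : ℝ) 1,
      wt s * (Real.pi / s * gau (Real.pi ^ 2 / s) (intPt k)) ≤ 6 / q ^ 3 := by
    intro s hs
    have hs0 := hs.1
    have h1 : gau (Real.pi ^ 2 / s) (intPt k) ≤ 6 / (Real.pi ^ 2 / s * q) ^ 3 := by
      have := exp_neg_le_cube (x := Real.pi ^ 2 / s * q) (by positivity)
      rwa [← neg_mul] at this
    have h2 : wt s ≤ s⁻¹ := by
      refine (wt_le hs0.le).trans ?_
      rw [← Real.rpow_neg_one]
      exact Real.rpow_le_rpow_of_exponent_ge hs0 hs.2 (by norm_num)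
    calc _ ≤ s⁻¹ * (Real.pi / s * (6 / (Real.pi ^ 2 / s * q) ^ 3)) := by
          have := (gau_pos (Real.pi ^ 2 / s) (intPt k)).le
          gcongr
      _ = s / Real.pi ^ 5 * (6 / q ^ 3) := by field_simp
      _ ≤ 1 * (6 / q ^ 3) := by
          gcongr
          rw [div_le_one (by positivity)]
          have : (1 : ℝ) ≤ Real.pi ^ 5 := one_le_pow₀ (by linarith)
          linarith [hs.2]
      _ = _ := one_mul _
  have hint : IntegrableOn (fun s => wt s * (Real.pi / s * gau (Real.pi ^ 2 / s) (intPt k)))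
      (Ioc 0 1) := (integrableOn_wt_gau_dual (intPt_ne_zero hk)).mono_set Ioc_subset_Ioi_self
  have hm : ∫ s in Ioc (0 : ℝ) 1, wt s * (Real.pi / s * gau (Real.pi ^ 2 / s) (intPt k))
      ≤ 6 / q ^ 3 := by
    refine (setIntegral_mono_on hint (integrableOn_const (by simp)) measurableSet_Ioc hb).trans_eq
      ?_
    simp
  have hk2 : |(k.2 : ℝ)| ≤ q := by
    have h1 : |(k.2 : ℝ)| ≤ (k.2 : ℝ) ^ 2 := by
      have : |k.2| ≤ k.2 ^ 2 := by
        rcases eq_or_ne k.2 0 with h | h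
        · simp [h]
        · nlinarith [Int.one_le_abs h, sq_abs k.2]
      exact_mod_cast this
    nlinarith [sq_nonneg (k.1 : ℝ)]
  calc |(k.2 : ℝ)| * _ ≤ q * (6 / q ^ 3) :=
        mul_le_mul hk2 hm (setIntegral_nonneg measurableSet_Ioc fun s hs =>
          mul_nonneg (wt_nonneg hs.1.le) (mul_nonneg (div_nonneg (by positivity) hs.1.le)
            (gau_pos _ _).le)) (by positivity)
    _ = 6 / q ^ 2 := by field_simp
    _ ≤ 192 * decay k := by
        rw [decay, ← mul_inv, ← div_eq_mul_inv, div_le_div_iff₀ (by positivity) (by positivity)]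
        nlinarith [sq_nonneg ((k.1 : ℝ) ^ 2 - (k.2 : ℝ) ^ 2), sq_nonneg (k.1 : ℝ),
          sq_nonneg (k.2 : ℝ), mul_nonneg (sq_nonneg (k.1 : ℝ)) (sq_nonneg (k.2 : ℝ))]

lemma norm_ch_sub_one_le (k : ℤ × ℤ) (h : ℝ) :
    ‖ch (intPt k) (-(0, h)) - 1‖ ≤ 2 * Real.pi * |(k.2 : ℝ)| * |h| := by
  have e : ch (intPt k) (-(0, h)) = Complex.exp (Complex.I * ((2 * Real.pi * (k.2 * h) : ℝ) : ℂ)) := by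
    rw [ch]; congr 1; simp [intPt]; ring
  rw [e]
  refine (Real.norm_exp_I_mul_ofReal_sub_one_le).trans_eq ?_
  rw [Real.norm_eq_abs, abs_mul, abs_mul, abs_mul, abs_two, abs_of_pos Real.pi_pos]
  ring

/-- The stream function of a bounded periodic function is log-Lipschitz. -/
theorem abs_stream_sub_le_torus {f ψ : ℝ × ℝ → ℝ} (hf : Continuous f)
    (hp : Domain.torus.IsFunction f) {M : ℝ} (hM : ∀ y, |f y| ≤ M) (hψc : Continuous ψ)
    (hψ : IsInvSqrtLaplacian .torus f ψ) (x : ℝ × ℝ) {h H : ℝ} (hH : 0 < H) (hH1 : H ≤ 1)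
    (hh : |h| ≤ H) :
    |ψ (x + (0, h)) - ψ x|
      ≤ (36 * Real.pi * M + ∑' k, 2 * Real.pi * M * (192 * decay k)) *
        (H * (1 + Real.log (1 / H))) := by
  have hM0 : 0 ≤ M := (abs_nonneg _).trans (hM 0)
  obtain ⟨hψp, hψk⟩ := hψ
  let a : ℝ × ℝ → ℝ := fun x => ∫ y, f y * ker (Ioi 1) (x - y)
  have ha : Continuous a := continuous_localPotential hf hM
  have hap : Domain.torus.IsFunction a := isFunction_localPotential hp
  let D : ℝ × ℝ → ℝ := fun x => ψ x - a x
  have hD : Continuous D := hψc.sub ha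
  have hDp : Domain.torus.IsFunction D := fun x => by
    simp only [D]
    exact ⟨congrArg₂ _ (hψp x).1 (hap x).1, congrArg₂ _ (hψp x).2 (hap x).2⟩
  have hDk : ∀ k ≠ 0, fourierCoeff₂ D k = ((∫ s in Ioc (0 : ℝ) 1, wt s *
      (Real.pi / s * gau (Real.pi ^ 2 / s) (intPt k)) : ℝ) : ℂ) * fourierCoeff₂ f k := by
    intro k hk
    have hi := integrableOn_wt_gau_dual (intPt_ne_zero hk)
    have hsum := integral_wt_gau_dual (intPt_ne_zero hk)
    rw [← Ioc_union_Ioi_eq_Ioi (zero_le_one' ℝ), setIntegral_union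
      (Ioc_disjoint_Ioi le_rfl) measurableSet_Ioi (hi.mono_set Ioc_subset_Ioi_self)
      (hi.mono_set (Ioi_subset_Ioi zero_le_one))] at hsum
    have h1 : fourierCoeff₂ ψ k = ((1 / (2 * Real.pi * euclid (intPt k)) : ℝ) : ℂ) *
        fourierCoeff₂ f k := by
      rw [hψk, if_neg hk, intPt]; push_cast; ring
    rw [fourierCoeff₂_sub hψc ha, h1, fourierCoeff₂_localPotential hf hp hM, ← hsum]
    push_cast; ring
  have hwc : Continuous fun x => D (x + (0, h)) - D x := by fun_prop
  have hwp : Domain.torus.IsFunction fun x => D (x + (0, h)) - D x := by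
    intro x
    constructor
    · simp only
      rw [(hDp x).1, ← (hDp (x + (0, h))).1]
      congr 2; exact Prod.ext (by simp) (by simp)
    · simp only
      rw [(hDp x).2, ← (hDp (x + (0, h))).2]
      congr 2; exact Prod.ext (by simp) (by simp; ring)
  have hwk : ∀ k, ‖fourierCoeff₂ (fun x => D (x + (0, h)) - D x) k‖
      ≤ |h| * (2 * Real.pi * M * (192 * decay k)) := by
    intro k
    have hd0 : 0 ≤ decay k := by unfold decay; positivity
    rw [fourierCoeff₂_sub (by fun_prop) hD, fourierCoeff₂_translate hD hDp, ← sub_one_mul, norm_mul]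
    by_cases hk : k = 0
    · have : ‖ch (intPt k) (-(0, h)) - 1‖ = 0 := by
        refine le_antisymm ((norm_ch_sub_one_le k h).trans ?_) (norm_nonneg _)
        simp [hk]
      rw [this, zero_mul]; positivity
    · rw [hDk k hk, norm_mul, Complex.norm_real, Real.norm_of_nonneg
        (setIntegral_nonneg measurableSet_Ioc fun s hs =>
          mul_nonneg (wt_nonneg hs.1.le) (mul_nonneg (div_nonneg Real.pi_pos.le hs.1.le)
            (gau_pos _ _).le))]
      have h1 := norm_ch_sub_one_le k h
      have h2 := integral_wt_gau_dual_Ioc_le hk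
      have h3 := norm_fourierCoeff₂_le hM k
      have h4 : 0 ≤ ∫ s in Ioc (0 : ℝ) 1, wt s *
          (Real.pi / s * gau (Real.pi ^ 2 / s) (intPt k)) :=
        setIntegral_nonneg measurableSet_Ioc fun s hs =>
          mul_nonneg (wt_nonneg hs.1.le) (mul_nonneg (div_nonneg Real.pi_pos.le hs.1.le)
            (gau_pos _ _).le)
      set m := ∫ s in Ioc (0 : ℝ) 1, wt s * (Real.pi / s * gau (Real.pi ^ 2 / s) (intPt k))
      calc _ ≤ 2 * Real.pi * |(k.2 : ℝ)| * |h| * (m * M) := by gcongr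
        _ = 2 * Real.pi * |h| * M * (|(k.2 : ℝ)| * m) := by ring
        _ ≤ 2 * Real.pi * |h| * M * (192 * decay k) := by gcongr
        _ = _ := by ring
  have hsumm : Summable fun k => 2 * Real.pi * M * (192 * decay k) :=
    (summable_decay.mul_left 192).mul_left _
  have h1 := abs_le_tsum_fourierCoeff₂ hwc hwp (hsumm.mul_left |h|) hwk x
  rw [tsum_mul_left] at h1
  have h2 := abs_localPotential_sub_le hf hM x hH hH1 hh
  have hlog : 0 ≤ Real.log (1 / H) := Real.log_nonneg (by rw [le_div_iff₀ hH]; linarith)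
  have h3 : |h| ≤ H * (1 + Real.log (1 / H)) := by nlinarith
  have h4 : 0 ≤ ∑' k, 2 * Real.pi * M * (192 * decay k) :=
    tsum_nonneg fun k => by unfold decay; positivity
  have e : ψ (x + (0, h)) - ψ x = (D (x + (0, h)) - D x) + (a (x + (0, h)) - a x) := by
    simp only [D]; ring
  rw [e]
  refine (abs_add_le _ _).trans ?_
  have h5 := mul_le_mul_of_nonneg_right h3 h4
  change |a (x + (0, h)) - a x| ≤ _ at h2
  linarith

/-! ### The modulus of continuity of the stream function -/

/-- The log-Lipschitz constant of the stream function, in terms of the norm of the datum. -/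
def streamConst (N : ℝ) : ℝ :=
  36 * Real.pi * N + (∑' k, 2 * Real.pi * N * (192 * decay k)) + 4 * (N ^ 2 + 2 * Real.pi)

lemma tsum_decay_nonneg {N : ℝ} (hN : 0 ≤ N) : 0 ≤ ∑' k, 2 * Real.pi * N * (192 * decay k) :=
  tsum_nonneg fun k => by unfold decay; positivity

lemma streamConst_nonneg {N : ℝ} (hN : 0 ≤ N) : 0 ≤ streamConst N := by
  have := tsum_decay_nonneg hN
  unfold streamConst; positivity

/-- The log-Lipschitz modulus `H (1 + log⁺ (1 / H))`. -/
def logMod (H : ℝ) : ℝ := H * (1 + max (Real.log (1 / H)) 0)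

section Stream

variable {Ω : Domain} {T : EReal} {θ ψ : ℝ × ℝ → ℝ → ℝ}

lemma IsSolution.abs_stream_sub_le_of_le_one (hS : IsSolution Ω T θ ψ) {N : ℝ} (hN : 0 ≤ N)
    (h0 : normL1Linf Ω (fun x => θ x 0) ≤ ENNReal.ofReal N) {t : ℝ} (ht : t ∈ timeInterval T)
    (x : ℝ × ℝ) {h H : ℝ} (hH : 0 < H) (hH1 : H ≤ 1) (hh : |h| ≤ H) :
    |ψ (x + (0, h)) t - ψ x t| ≤ streamConst N * logMod H := by
  have hlog : 0 ≤ Real.log (1 / H) := Real.log_nonneg (by rw [le_div_iff₀ hH]; linarith)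
  have hg : 0 ≤ H * (1 + Real.log (1 / H)) := by positivity
  have hc : Continuous fun x => θ x t := (contDiff_slice hS.contDiffOn ht).continuous
  have hM : ∀ y, |θ y t| ≤ N := hS.abs_le hN h0 ht
  have hd := tsum_decay_nonneg hN
  rw [logMod, max_eq_left hlog]
  cases Ω with
  | plane =>
    obtain ⟨M, hM'⟩ := hS.locallyBounded t ht
    have hi : Integrable fun x => θ x t :=
      integrable_of_norm (M := M) hc (by simpa using hM' t ⟨ht.1, le_rfl⟩)
    have h1 := abs_potential_sub_le hc hi hM (sq_nonneg N) (hS.lintegral_sq_le hN h0 ht) x hH hH1 hh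
    rw [← riesz_eq_ker (hS.stream t ht) (x + (0, h)), ← riesz_eq_ker (hS.stream t ht) x] at h1
    refine h1.trans (mul_le_mul_of_nonneg_right ?_ hg)
    unfold streamConst; linarith
  | torus =>
    have h1 := abs_stream_sub_le_torus hc (hS.isFunction t ht) hM
      (hS.stream_contDiff t ht).continuous (hS.stream t ht) x hH hH1 hh
    refine h1.trans (mul_le_mul_of_nonneg_right ?_ hg)
    have : 0 ≤ 4 * (N ^ 2 + 2 * Real.pi) := by positivity
    unfold streamConst; linarith

lemma abs_sub_le_nat_mul {p : ℝ × ℝ → ℝ} {C h : ℝ}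
    (hp : ∀ x : ℝ × ℝ, |p (x + (0, h)) - p x| ≤ C) (n : ℕ) (x : ℝ × ℝ) :
    |p (x + (0, n * h)) - p x| ≤ n * C := by
  induction n with
  | zero => simp [show ((0 : ℝ), (0 : ℝ)) = (0 : ℝ × ℝ) from rfl]
  | succ n ih =>
    have e : x + (0, ((n + 1 : ℕ) : ℝ) * h) = x + (0, n * h) + (0, h) :=
      Prod.ext (by simp) (by simp; ring)
    rw [e]
    have h1 := abs_sub_le (p (x + (0, n * h) + (0, h))) (p (x + (0, n * h))) (p x)
    have h2 := hp (x + (0, n * h))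
    push_cast
    linarith

lemma IsSolution.abs_stream_sub_le (hS : IsSolution Ω T θ ψ) {N : ℝ} (hN : 0 ≤ N)
    (h0 : normL1Linf Ω (fun x => θ x 0) ≤ ENNReal.ofReal N) {t : ℝ} (ht : t ∈ timeInterval T)
    {r p q H : ℝ} (hH : 0 < H) (hh : |q - p| ≤ H) :
    |ψ (r, q) t - ψ (r, p) t| ≤ 2 * streamConst N * logMod H := by
  have hK := streamConst_nonneg hN
  have hm : 0 ≤ logMod H := by unfold logMod; positivity
  rcases le_total H 1 with hH1 | hH1
  · have h1 := hS.abs_stream_sub_le_of_le_one hN h0 ht (r, p) hH hH1 hh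
    have e : ((r, p) : ℝ × ℝ) + (0, q - p) = (r, q) := Prod.ext (by simp) (by simp)
    rw [e] at h1
    have := mul_nonneg hK hm
    linarith
  · have hn : 0 < (⌈H⌉₊ : ℝ) := by
      exact_mod_cast Nat.ceil_pos.mpr hH
    have hstep : ∀ x : ℝ × ℝ, |ψ (x + (0, (q - p) / ⌈H⌉₊)) t - ψ x t| ≤ streamConst N := by
      intro x
      have h1 := hS.abs_stream_sub_le_of_le_one hN h0 ht x one_pos le_rfl
        (h := (q - p) / ⌈H⌉₊) (by
          rw [abs_div, abs_of_pos hn, div_le_one hn]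
          exact hh.trans (Nat.le_ceil H))
      simpa [logMod] using h1
    have h2 := abs_sub_le_nat_mul (p := fun x => ψ x t) hstep ⌈H⌉₊ (r, p)
    have e : ((r, p) : ℝ × ℝ) + (0, (⌈H⌉₊ : ℝ) * ((q - p) / ⌈H⌉₊)) = (r, q) := by
      rw [mul_div_cancel₀ _ hn.ne']
      exact Prod.ext (by simp) (by simp)
    rw [e] at h2
    have h3 : (⌈H⌉₊ : ℝ) ≤ 2 * H := by linarith [Nat.ceil_lt_add_one hH.le]
    have h4 : H ≤ logMod H := by
      unfold logMod
      exact le_mul_of_one_le_right hH.le (by linarith [le_max_right (Real.log (1 / H)) 0])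
    nlinarith

/-! ### Motion of the level curves -/

variable {a b g : ℝ} {φ : ℝ → ℝ → ℝ}

lemma IsLevelCurve.hasDerivAt_stream (hS : IsSolution Ω T θ ψ) (hφ : IsLevelCurve T θ a b φ g)
    {x t φt : ℝ} (hx : x ∈ Ioo a b) (ht : t ∈ openTime T)
    (hφt : HasDerivAt (fun s => φ x s) φt t) :
    HasDerivAt (fun y => ψ (y, φ y t) t) φt x := by
  have htT := openTime_subset T ht
  have hxI := Ioo_subset_Icc_self hx
  have hU : Icc a b ×ˢ timeInterval T ∈ nhds (x, t) := by
    refine Filter.mem_of_superset ((isOpen_Ioo.prod (isOpen_openTime T)).mem_nhds ⟨hx, ht⟩) ?_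
    exact prod_mono Ioo_subset_Icc_self (openTime_subset T)
  have hV : (univ : Set (ℝ × ℝ)) ×ˢ timeInterval T ∈ nhds ((x, φ x t), t) :=
    Filter.mem_of_superset ((isOpen_univ.prod (isOpen_openTime T)).mem_nhds ⟨mem_univ _, ht⟩)
      (prod_mono_right (openTime_subset T))
  have hφd : DifferentiableAt ℝ (fun p : ℝ × ℝ => φ p.1 p.2) (x, t) :=
    (hφ.contDiffOn.contDiffAt hU).differentiableAt one_ne_zero
  have hθd : DifferentiableAt ℝ (fun p : (ℝ × ℝ) × ℝ => θ p.1 p.2) ((x, φ x t), t) :=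
    (hS.contDiffOn.contDiffAt hV).differentiableAt one_ne_zero
  obtain ⟨φx, hφx⟩ : ∃ φx, HasDerivAt (fun y => φ y t) φx x := by
    have h1 : HasDerivAt (fun y : ℝ => (y, t)) ((1 : ℝ), (0 : ℝ)) x :=
      (hasDerivAt_id x).prodMk (hasDerivAt_const x t)
    exact ⟨_, hφd.hasFDerivAt.comp_hasDerivAt (x := x) (f := fun y : ℝ => (y, t)) h1⟩
  set L := fderiv ℝ (fun p : (ℝ × ℝ) × ℝ => θ p.1 p.2) ((x, φ x t), t) with hL
  have hθx : ∀ v : ℝ × ℝ, fderiv ℝ (fun y => θ y t) (x, φ x t) v = L (v, 0) := by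
    intro v
    have h1 : HasFDerivAt (fun y : ℝ × ℝ => (y, t)) (ContinuousLinearMap.inl ℝ (ℝ × ℝ) ℝ)
        (x, φ x t) := hasFDerivAt_prodMk_left _ _
    have h2 := hθd.hasFDerivAt.comp (x, φ x t) h1
    have h3 : fderiv ℝ (fun y => θ y t) (x, φ x t) = _ := h2.fderiv
    rw [h3]; simp [hL]
  have e1 : L ((1, φx), 0) = 0 := by
    have h1 : HasDerivAt (fun y : ℝ => ((y, φ y t), t)) (((1 : ℝ), φx), (0 : ℝ)) x :=
      ((hasDerivAt_id x).prodMk hφx).prodMk (hasDerivAt_const x t)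
    have h2 := hθd.hasFDerivAt.comp_hasDerivAt (x := x) (f := fun y : ℝ => ((y, φ y t), t)) h1
    have h3 : HasDerivAt ((fun p : (ℝ × ℝ) × ℝ => θ p.1 p.2) ∘ fun y : ℝ => ((y, φ y t), t)) 0 x := by
      refine (hasDerivAt_const x g).congr_of_eventuallyEq ?_
      filter_upwards [isOpen_Ioo.mem_nhds hx] with y hy
      exact hφ.level y (Ioo_subset_Icc_self hy) t htT
    exact h2.unique h3
  have e2 : L ((0, φt), 1) = 0 := by
    have h1 : HasDerivAt (fun s : ℝ => ((x, φ x s), s)) (((0 : ℝ), φt), (1 : ℝ)) t :=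
      ((hasDerivAt_const t x).prodMk hφt).prodMk (hasDerivAt_id t)
    have h2 := hθd.hasFDerivAt.comp_hasDerivAt (x := t) (f := fun s : ℝ => ((x, φ x s), s)) h1
    have h3 : HasDerivAt ((fun p : (ℝ × ℝ) × ℝ => θ p.1 p.2) ∘ fun s : ℝ => ((x, φ x s), s)) 0 t := by
      refine (hasDerivAt_const t g).congr_of_eventuallyEq ?_
      filter_upwards [(isOpen_openTime T).mem_nhds ht] with s hs
      exact hφ.level x hxI s (openTime_subset T hs)
    exact h2.unique h3
  have hθs := (contDiff_slice hS.contDiffOn htT).differentiable one_ne_zero (x, φ x t)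
  have hψs := (hS.stream_contDiff t htT).differentiable one_ne_zero (x, φ x t)
  have htr := hS.transport t htT ht.1 (x, φ x t)
  have hnd := hφ.nondegenerate x hxI t htT
  rw [d₁_eq_fderiv hψs, d₂_eq_fderiv hψs, d₁_eq_fderiv hθs, d₂_eq_fderiv hθs,
    (hasDerivAt_time hS.contDiffOn ht (x, φ x t)).deriv, hθx, hθx, ← hL] at htr
  rw [d₂_eq_fderiv hθs, hθx] at hnd
  have l1 : L ((1, φx), 0) = L ((1, 0), 0) + φx * L ((0, 1), 0) := by
    rw [← smul_eq_mul, ← map_smul, ← map_add]; simp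
  have l2 : L ((0, φt), 1) = L (0, 1) + φt * L ((0, 1), 0) := by
    rw [← smul_eq_mul, ← map_smul, ← map_add]; simp
  rw [l1] at e1
  rw [l2] at e2
  have h1 : HasDerivAt (fun y : ℝ => (y, φ y t)) ((1 : ℝ), φx) x := (hasDerivAt_id x).prodMk hφx
  have h2 := hψs.hasFDerivAt.comp_hasDerivAt (x := x) (f := fun y : ℝ => (y, φ y t)) h1
  have l3 : fderiv ℝ (fun y => ψ y t) (x, φ x t) (1, φx) =
      fderiv ℝ (fun y => ψ y t) (x, φ x t) (1, 0) +
        φx * fderiv ℝ (fun y => ψ y t) (x, φ x t) (0, 1) := by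
    rw [← smul_eq_mul, ← map_smul, ← map_add]; simp
  rw [l3] at h2
  have e3 : φt = fderiv ℝ (fun y => ψ y t) (x, φ x t) (1, 0) +
      φx * fderiv ℝ (fun y => ψ y t) (x, φ x t) (0, 1) := by
    refine mul_right_cancel₀ hnd ?_
    linear_combination e2 - htr - fderiv ℝ (fun y => ψ y t) (x, φ x t) (0, 1) * e1
  rw [e3]
  exact h2

lemma IsLevelCurve.hasDerivAt_integral (hS : IsSolution Ω T θ ψ) (hφ : IsLevelCurve T θ a b φ g)
    (hab : a < b) {t : ℝ} (ht : t ∈ openTime T) :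
    HasDerivAt (fun s => ∫ x in a..b, φ x s) (ψ (b, φ b t) t - ψ (a, φ a t) t) t := by
  obtain ⟨ε, hε, hball⟩ := Metric.isOpen_iff.mp (isOpen_openTime T) t ht
  have hsub : Icc (t - ε / 2) (t + ε / 2) ⊆ openTime T := by
    refine Subset.trans (fun s hs => ?_) hball
    rw [Metric.mem_ball, Real.dist_eq, abs_lt]
    constructor <;> linarith [hs.1, hs.2]
  set J := Icc (t - ε / 2) (t + ε / 2) with hJ
  have hφJ : ContDiffOn ℝ 1 (fun p : ℝ × ℝ => φ p.1 p.2) (Icc a b ×ˢ J) :=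
    hφ.contDiffOn.mono (prod_mono_right (hsub.trans (openTime_subset T)))
  have hD : ContinuousOn (fun p => fderivWithin ℝ (fun p : ℝ × ℝ => φ p.1 p.2) (Icc a b ×ˢ J) p
      (0, 1)) (Icc a b ×ˢ J) :=
    (hφJ.continuousOn_fderivWithin ((uniqueDiffOn_Icc hab).prod
      (uniqueDiffOn_Icc (by linarith))) le_rfl).clm_apply continuousOn_const
  obtain ⟨C, hC⟩ := (isCompact_Icc.prod isCompact_Icc).exists_bound_of_continuousOn hD
  have hder : ∀ x ∈ Icc a b, ∀ s ∈ Ioo (t - ε / 2) (t + ε / 2), HasDerivAt (fun s => φ x s)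
      (fderivWithin ℝ (fun p : ℝ × ℝ => φ p.1 p.2) (Icc a b ×ˢ J) (x, s) (0, 1)) s := by
    intro x hx s hs
    have h1 : HasDerivWithinAt (fun s : ℝ => (x, s)) ((0 : ℝ), (1 : ℝ)) J s :=
      ((hasDerivAt_const s x).prodMk (hasDerivAt_id s)).hasDerivWithinAt
    have h2 := ((hφJ.differentiableOn one_ne_zero (x, s)
      ⟨hx, Ioo_subset_Icc_self hs⟩).hasFDerivWithinAt).comp_hasDerivWithinAt (x := s)
      (f := fun s : ℝ => (x, s)) h1 (fun s hs => ⟨hx, hs⟩)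
    exact h2.hasDerivAt (Icc_mem_nhds hs.1 hs.2)
  have htJ : t ∈ Ioo (t - ε / 2) (t + ε / 2) := ⟨by linarith, by linarith⟩
  have hslice : ∀ s ∈ J, ContinuousOn (fun x => φ x s) (Icc a b) := fun s hs =>
    hφJ.continuousOn.comp (f := fun x : ℝ => (x, s)) (by fun_prop) fun x hx => ⟨hx, hs⟩
  have hDt : ContinuousOn (fun x => fderivWithin ℝ (fun p : ℝ × ℝ => φ p.1 p.2) (Icc a b ×ˢ J)
      (x, t) (0, 1)) (Icc a b) :=
    hD.comp (f := fun x : ℝ => (x, t)) (by fun_prop) fun x hx => ⟨hx, Ioo_subset_Icc_self htJ⟩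
  have hu : Set.uIoc a b ⊆ Icc a b := by rw [uIoc_of_le hab.le]; exact Ioc_subset_Icc_self
  have key := (intervalIntegral.hasDerivAt_integral_of_dominated_loc_of_deriv_le (μ := volume)
    (F := fun s x => φ x s) (a := a) (b := b) (bound := fun _ => C)
    (F' := fun s x => fderivWithin ℝ (fun p : ℝ × ℝ => φ p.1 p.2) (Icc a b ×ˢ J) (x, s) (0, 1))
    (Ioo_mem_nhds htJ.1 htJ.2) ?_ ?_ ?_ ?_ ?_ ?_).2
  · have hftc := intervalIntegral.integral_eq_sub_of_hasDerivAt_of_le hab.le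
      (f := fun y => ψ (y, φ y t) t)
      (f' := fun x => fderivWithin ℝ (fun p : ℝ × ℝ => φ p.1 p.2) (Icc a b ×ˢ J) (x, t) (0, 1))
      ?_ ?_ ?_
    · rw [hftc] at key; exact key
    · have hc := (hS.stream_contDiff t (openTime_subset T ht)).continuous
      exact hc.comp_continuousOn (continuousOn_id.prodMk (hslice t (Ioo_subset_Icc_self htJ)))
    · intro x hx
      exact hφ.hasDerivAt_stream hS hx ht (hder x (Ioo_subset_Icc_self hx) t htJ)
    · exact hDt.intervalIntegrable_of_Icc hab.le
  · filter_upwards [Ioo_mem_nhds htJ.1 htJ.2] with s hs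
    exact ((hslice s (Ioo_subset_Icc_self hs)).aestronglyMeasurable measurableSet_Icc).mono_measure
      (Measure.restrict_mono hu le_rfl)
  · exact (hslice t (Ioo_subset_Icc_self htJ)).intervalIntegrable_of_Icc hab.le
  · exact (hDt.aestronglyMeasurable measurableSet_Icc).mono_measure
      (Measure.restrict_mono hu le_rfl)
  · exact Filter.Eventually.of_forall fun x hx s hs => hC (x, s) ⟨hu hx, Ioo_subset_Icc_self hs⟩
  · exact intervalIntegrable_const
  · exact Filter.Eventually.of_forall fun x hx s hs => hder x (hu hx) s hs

lemma IsLevelCurve.continuousOn_integral (hφ : IsLevelCurve T θ a b φ g) (hab : a < b) {t : ℝ}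
    (ht : t ∈ timeInterval T) : ContinuousOn (fun s => ∫ x in a..b, φ x s) (Icc 0 t) := by
  have hc : ContinuousOn (fun p : ℝ × ℝ => φ p.1 p.2) (Icc a b ×ˢ Icc 0 t) :=
    hφ.contDiffOn.continuousOn.mono (prod_mono_right (Icc_subset_timeInterval ht))
  obtain ⟨C, hC⟩ := (isCompact_Icc.prod isCompact_Icc).exists_bound_of_continuousOn hc
  simp only [intervalIntegral.integral_of_le hab.le]
  refine continuousOn_of_dominated (bound := fun _ => C) (fun s hs => ?_) (fun s hs => ?_)
    (integrable_const C) ?_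
  · have h1 : ContinuousOn (fun x => φ x s) (Icc a b) :=
      hc.comp (f := fun x : ℝ => (x, s)) (by fun_prop) fun x hx => ⟨hx, hs⟩
    exact (h1.aestronglyMeasurable measurableSet_Icc).mono_measure
      (Measure.restrict_mono Ioc_subset_Icc_self le_rfl)
  · filter_upwards [ae_restrict_mem measurableSet_Ioc] with x hx
    exact hC (x, s) ⟨Ioc_subset_Icc_self hx, hs⟩
  · filter_upwards [ae_restrict_mem measurableSet_Ioc] with x hx
    exact hc.comp (f := fun s : ℝ => (x, s)) (by fun_prop)
      fun s hs => ⟨Ioc_subset_Icc_self hx, hs⟩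

end Stream

/-! ### Thickness of the front -/

section Front

variable {T : EReal} {θ : ℝ × ℝ → ℝ → ℝ} {a b c t : ℝ} {φ₁ φ₂ : ℝ → ℝ → ℝ}

lemma IsLevelCurve.continuousOn_slice {φ : ℝ → ℝ → ℝ} {g : ℝ} (hφ : IsLevelCurve T θ a b φ g)
    (ht : t ∈ timeInterval T) : ContinuousOn (fun x => φ x t) (Icc a b) :=
  hφ.contDiffOn.continuousOn.comp (f := fun x : ℝ => (x, t)) (by fun_prop) fun _ hx => ⟨hx, ht⟩

lemma IsSemiUniformFront.continuousOn_sub (hF : IsSemiUniformFront T θ a b c φ₁ φ₂)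
    (ht : t ∈ timeInterval T) : ContinuousOn (fun x => φ₂ x t - φ₁ x t) (Icc a b) := by
  obtain ⟨g₁, h₁⟩ := hF.levelCurve₁
  obtain ⟨g₂, h₂⟩ := hF.levelCurve₂
  exact (h₂.continuousOn_slice ht).sub (h₁.continuousOn_slice ht)

lemma minThickness_le {x : ℝ} (hx : x ∈ Icc a b) :
    minThickness a b φ₁ φ₂ t ≤ thickness φ₁ φ₂ x t := by
  refine csInf_le ⟨0, ?_⟩ ⟨x, hx, rfl⟩
  rintro _ ⟨y, _, rfl⟩
  exact abs_nonneg _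

lemma IsSemiUniformFront.thickness_le_max (hF : IsSemiUniformFront T θ a b c φ₁ φ₂)
    (ht : t ∈ timeInterval T) {x : ℝ} (hx : x ∈ Icc a b) :
    thickness φ₁ φ₂ x t ≤ maxThickness a b φ₁ φ₂ t :=
  le_csSup (isCompact_Icc.bddAbove_image (hF.continuousOn_sub ht).abs) ⟨x, hx, rfl⟩

lemma mul_le_abs_integral {u : ℝ → ℝ} (hab : a < b) (hu : ContinuousOn u (Icc a b)) {m : ℝ}
    (hm : ∀ x ∈ Icc a b, m ≤ |u x|) : (b - a) * m ≤ |∫ x in a..b, u x| := by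
  rcases le_or_gt m 0 with hm0 | hm0
  · exact (mul_nonpos_of_nonneg_of_nonpos (by linarith) hm0).trans (abs_nonneg _)
  have hsign : (∀ x ∈ Icc a b, m ≤ u x) ∨ ∀ x ∈ Icc a b, m ≤ -u x := by
    by_contra hcon
    push Not at hcon
    obtain ⟨⟨x, hx, hxm⟩, y, hy, hym⟩ := hcon
    have h1 : u x ≤ 0 := by
      rcases le_abs.mp (hm x hx) with h | h <;> linarith
    have h2 : 0 ≤ u y := by
      rcases le_abs.mp (hm y hy) with h | h <;> linarith
    obtain ⟨z, hz, hz0⟩ := isPreconnected_Icc.intermediate_value hx hy hu ⟨h1, h2⟩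
    have := hm z hz
    rw [hz0, abs_zero] at this
    linarith
  have hi : IntervalIntegrable u volume a b := hu.intervalIntegrable_of_Icc hab.le
  have hconst : ∫ _ in a..b, m = (b - a) * m := by simp
  rcases hsign with h | h
  · refine le_trans ?_ (le_abs_self _)
    rw [← hconst]
    exact intervalIntegral.integral_mono_on hab.le intervalIntegrable_const hi h
  · refine le_trans ?_ (neg_le_abs _)
    rw [← hconst, ← intervalIntegral.integral_neg]
    exact intervalIntegral.integral_mono_on hab.le intervalIntegrable_const hi.neg h

lemma IsSemiUniformFront.mul_minThickness_le (hF : IsSemiUniformFront T θ a b c φ₁ φ₂)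
    (hab : a < b) (ht : t ∈ timeInterval T) :
    (b - a) * minThickness a b φ₁ φ₂ t ≤ |∫ x in a..b, (φ₂ x t - φ₁ x t)| :=
  mul_le_abs_integral hab (hF.continuousOn_sub ht) fun _ hx => minThickness_le hx

lemma IsSemiUniformFront.abs_integral_le (hF : IsSemiUniformFront T θ a b c φ₁ φ₂)
    (hab : a < b) (ht : t ∈ timeInterval T) :
    |∫ x in a..b, (φ₂ x t - φ₁ x t)| ≤ (b - a) * maxThickness a b φ₁ φ₂ t := by
  have h := intervalIntegral.norm_integral_le_of_norm_le_const (a := a) (b := b)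
    (f := fun x => φ₂ x t - φ₁ x t) (C := maxThickness a b φ₁ φ₂ t) fun x hx => by
      rw [uIoc_of_le hab.le] at hx
      exact hF.thickness_le_max ht (Ioc_subset_Icc_self hx)
  rw [abs_of_pos (sub_pos.mpr hab), mul_comm] at h
  exact h

lemma IsSemiUniformFront.thickness_le (hF : IsSemiUniformFront T θ a b c φ₁ φ₂) (hc : 0 < c)
    (hab : a < b) (ht : t ∈ timeInterval T) {x : ℝ} (hx : x ∈ Icc a b) :
    thickness φ₁ φ₂ x t ≤ |∫ x in a..b, (φ₂ x t - φ₁ x t)| / (c * (b - a)) := by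
  have hba := sub_pos.mpr hab
  rw [le_div_iff₀ (by positivity)]
  have h1 := hF.mul_minThickness_le hab ht
  have h2 := mul_le_mul_of_nonneg_left (hF.semiUniform t ht) hba.le
  have h3 := mul_le_mul_of_nonneg_left (hF.thickness_le_max ht hx) (by positivity : 0 ≤ c * (b - a))
  nlinarith

end Front

/-! ### The differential inequality -/

/-- The double exponential barrier. -/
lemma hasDerivAt_doubleExp (A B t : ℝ) :
    HasDerivAt (fun t => Real.exp (-Real.exp (A * t + B)))
      (-(A * (Real.exp (A * t + B) * Real.exp (-Real.exp (A * t + B))))) t := by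
  have h1 : HasDerivAt (fun t => A * t + B) A t := by
    simpa using ((hasDerivAt_id t).const_mul A).add_const B
  refine h1.exp.neg.exp.congr_deriv ?_
  simp only [Pi.neg_apply]
  ring

lemma doubleExp_le_of_deriv {Y Y' : ℝ → ℝ} {κ B t : ℝ} (hκ : 0 ≤ κ) (hB : 0 ≤ B) (ht : 0 ≤ t)
    (hc : ContinuousOn Y (Icc 0 t)) (h0 : Real.exp (-Real.exp B) < Y 0)
    (hd : ∀ s ∈ Ioo 0 t, HasDerivAt Y (Y' s) s)
    (hY : ∀ s ∈ Ioo 0 t, 0 < Y s → |Y' s| ≤ κ * logMod (Y s)) :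
    Real.exp (-Real.exp ((2 * κ + 1) * t + B)) ≤ Y t := by
  rcases ht.eq_or_lt with rfl | ht0
  · simpa using h0.le
  set A := 2 * κ + 1 with hA
  set w : ℝ → ℝ := fun t => Real.exp (-Real.exp (A * t + B)) with hw
  have hwc : Continuous w := by fun_prop
  obtain ⟨t₀, ht₀, hlt⟩ : ∃ t₀ ∈ Ioo 0 t, w t₀ < Y t₀ := by
    have h1 : ContinuousWithinAt Y (Ioo 0 t) 0 :=
      (hc 0 ⟨le_rfl, ht⟩).mono Ioo_subset_Icc_self
    have h2 : ∀ᶠ s in nhdsWithin 0 (Ioo 0 t), w s < Y s := by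
      refine hwc.continuousWithinAt.eventually_lt h1 ?_
      simpa [hw] using h0
    have : (nhdsWithin (0 : ℝ) (Ioo 0 t)).NeBot := left_nhdsWithin_Ioo_neBot ht0
    obtain ⟨s, hs, hs'⟩ := (h2.and self_mem_nhdsWithin).exists
    exact ⟨s, hs', hs⟩
  have hsub : ∀ s ∈ Ico t₀ t, s ∈ Ioo 0 t := fun s hs => ⟨ht₀.1.trans_le hs.1, hs.2⟩
  refine image_le_of_deriv_right_lt_deriv_boundary' (a := t₀) (b := t) (f := w)
    (f' := fun s => -(A * (Real.exp (A * s + B) * w s)))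
    hwc.continuousOn (fun s _ => (hasDerivAt_doubleExp A B s).hasDerivWithinAt) hlt.le
    (hc.mono (Icc_subset_Icc_left ht₀.1.le))
    (fun s hs => (hd s (hsub s hs)).hasDerivWithinAt) ?_ ⟨ht₀.2.le, le_rfl⟩
  intro s hs heq
  have hs0 := hsub s hs
  have hws : 0 < w s := Real.exp_pos _
  have hL : 1 ≤ Real.exp (A * s + B) :=
    Real.one_le_exp (by have := hs0.1; positivity)
  have h1 := hY s hs0 (heq ▸ hws)
  have hlog : Real.log (1 / Y s) = Real.exp (A * s + B) := by
    rw [← heq, one_div, Real.log_inv, hw, Real.log_exp, neg_neg]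
  rw [logMod, hlog, max_eq_left (by linarith), ← heq] at h1
  have h2 := neg_le_of_abs_le h1
  set L := Real.exp (A * s + B)
  have h3 : κ * (w s * (1 + L)) ≤ 2 * κ * (L * w s) := by
    have := mul_le_mul_of_nonneg_left (show 1 + L ≤ 2 * L by linarith)
      (mul_nonneg hκ hws.le)
    nlinarith
  have h4 : 0 < L * w s := by positivity
  nlinarith

end QG

end

open QG

theorem theorem1 (ℓ c d N : ℝ) (hℓ : 0 < ℓ) (hc : 0 < c) (hd : 0 < d) (hN : 0 ≤ N) :
    ∃ A B : ℝ, ∀ (Ω : QG.Domain) (T : EReal) (θ ψ : ℝ × ℝ → ℝ → ℝ) (a b : ℝ)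
      (φ₁ φ₂ : ℝ → ℝ → ℝ),
      QG.IsSolution Ω T θ ψ →
      QG.IsSemiUniformFront T θ a b c φ₁ φ₂ →
      b - a = ℓ →
      QG.minThickness a b φ₁ φ₂ 0 = d →
      QG.normL1Linf Ω (fun x => θ x 0) = ENNReal.ofReal N →
      ∀ t ∈ QG.timeInterval T,
        Real.exp (-Real.exp (A * t + B)) < QG.minThickness a b φ₁ φ₂ t := by
  have hK := streamConst_nonneg hN
  set κ : ℝ := 4 * streamConst N / (c * ℓ) with hκ
  have hκ0 : 0 ≤ κ := by positivity
  set B₀ : ℝ := Real.log (1 + |Real.log (d / c)|) with hB₀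
  have hB₀0 : 0 ≤ B₀ := Real.log_nonneg (by linarith [abs_nonneg (Real.log (d / c))])
  have hB₀e : Real.exp B₀ = 1 + |Real.log (d / c)| := Real.exp_log (by positivity)
  refine ⟨2 * κ + 1, Real.log (Real.exp B₀ + |Real.log (c ^ 2)| + 1), ?_⟩
  intro Ω T θ ψ a b φ₁ φ₂ hS hF hba hd0 hnorm t ht
  have hab : a < b := by linarith
  have h0T := timeInterval_zero_mem ht
  obtain ⟨g₁, hφ₁⟩ := hF.levelCurve₁
  obtain ⟨g₂, hφ₂⟩ := hF.levelCurve₂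
  set I : ℝ → ℝ := fun s => ∫ x in a..b, (φ₂ x s - φ₁ x s) with hI
  have hIeq : ∀ s ∈ timeInterval T, I s = (∫ x in a..b, φ₂ x s) - ∫ x in a..b, φ₁ x s := by
    intro s hs
    exact intervalIntegral.integral_sub
      ((hφ₂.continuousOn_slice hs).intervalIntegrable_of_Icc hab.le)
      ((hφ₁.continuousOn_slice hs).intervalIntegrable_of_Icc hab.le)
  have hIc : ContinuousOn I (Icc 0 t) :=
    ((hφ₂.continuousOn_integral hab ht).sub (hφ₁.continuousOn_integral hab ht)).congr
      fun s hs => hIeq s (Icc_subset_timeInterval ht hs)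
  set I' : ℝ → ℝ := fun s => (ψ (b, φ₂ b s) s - ψ (a, φ₂ a s) s) -
    (ψ (b, φ₁ b s) s - ψ (a, φ₁ a s) s) with hI'
  have hId : ∀ s ∈ Ioo 0 t, HasDerivAt I (I' s) s := by
    intro s hs
    have hsT := Ioo_subset_openTime ht hs
    refine ((hφ₂.hasDerivAt_integral hS hab hsT).sub
      (hφ₁.hasDerivAt_integral hS hab hsT)).congr_of_eventuallyEq ?_
    filter_upwards [(isOpen_openTime T).mem_nhds hsT] with r hr
    exact hIeq r (openTime_subset T hr)
  have hIb : ∀ s ∈ Ioo 0 t, I s ≠ 0 →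
      |I' s| ≤ 4 * streamConst N * logMod (|I s| / (c * ℓ)) := by
    intro s hs hIs
    have hsT := openTime_subset T (Ioo_subset_openTime ht hs)
    have hH : 0 < |I s| / (c * ℓ) := by positivity
    have hth : ∀ x ∈ Icc a b, |φ₂ x s - φ₁ x s| ≤ |I s| / (c * ℓ) := by
      intro x hx
      rw [← hba]
      exact hF.thickness_le hc hab hsT hx
    have h1 := hS.abs_stream_sub_le hN hnorm.le hsT (r := b) hH (hth b ⟨hab.le, le_rfl⟩)
    have h2 := hS.abs_stream_sub_le hN hnorm.le hsT (r := a) hH (hth a ⟨le_rfl, hab.le⟩)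
    have e : I' s = (ψ (b, φ₂ b s) s - ψ (b, φ₁ b s) s) -
        (ψ (a, φ₂ a s) s - ψ (a, φ₁ a s) s) := by simp only [hI']; ring
    rw [e]
    refine (abs_sub _ _).trans ?_
    linarith
  have hI0 : ℓ * d ≤ |I 0| := by
    have := hF.mul_minThickness_le hab h0T
    rwa [hba, hd0] at this
  obtain ⟨σ, hσ, hσI⟩ : ∃ σ : ℝ, |σ| = 1 ∧ σ * I 0 = |I 0| := by
    rcases le_total 0 (I 0) with h | h
    · exact ⟨1, by simp, by rw [abs_of_nonneg h, one_mul]⟩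
    · exact ⟨-1, by simp, by rw [abs_of_nonpos h]; ring⟩
  have hbar := doubleExp_le_of_deriv (Y := fun s => σ / (c * ℓ) * I s)
    (Y' := fun s => σ / (c * ℓ) * I' s) hκ0 hB₀0 ht.1 (continuousOn_const.mul hIc) ?_
    (fun s hs => (hId s hs).const_mul _) ?_
  · have hYI : Real.exp (-Real.exp ((2 * κ + 1) * t + B₀)) ≤ |I t| / (c * ℓ) := by
      refine hbar.trans ((le_abs_self _).trans_eq ?_)
      rw [abs_mul, abs_div, hσ, abs_of_pos (by positivity : 0 < c * ℓ)]
      ring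
    have hmax := hF.abs_integral_le hab ht
    have hmin := hF.semiUniform t ht
    have hle : c ^ 2 * (|I t| / (c * ℓ)) ≤ minThickness a b φ₁ φ₂ t := by
      refine le_trans ?_ hmin
      rw [hba] at hmax
      calc c ^ 2 * (|I t| / (c * ℓ)) = c * (|I t| / ℓ) := by field_simp
        _ ≤ c * maxThickness a b φ₁ φ₂ t := by
            gcongr
            rw [div_le_iff₀ hℓ, mul_comm]
            exact hmax
    refine lt_of_lt_of_le ?_ ((mul_le_mul_of_nonneg_left hYI (sq_nonneg c)).trans hle)
    have hc2 : c ^ 2 = Real.exp (Real.log (c ^ 2)) := (Real.exp_log (by positivity)).symm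
    rw [hc2, ← Real.exp_add, ← hc2, Real.exp_lt_exp, Real.exp_add, Real.exp_add,
      Real.exp_log (by positivity)]
    have hE : 1 ≤ Real.exp ((2 * κ + 1) * t) :=
      Real.one_le_exp (by have := ht.1; positivity)
    have h1 := abs_nonneg (Real.log (c ^ 2))
    have h2 := neg_abs_le (Real.log (c ^ 2))
    nlinarith
  · have h1 : d / c ≤ σ / (c * ℓ) * I 0 := by
      rw [div_mul_eq_mul_div, hσI, div_le_div_iff₀ hc (by positivity)]
      nlinarith
    refine lt_of_lt_of_le ?_ h1
    rw [hB₀e, ← Real.lt_log_iff_exp_lt (by positivity)]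
    linarith [neg_abs_le (Real.log (d / c))]
  · intro s hs hpos
    have hIs : I s ≠ 0 := by
      rintro h
      simp [h] at hpos
    have e : σ / (c * ℓ) * I s = |I s| / (c * ℓ) := by
      rw [← abs_of_pos hpos, abs_mul, abs_div, hσ, abs_of_pos (by positivity : 0 < c * ℓ)]
      ring
    rw [e, abs_mul, abs_div, hσ, abs_of_pos (by positivity : 0 < c * ℓ)]
    refine (mul_le_mul_of_nonneg_left (hIb s hs hIs) (by positivity)).trans_eq ?_
    rw [hκ]; ring
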